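/- Let $G=(\mathcal R\cup\mathcal H,E)$ be a finite bipartite graph with strict preference lists on both sides, in which every hospital $h$ has an upper quota $q^+(h)$ and a lower quota $q^-(h)$. A matching is a set $M\subseteq E$ with $|M(r)|\le 1$ for $r\in\mathcal R$ and $|M(h)|\le q^+(h)$ for $h\in\mathcal H$; it is feasible if also $|M(h)|\ge q^-(h)$ for all $h$. Assume that $G$ admits a feasible matching. **Reduction.** Put $n=|\mathcal R|$ and $\ell=n+\sum_h q^-(h)$. The Hospital Residents instance $G''$ has copies $h^0,\dots,h^{\ell-1}$ of each hospital $h$, where $h^s$ has capacity $q^+(h)$ for $s<n$ and $q^-(h)$ for $s\ge n$. Its residents are $\mathcal R$ together with dummies $d^s_{h,1},d^s_{h,2},\dots$ for $0\le s\le \ell-2$, as many as the capacity of $h^s$; let $D^s_h$ be the list of these in increasing order of index. A resident $r\in\mathcal R$ has the list $\mathrm{list}_r^{\ell-1}\circ\dots\circ \mathrm{list}_r^{0}$, where $\mathrm{list}_r^{s}$ is its list in $G$ with every $h$ replaced by $h^s$. The dummy $d^s_{h,i}$ has the list $\langle h^s,h^{s+1}\rangle$, except that it is $\langle h^s\rangle$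 if $s=n-1$ and $i\le q^+(h)-q^-(h)$. The copy $h^s$ has the list $\widehat D^{s-1}_h\circ \mathrm{list}_h\circ D^s_h$, where $\widehat D^{s-1}_h$ is $D^{s-1}_h$ without the dummies that do not list $h^s$, and where $\widehat D^{-1}_h$ and $D^{\ell-1}_h$ are empty. For a stable matching $M''$ of $G''$, the set $\mathrm{map}(M'')$ consists of the edges $(r,h)$ such that $M''$ matches $r\in\mathcal R$ to some copy of $h$. **Votes.** $\mathrm{vote}_u(x,y)$ is $1$, $-1$ or $0$ according to whether $u$ prefers $x$ to $y$, prefers $y$ to $x$, or $x=y$; every neighbour is preferred to $\bot$. For matchings $M_1,M_2$, $\mathrm{vote}_r(M_1,M_2)=\mathrm{vote}_r(M_1(r),M_2(r))$ for a resident $r$, where $M_i(r)=\bot$ if $r$ is unmatched. Each hospital $h$ chooses an arbitrary bijective correspondence $\mathbf{corr}_h$ between $M_1(h)\setminus M_2(h)$ and $M_2(h)\setminus M_1(h)$, the smaller of the two being padded with copies of $\bot$, and the same correspondence is used when $M_1$ and $M_2$ are exchanged; $\mathrm{vote}_h(M_1,M_2)$ is the sum of $\mathrm{vote}_h$ over the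 corresponding pairs. Let $\Delta(M_1,M_2)=\sum_{v\in\mathcal R\cup\mathcal H}\mathrm{vote}_v(M_1,M_2)$; $M_1$ is more popular than $M_2$ if $\Delta(M_1,M_2)>\Delta(M_2,M_1)$. **Decomposition.** For a feasible matching $N$, the edges of $M\oplus N$ are decomposed into (possibly non-simple) maximal alternating paths and cycles, by making consecutive the two edges at a resident, and, at a hospital, an edge of $M\setminus N$ and an edge of $N\setminus M$ whose residents correspond to each other under a correspondence between $M(h)\setminus N(h)$ and $N(h)\setminus M(h)$ as above. An end-point of a path counts as matched in $M$ if the terminal edge of the path there is in $M$. **Theorem.** Let $M''$ be any stable matching of $G''$ and $M=\mathrm{map}(M'')$. 1. Let $N$ be a feasible matching, and let $\rho$ be an alternating cycle, or an alternating path with exactly one end-point matched in $M$, in the decomposition of $M\oplus N$. Then $M\oplus\rho$ is a feasible matching and $\Delta(M\oplus\rho,M)\le\Delta(M,M\oplus\rho)$. This holds for every choice of the correspondences, and the ones used for decomposing may differ from the ones used for voting. 2. For every choice of the correspondences, $M$ is popular among the maximum-cardinality feasible matchings: $M$ is feasible, no feasible matching has more edges, and no maximum-cardinality feasible matching is more popular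 than $M$. 3. Such an $M$ is computable in polynomial time: there are a program of a random access machine (unit-cost addition and truncated subtraction of natural numbers, indirect load and store, branches and loops) and a polynomial $p$ such that, for every instance $G$ that admits a feasible matching, given as a sequence of $L$ numbers (the numbers of residents and hospitals, the quotas, and the preference lists preceded by their lengths), the program halts after at most $p(L)$ steps with output $\mathrm{map}(M'')$ for some stable matching $M''$ of $G''$. -/

import Mathlib

open scoped symmDiff

universe u v

/-- A Hospital Residents instance: strict preference lists of residents and hospitals (which
determine the edges of the bipartite graph) and capacities of the hospitals. -/
structure HR (R : Type u) (H : Type v) where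
  resList : R → List H
  hospList : H → List R
  upper : H → ℕ
  resList_nodup : ∀ r, (resList r).Nodup
  hospList_nodup : ∀ h, (hospList h).Nodup
  mem_iff : ∀ r h, h ∈ resList r ↔ r ∈ hospList h

/-- A Hospital Residents instance with lower quotas; `upper` and `lower` are `q⁺` and `q⁻`. -/
structure HRLQ (R : Type u) (H : Type v) extends HR R H where
  lower : H → ℕ

/-- On a preference list, `x` is strictly preferred to `y`. -/
def Prefers {α : Type*} [DecidableEq α] (l : List α) (x y : α) : Prop :=
  x ∈ l ∧ y ∈ l ∧ l.idxOf x < l.idxOf y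

instance {α : Type*} [DecidableEq α] (l : List α) (x y : α) : Decidable (Prefers l x y) := by
  unfold Prefers; infer_instance

/-- `vote_u(x, y)` for a vertex `u` with preference list `l`; `none` is `⊥`. -/
def vote {α : Type*} [DecidableEq α] (l : List α) : Option α → Option α → ℤ
  | some x, some y => if Prefers l x y then 1 else if Prefers l y x then -1 else 0
  | some _, none => 1
  | none, some _ => -1
  | none, none => 0

section Sets

variable {R : Type u} {H : Type v} [DecidableEq R] [DecidableEq H]

/-- `M(h)`: the residents assigned to `h`. -/
def residentsOf (M : Finset (R × H)) (h : H) : Finset R :=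
  (M.filter (fun e => e.2 = h)).image Prod.fst

open Classical in
/-- `M(r)`: the hospital of `r`, or `none` (`⊥`) if `r` is unmatched. -/
noncomputable def partner (M : Finset (R × H)) (r : R) : Option H :=
  if hx : ∃ h, (r, h) ∈ M then some hx.choose else none

/-- A matching of an HR instance: a set of edges respecting the capacities. -/
def HR.IsMatching (G : HR R H) (M : Finset (R × H)) : Prop :=
  (∀ e ∈ M, e.2 ∈ G.resList e.1) ∧
  (∀ r h h', (r, h) ∈ M → (r, h') ∈ M → h = h') ∧
  (∀ h, (residentsOf M h).card ≤ G.upper h)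

/-- The edge `(r, h)` blocks `M`. -/
def HR.Blocks (G : HR R H) (M : Finset (R × H)) (r : R) (h : H) : Prop :=
  h ∈ G.resList r ∧
  ((∀ h', (r, h') ∉ M) ∨ ∃ h', (r, h') ∈ M ∧ Prefers (G.resList r) h h') ∧
  ((residentsOf M h).card < G.upper h ∨ ∃ r' ∈ residentsOf M h, Prefers (G.hospList h) r r')

def HR.IsStable (G : HR R H) (M : Finset (R × H)) : Prop :=
  G.IsMatching M ∧ ∀ r h, ¬ G.Blocks M r h

def HRLQ.IsFeasible (G : HRLQ R H) (M : Finset (R × H)) : Prop :=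
  G.toHR.IsMatching M ∧ ∀ h, G.lower h ≤ (residentsOf M h).card

def HRLQ.IsMaxFeasible (G : HRLQ R H) (M : Finset (R × H)) : Prop :=
  G.IsFeasible M ∧ ∀ N, G.IsFeasible N → N.card ≤ M.card

/-- The correspondences `corr_h(·, M₁, M₂)` chosen by the hospitals: for every hospital `h` and
all `M₁, M₂` an arbitrary pairing of `M₁(h) \ M₂(h)` with `M₂(h) \ M₁(h)`. The smaller of the
two sets is padded with `⊥` (`none`), so only the larger one has elements paired with `⊥`. -/
structure Correspondence (R : Type u) (H : Type v) [DecidableEq R] [DecidableEq H] where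
  corr : H → Finset (R × H) → Finset (R × H) → R → Option R
  pairing : ∀ h M₁ M₂ r r', r ∈ residentsOf M₁ h \ residentsOf M₂ h →
    corr h M₁ M₂ r = some r' →
    r' ∈ residentsOf M₂ h \ residentsOf M₁ h ∧ corr h M₂ M₁ r' = some r
  one_sided : ∀ h M₁ M₂ r r', r ∈ residentsOf M₁ h \ residentsOf M₂ h →
    r' ∈ residentsOf M₂ h \ residentsOf M₁ h →
    ¬ (corr h M₁ M₂ r = none ∧ corr h M₂ M₁ r' = none)

/-- `vote_h(M₁, M₂)`: the residents of `M₁(h) \ M₂(h)` are compared with their correspondents,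
and the empty positions of `M₁` with the residents of `M₂(h) \ M₁(h)` paired with `⊥`. -/
def HR.hospVote (G : HR R H) (τ : Correspondence R H) (M₁ M₂ : Finset (R × H)) (h : H) : ℤ :=
  ∑ r ∈ residentsOf M₁ h \ residentsOf M₂ h,
      vote (G.hospList h) (some r) (τ.corr h M₁ M₂ r) +
    ∑ r ∈ (residentsOf M₂ h \ residentsOf M₁ h).filter (fun r => τ.corr h M₂ M₁ r = none),
      vote (G.hospList h) none (some r)

/-- `Δ(M₁, M₂)`: the sum of the votes of all vertices for `M₁` against `M₂`. -/
noncomputable def HR.votes [Fintype R] [Fintype H] (G : HR R H) (τ : Correspondence R H)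
    (M₁ M₂ : Finset (R × H)) : ℤ :=
  ∑ r, vote (G.resList r) (partner M₁ r) (partner M₂ r) + ∑ h, G.hospVote τ M₁ M₂ h

def HR.MorePopular [Fintype R] [Fintype H] (G : HR R H) (τ : Correspondence R H)
    (M₁ M₂ : Finset (R × H)) : Prop :=
  G.votes τ M₁ M₂ > G.votes τ M₂ M₁

/-- `M` is a maximum-cardinality feasible matching, and no maximum-cardinality feasible matching
is more popular. -/
def HRLQ.IsPopularAmongMaxFeasible [Fintype R] [Fintype H] (G : HRLQ R H)
    (τ : Correspondence R H) (M : Finset (R × H)) : Prop :=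
  G.IsMaxFeasible M ∧ ∀ N, G.IsMaxFeasible N → ¬ G.toHR.MorePopular τ N M

/-- Two edges of `M ⊕ N` are consecutive in the decomposition of `M ⊕ N`: they are the two edges
at a resident, or an edge of `M` and an edge of `N` at a hospital whose residents correspond to
each other. -/
def Linked (σ : Correspondence R H) (M N : Finset (R × H)) (e f : R × H) : Prop :=
  e ∈ M ∆ N ∧ f ∈ M ∆ N ∧ e ≠ f ∧
  (e.1 = f.1 ∨ e.2 = f.2 ∧
    ((e ∈ M ∧ f ∈ N ∧ σ.corr e.2 M N e.1 = some f.1) ∨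
     (e ∈ N ∧ f ∈ M ∧ σ.corr e.2 M N f.1 = some e.1)))

/-- The list of edges `ρ` closes up (at least three edges are required, as the two edges of a
path of length two are linked to each other). -/
def ClosesUp (σ : Correspondence R H) (M N : Finset (R × H)) (ρ : List (R × H)) : Prop :=
  2 < ρ.length ∧ ∀ e ∈ ρ.getLast?, ∀ f ∈ ρ.head?, Linked σ M N e f

/-- `ρ` lists the edges of an alternating cycle of the decomposition of `M ⊕ N`. -/
def IsAltCycle (σ : Correspondence R H) (M N : Finset (R × H)) (ρ : List (R × H)) : Prop :=
  ρ.Nodup ∧ ρ.IsChain (Linked σ M N) ∧ ClosesUp σ M N ρ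

/-- `ρ` lists the edges of a (maximal) alternating path of the decomposition of `M ⊕ N`. -/
def IsAltPath (σ : Correspondence R H) (M N : Finset (R × H)) (ρ : List (R × H)) : Prop :=
  ρ ≠ [] ∧ ρ.Nodup ∧ (∀ e ∈ ρ, e ∈ M ∆ N) ∧ ρ.IsChain (Linked σ M N) ∧ ¬ ClosesUp σ M N ρ ∧
  ∀ e ∈ ρ, ∀ f, Linked σ M N e f → f ∈ ρ

/-- Exactly one end-point of the path `ρ` is matched in `M`. The position of an end-point on the
path is matched in `M` if and only if the terminal edge of `ρ` there belongs to `M`: at a terminal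
edge of `N` the end-point is an unmatched resident, or a hospital with an empty position in `M`. -/
def OneEndMatched (M : Finset (R × H)) (ρ : List (R × H)) : Prop :=
  ∃ e ∈ ρ.head?, ∃ f ∈ ρ.getLast?, Xor (e ∈ M) (f ∈ M)

end Sets

section Reduction

variable {R : Type u} {H : Type v} [Fintype R] [Fintype H]

/-- The number `ℓ` of copies of each hospital. -/
def HRLQ.numLevels (G : HRLQ R H) : ℕ := Fintype.card R + ∑ h, G.lower h

/-- The capacity of the level-`s` copy of `h`, also the number of its level-`s` dummies. -/
def HRLQ.levelCap (G : HRLQ R H) (h : H) (s : ℕ) : ℕ :=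
  if s < Fintype.card R then G.upper h else G.lower h

/-- The dummy residents `d^s_{h,i}` with `0 ≤ s ≤ ℓ - 2` and (counting from zero)
`0 ≤ i < levelCap h s`. -/
abbrev HRLQ.Dummy (G : HRLQ R H) : Type v :=
  Σ h : H, Σ s : Fin (G.numLevels - 1), Fin (G.levelCap h s)

/-- The residents of the reduced instance. -/
abbrev HRLQ.Res (G : HRLQ R H) : Type (max u v) := R ⊕ G.Dummy

/-- The hospitals of the reduced instance; `(h, s)` is the level-`s` copy of `h`. -/
abbrev HRLQ.Copy (G : HRLQ R H) : Type v := H × Fin G.numLevels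

/-- The list of the level-`s` dummies of `h` with index at least `k`, in increasing order. -/
def HRLQ.dummies (G : HRLQ R H) (h : H) (s : Fin (G.numLevels - 1)) (k : ℕ) : List G.Res :=
  ((List.finRange (G.levelCap h s)).filter (fun i => k ≤ i.val)).map (fun i => Sum.inr ⟨h, s, i⟩)

/-- The number of first level-`s` dummies of `h` that list only the level-`s` copy: it is
`q⁺(h) - q⁻(h)` at the last level of capacity `q⁺(h)`, and zero at the other levels. -/
def HRLQ.numShort (G : HRLQ R H) (h : H) (s : ℕ) : ℕ :=
  if s + 1 = Fintype.card R then G.upper h - G.lower h else 0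

/-- Preference lists of the residents: `list_r^{ℓ-1} ∘ ⋯ ∘ list_r^0` for a resident `r`,
`⟨h^s⟩` or `⟨h^s, h^{s+1}⟩` for a dummy. -/
def HRLQ.redResList (G : HRLQ R H) : G.Res → List G.Copy
  | Sum.inl r => (List.finRange G.numLevels).reverse.flatMap
      (fun s => (G.resList r).map (fun h => (h, s)))
  | Sum.inr ⟨h, s, i⟩ =>
      if i.val < G.numShort h s then [(h, ⟨s.val, by omega⟩)]
      else [(h, ⟨s.val, by omega⟩), (h, ⟨s.val + 1, by omega⟩)]

/-- Preference list of `h^s`: the level-`(s-1)` dummies that list it, then `list_h`, then the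
level-`s` dummies. -/
def HRLQ.redHospList (G : HRLQ R H) (c : G.Copy) : List G.Res :=
  (if hs : 0 < c.2.val then
      G.dummies c.1 ⟨c.2.val - 1, by omega⟩ (G.numShort c.1 (c.2.val - 1)) else []) ++
  ((G.hospList c.1).map Sum.inl ++
  (if hs : c.2.val + 1 < G.numLevels then G.dummies c.1 ⟨c.2.val, by omega⟩ 0 else []))

theorem HRLQ.mem_dummies (G : HRLQ R H) (x : G.Res) (h : H) (s : Fin (G.numLevels - 1)) (k : ℕ) :
    x ∈ G.dummies h s k ↔ ∃ i, k ≤ i.val ∧ x = Sum.inr ⟨h, s, i⟩ := by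
  simp [HRLQ.dummies, eq_comm]

theorem HRLQ.dummies_nodup (G : HRLQ R H) (h : H) (s : Fin (G.numLevels - 1)) (k : ℕ) :
    (G.dummies h s k).Nodup := by
  refine List.Nodup.map ?_ ((List.nodup_finRange _).filter _)
  intro i j hij
  simpa using hij

theorem HRLQ.redResList_nodup (G : HRLQ R H) (x : G.Res) : (G.redResList x).Nodup := by
  rcases x with r | ⟨h, s, i⟩
  · simp only [HRLQ.redResList]
    rw [List.nodup_flatMap]
    refine ⟨fun s _ => (G.resList_nodup r).map (fun a b hab => by simpa using hab), ?_⟩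
    have hn : (List.finRange G.numLevels).reverse.Nodup :=
      List.nodup_reverse.2 (List.nodup_finRange _)
    refine hn.imp ?_
    intro a b hab
    simp only [Function.onFun]
    intro c hc hc'
    simp only [List.mem_map] at hc hc'
    obtain ⟨_, _, rfl⟩ := hc
    obtain ⟨_, _, h2⟩ := hc'
    exact hab (Prod.ext_iff.1 h2).2.symm
  · simp only [HRLQ.redResList]
    split_ifs <;> simp

theorem HRLQ.redHospList_nodup (G : HRLQ R H) (c : G.Copy) : (G.redHospList c).Nodup := by
  obtain ⟨h, s⟩ := c
  simp only [HRLQ.redHospList]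
  have hm : ((G.hospList h).map (Sum.inl : R → G.Res)).Nodup :=
    (G.hospList_nodup h).map Sum.inl_injective
  rw [List.nodup_append', List.nodup_append']
  refine ⟨?_, ⟨hm, ?_, ?_⟩, ?_⟩
  · split_ifs
    · exact G.dummies_nodup _ _ _
    · simp
  · split_ifs
    · exact G.dummies_nodup _ _ _
    · simp
  · intro x hx hx'
    split_ifs at hx'
    · simp only [List.mem_map] at hx
      obtain ⟨r, _, rfl⟩ := hx
      simp [HRLQ.mem_dummies] at hx'
    · simp at hx'
  · intro x hx hx'
    split_ifs at hx with h1
    · rw [HRLQ.mem_dummies] at hx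
      obtain ⟨i, _, rfl⟩ := hx
      rw [List.mem_append] at hx'
      rcases hx' with hx' | hx'
      · simp at hx'
      · split_ifs at hx'
        · rw [HRLQ.mem_dummies] at hx'
          obtain ⟨j, _, hj⟩ := hx'
          simp only [Sum.inr.injEq, Sigma.mk.injEq, heq_eq_eq, true_and] at hj
          have := congrArg Fin.val hj.1
          simp at this
          omega
        · simp at hx'
    · simp at hx

theorem HRLQ.red_mem_iff (G : HRLQ R H) (x : G.Res) (c : G.Copy) :
    c ∈ G.redResList x ↔ x ∈ G.redHospList c := by
  obtain ⟨h, s⟩ := c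
  have key : ∀ (x : G.Res), x ∈ G.redHospList (h, s) ↔
      ((∃ hs : 0 < s.val, ∃ i : Fin (G.levelCap h (s.val - 1)), G.numShort h (s.val - 1) ≤ i.val ∧
        x = Sum.inr ⟨h, ⟨s.val - 1, by omega⟩, i⟩) ∨ (∃ r ∈ G.hospList h, Sum.inl r = x) ∨
      (∃ hs : s.val + 1 < G.numLevels, ∃ i : Fin (G.levelCap h s.val), x = Sum.inr ⟨h, ⟨s.val, by omega⟩, i⟩)) := by
    intro x
    simp only [HRLQ.redHospList, List.mem_append, List.mem_map]
    refine or_congr ?_ (or_congr Iff.rfl ?_)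
    · split_ifs with h1 <;> simp [HRLQ.mem_dummies, h1]
    · split_ifs with h1 <;> simp [HRLQ.mem_dummies, h1]
  rw [key]
  rcases x with r | ⟨h', s', i⟩
  · simp [HRLQ.redResList, G.mem_iff]
  · constructor
    · intro hc
      simp only [HRLQ.redResList] at hc
      split_ifs at hc with h1
      · simp only [List.mem_singleton, Prod.mk.injEq] at hc
        obtain ⟨rfl, rfl⟩ := hc
        exact Or.inr (Or.inr ⟨by simp only; omega, i, rfl⟩)
      · simp only [List.mem_cons, Prod.mk.injEq, List.not_mem_nil, or_false] at hc
        rcases hc with ⟨rfl, rfl⟩ | ⟨rfl, rfl⟩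
        · exact Or.inr (Or.inr ⟨by simp only; omega, i, rfl⟩)
        · exact Or.inl ⟨by simp, i, by simpa using h1, rfl⟩
    · rintro (⟨hs, j, hj, hx⟩ | ⟨r, _, hr⟩ | ⟨hs, j, hx⟩)
      · simp only [Sum.inr.injEq] at hx
        cases hx
        simp only [HRLQ.redResList]
        rw [if_neg (by omega)]
        simp only [List.mem_cons, Prod.mk.injEq, Fin.ext_iff, true_and]
        right; left; omega
      · cases hr
      · simp only [Sum.inr.injEq] at hx
        cases hx
        simp only [HRLQ.redResList]
        split_ifs <;> simp

/-- The reduced Hospital Residents instance `G''`. -/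
def HRLQ.reduction (G : HRLQ R H) : HR G.Res G.Copy where
  resList := G.redResList
  hospList := G.redHospList
  upper := fun c => G.levelCap c.1 c.2
  resList_nodup := G.redResList_nodup
  hospList_nodup := G.redHospList_nodup
  mem_iff := G.red_mem_iff

open Classical in
/-- `map(M'')`: a resident is matched to `h` if it is matched to some copy of `h`. -/
noncomputable def HRLQ.mapBack (G : HRLQ R H)
    (M : Finset (G.Res × G.Copy)) : Finset (R × H) :=
  Finset.univ.filter (fun e => ∃ s : Fin G.numLevels, ((Sum.inl e.1 : G.Res), ((e.2, s) : G.Copy)) ∈ M)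

end Reduction

section Machine

/-- Programs of a random access machine with registers and a memory, both holding natural
numbers and indexed by natural numbers. There is no multiplication, so that a number of steps
bounds the growth of the stored numbers (at most one more bit in each step). -/
inductive RamProgram : Type
  /-- `reg x := c` -/
  | const (x c : ℕ)
  /-- `reg x := reg y + reg z` -/
  | plus (x y z : ℕ)
  /-- `reg x := reg y - reg z` (truncated) -/
  | minus (x y z : ℕ)
  /-- `reg x := mem (reg y)` -/
  | load (x y : ℕ)
  /-- `mem (reg x) := reg y` -/
  | store (x y : ℕ)
  /-- run `p`, then `q` -/
  | seq (p q : RamProgram)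
  /-- run `p` if `reg x ≠ 0`, otherwise `q` -/
  | branch (x : ℕ) (p q : RamProgram)
  /-- as long as `reg x ≠ 0`, run `p` -/
  | loop (x : ℕ) (p : RamProgram)

structure RamState where
  reg : ℕ → ℕ
  mem : ℕ → ℕ

def RamState.setReg (s : RamState) (x v : ℕ) : RamState :=
  { s with reg := Function.update s.reg x v }

def RamState.setMem (s : RamState) (a v : ℕ) : RamState :=
  { s with mem := Function.update s.mem a v }

/-- `p.Runs s t s'`: started in state `s`, the program `p` halts in state `s'` after exactly `t`
steps. Every elementary instruction and every test is one step. -/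
inductive RamProgram.Runs : RamProgram → RamState → ℕ → RamState → Prop
  | const (x c : ℕ) (s : RamState) : Runs (.const x c) s 1 (s.setReg x c)
  | plus (x y z : ℕ) (s : RamState) : Runs (.plus x y z) s 1 (s.setReg x (s.reg y + s.reg z))
  | minus (x y z : ℕ) (s : RamState) : Runs (.minus x y z) s 1 (s.setReg x (s.reg y - s.reg z))
  | load (x y : ℕ) (s : RamState) : Runs (.load x y) s 1 (s.setReg x (s.mem (s.reg y)))
  | store (x y : ℕ) (s : RamState) : Runs (.store x y) s 1 (s.setMem (s.reg x) (s.reg y))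
  | seq (p q : RamProgram) (s s' s'' : RamState) (t t' : ℕ) :
      Runs p s t s' → Runs q s' t' s'' → Runs (.seq p q) s (t + t') s''
  | branch_pos (x : ℕ) (p q : RamProgram) (s s' : RamState) (t : ℕ) :
      s.reg x ≠ 0 → Runs p s t s' → Runs (.branch x p q) s (t + 1) s'
  | branch_zero (x : ℕ) (p q : RamProgram) (s s' : RamState) (t : ℕ) :
      s.reg x = 0 → Runs q s t s' → Runs (.branch x p q) s (t + 1) s'
  | loop_zero (x : ℕ) (p : RamProgram) (s : RamState) :
      s.reg x = 0 → Runs (.loop x p) s 1 s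
  | loop_pos (x : ℕ) (p : RamProgram) (s s' s'' : RamState) (t t' : ℕ) :
      s.reg x ≠ 0 → Runs p s t s' → Runs (.loop x p) s' t' s'' →
      Runs (.loop x p) s (t + t' + 1) s''

/-- The input encoding of an instance with `n` residents and `m` hospitals: `n`, `m`, the upper
quotas, the lower quotas, then the preference lists of the residents and of the hospitals, each
preceded by its length. -/
def HRLQ.encode {n m : ℕ} (G : HRLQ (Fin n) (Fin m)) : List ℕ :=
  [n, m] ++ List.ofFn G.upper ++ List.ofFn G.lower ++
  (List.finRange n).flatMap (fun r => (G.resList r).length :: (G.resList r).map Fin.val) ++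
  (List.finRange m).flatMap (fun h => (G.hospList h).length :: (G.hospList h).map Fin.val)

/-- The initial state: the input stands at the beginning of the memory, all else is zero. -/
def RamState.init (input : List ℕ) : RamState where
  reg := fun _ => 0
  mem := fun a => input.getD a 0

/-- The output encoding of a matching: cell `r` holds `0` if the resident `r` is unmatched, and
`h + 1` if `r` is matched to the hospital `h`. -/
def RamState.Outputs {n m : ℕ} (s : RamState) (M : Finset (Fin n × Fin m)) : Prop :=
  ∀ r : Fin n, s.mem r.val = (partner M r).elim 0 (fun h => h.val + 1)

end Machine

/-! A stable matching of `G''` is summarised by the placement that sends a resident to the hospital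
and the level of its copy. Below the top level every copy is full, so a resident in `h^t` pushes a
dummy on to `h^{t+1}`, where the dummy takes a place in turn. Residents at lower levels therefore
count against the capacity of `h^s`, and the copies of `h` act as one hospital that serves lower
levels first and, within a level, follows its own preferences. The number served is measured by `q⁺`
at the levels below `n` and by `q⁻` from `n` on; the shortened dummies at level `n - 1` make this
change of capacity consistent. This is `HRLQ.LevelStable`. It is extracted from a stable matching by
`levelStable_placeOf` and turned back into one by `stableOf_isStable`, so that all other arguments
concern placements only.

Popularity: levels serve as dual weights. If the edge `(r, h)` of `N \ M` is paired at `h` with a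
resident of level `j`, the votes of `r` and `h` add up to at most twice the level of `r` minus `j`
(`vote_add_vote_le`). An empty position of `h` is treated as a resident of level `n - 1`. Summed
over all edges, the levels cancel and at most `2(n-1)(|M| - |N|)` remains, so no feasible `N` with
`|N| ≥ |M|` beats `M` (`votes_nonpos`). This yields both popularity claims. A maximum feasible
matching satisfies the condition, and so does `M ⊕ ρ`: components of the decomposition respect the
correspondence, hence the quotas, and an alternating list whose terminal edges lie in different
matchings preserves the cardinality.

Feasibility and maximality: fix a feasible `N` and let `X s` be the residents of level at least `s`
whose edge of `M` is not in `N`. If some hospital is deficient, `|X s|` drops strictly at each of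
the `∑ q⁻` levels from `n` on, which is more than the residents at those levels allow. If `|N| >
|M|`, it drops at each of the first `n` levels, so all residents are matched in `M`, a
contradiction. The step is `movers_step`.

Computation: deferred acceptance runs directly on placements, without dummies. Every resident starts
at the top level and goes down. Its stuck configurations are level stable, and feasibility gives `ℓ
≤ 2n`, so a potential bounds the number of moves polynomially. -/

set_option linter.unusedSectionVars false

/-! ### Placements of residents at levelled copies, and level stability. -/

section Placements

variable {R : Type u} {H : Type v} [Fintype R] [Fintype H] [DecidableEq R] [DecidableEq H]

open Classical in
/-- The edges of a placement of the residents at levelled copies of the hospitals. -/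
noncomputable def edgesOf (pl : R → Option (H × ℕ)) : Finset (R × H) :=
  Finset.univ.filter (fun e => ∃ s, pl e.1 = some (e.2, s))

open Classical in
/-- The residents placed at `h` before `(s, r)`: at a lower level, or at level `s` and preferred
to `r`. -/
noncomputable def HRLQ.above (G : HRLQ R H) (pl : R → Option (H × ℕ)) (h : H) (s : ℕ) (r : R) :
    Finset R :=
  Finset.univ.filter (fun r' => ∃ t, pl r' = some (h, t) ∧
    (t < s ∨ t = s ∧ Prefers (G.hospList h) r' r))

open Classical in
/-- The residents placed at `h` at a level at most `s`. -/
noncomputable def upTo (pl : R → Option (H × ℕ)) (h : H) (s : ℕ) : Finset R :=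
  Finset.univ.filter (fun r' => ∃ t, pl r' = some (h, t) ∧ t ≤ s)

/-- `r` prefers the level-`s` copy of `h` to its place. -/
def HRLQ.Desires (G : HRLQ R H) (pl : R → Option (H × ℕ)) (r : R) (h : H) (s : ℕ) : Prop :=
  h ∈ G.resList r ∧ ∀ h' t, pl r = some (h', t) → t < s ∨ t = s ∧ Prefers (G.resList r) h h'

/-- The conditions on the places of the residents in a stable matching of the reduced instance. -/
structure HRLQ.LevelStable (G : HRLQ R H) (pl : R → Option (H × ℕ)) : Prop where
  valid : ∀ r h s, pl r = some (h, s) → h ∈ G.resList r ∧ s < G.numLevels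
  keep : ∀ r h s, pl r = some (h, s) → (G.above pl h s r).card < G.levelCap h s
  full : ∀ r h s, s < G.numLevels → G.Desires pl r h s →
    G.levelCap h s ≤ (G.above pl h s r).card

theorem Prefers.trichotomy {α : Type*} [DecidableEq α] {l : List α} {x y : α} (hx : x ∈ l)
    (hy : y ∈ l) (hne : x ≠ y) : Prefers l x y ∨ Prefers l y x := by
  rcases lt_trichotomy (l.idxOf x) (l.idxOf y) with h | h | h
  · exact Or.inl ⟨hx, hy, h⟩
  · exact absurd ((List.idxOf_inj hx).1 h) hne
  · exact Or.inr ⟨hy, hx, h⟩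

theorem Prefers.asymm {α : Type*} [DecidableEq α] {l : List α} {x y : α} (h : Prefers l x y) :
    ¬ Prefers l y x := fun h' => absurd h.2.2 (not_lt.2 h'.2.2.le)

theorem Prefers.ne {α : Type*} [DecidableEq α] {l : List α} {x y : α} (h : Prefers l x y) :
    x ≠ y := by
  rintro rfl; exact lt_irrefl _ h.2.2

theorem vote_le_one {α : Type*} [DecidableEq α] (l : List α) (x y : Option α) : vote l x y ≤ 1 := by
  rcases x with _ | x <;> rcases y with _ | y <;> simp only [vote] <;> (try split_ifs) <;> norm_num

theorem vote_eq_neg_one {α : Type*} [DecidableEq α] {l : List α} {x y : α} (h : Prefers l y x) :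
    vote l (some x) (some y) = -1 := by
  simp only [vote, if_neg h.asymm, if_pos h]

theorem vote_swap {α : Type*} [DecidableEq α] (l : List α) (x y : Option α) :
    vote l x y = - vote l y x := by
  rcases x with _ | x <;> rcases y with _ | y <;> simp only [vote]
  · simp
  · simp
  · by_cases h : Prefers l x y
    · simp [h, h.asymm]
    · simp only [if_neg h]; split_ifs <;> simp

theorem vote_self {α : Type*} [DecidableEq α] (l : List α) (x : Option α) : vote l x x = 0 := by
  have := vote_swap l x x; omega

theorem mem_residentsOf {M : Finset (R × H)} {h : H} {r : R} :
    r ∈ residentsOf M h ↔ (r, h) ∈ M := by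
  simp [residentsOf]

theorem mem_edgesOf {pl : R → Option (H × ℕ)} {r : R} {h : H} :
    (r, h) ∈ edgesOf pl ↔ ∃ s, pl r = some (h, s) := by
  simp [edgesOf]

theorem mem_upTo {pl : R → Option (H × ℕ)} {h : H} {s : ℕ} {r : R} :
    r ∈ upTo pl h s ↔ ∃ t, pl r = some (h, t) ∧ t ≤ s := by
  simp [upTo]

theorem HRLQ.mem_above {G : HRLQ R H} {pl : R → Option (H × ℕ)} {h : H} {s : ℕ} {r r' : R} :
    r' ∈ G.above pl h s r ↔
      ∃ t, pl r' = some (h, t) ∧ (t < s ∨ t = s ∧ Prefers (G.hospList h) r' r) := by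
  simp [HRLQ.above]

theorem partner_eq_some {M : Finset (R × H)} (hM : ∀ r h h', (r, h) ∈ M → (r, h') ∈ M → h = h')
    {r : R} {h : H} (hr : (r, h) ∈ M) : partner M r = some h := by
  have hx : ∃ h, (r, h) ∈ M := ⟨h, hr⟩
  rw [partner, dif_pos hx, hM _ _ _ hx.choose_spec hr]

theorem partner_eq_none {M : Finset (R × H)} {r : R} (hr : ∀ h, (r, h) ∉ M) :
    partner M r = none := by
  rw [partner, dif_neg (by simpa using hr)]

theorem mem_of_partner_eq_some {M : Finset (R × H)} {r : R} {h : H} (hr : partner M r = some h) :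
    (r, h) ∈ M := by
  rw [partner] at hr
  split_ifs at hr with hx
  obtain rfl : hx.choose = h := by simpa using hr
  exact hx.choose_spec

theorem edgesOf_unique (pl : R → Option (H × ℕ)) (r : R) (h h' : H) (hr : (r, h) ∈ edgesOf pl)
    (hr' : (r, h') ∈ edgesOf pl) : h = h' := by
  rw [mem_edgesOf] at hr hr'
  obtain ⟨s, hs⟩ := hr
  obtain ⟨s', hs'⟩ := hr'
  rw [hs] at hs'
  simp only [Option.some.injEq, Prod.mk.injEq] at hs'
  exact hs'.1

theorem partner_edgesOf (pl : R → Option (H × ℕ)) (r : R) :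
    partner (edgesOf pl) r = (pl r).map Prod.fst := by
  rcases hp : pl r with _ | ⟨h, s⟩
  · exact partner_eq_none fun h => by rw [mem_edgesOf]; simp [hp]
  · exact partner_eq_some (edgesOf_unique pl) (mem_edgesOf.2 ⟨s, hp⟩)

theorem HRLQ.levelCap_anti (G : HRLQ R H) (hq : ∀ h, G.lower h ≤ G.upper h) (h : H) {s t : ℕ}
    (hst : s ≤ t) : G.levelCap h t ≤ G.levelCap h s := by
  unfold HRLQ.levelCap
  have := hq h
  split_ifs <;> omega

theorem HRLQ.IsFeasible.lower_le_upper {G : HRLQ R H} {N : Finset (R × H)} (hN : G.IsFeasible N)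
    (h : H) : G.lower h ≤ G.upper h := (hN.2 h).trans (hN.1.2.2 h)

theorem sum_card_residentsOf (M : Finset (R × H)) : ∑ h, (residentsOf M h).card = M.card := by
  rw [Finset.card_eq_sum_card_fiberwise (f := Prod.snd) (t := Finset.univ) (by simp)]
  refine Finset.sum_congr rfl fun h _ => ?_
  rw [residentsOf, Finset.card_image_of_injOn]
  rintro ⟨a, b⟩ hx ⟨c, d⟩ hy hxy
  simp at hx hy hxy
  simp [hx.2, hy.2, hxy]

theorem HR.IsMatching.card_le {G : HR R H} {N : Finset (R × H)} (hN : G.IsMatching N) :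
    N.card ≤ Fintype.card R := by
  rw [← Finset.card_image_of_injOn (f := Prod.fst) (s := N)]
  · exact Finset.card_le_univ _
  · rintro ⟨a, b⟩ hx ⟨c, d⟩ hy hxy
    obtain rfl : a = c := hxy
    rw [hN.2.1 a b d hx hy]

theorem HRLQ.IsFeasible.sum_lower_le {G : HRLQ R H} {N : Finset (R × H)} (hN : G.IsFeasible N) :
    ∑ h, G.lower h ≤ Fintype.card R :=
  (Finset.sum_le_sum fun h _ => hN.2 h).trans ((sum_card_residentsOf N).le.trans hN.1.card_le)

namespace HRLQ.LevelStable

variable {G : HRLQ R H} {pl : R → Option (H × ℕ)}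

theorem mem_hospList (hp : G.LevelStable pl) {r : R} {h : H} {s : ℕ} (hr : pl r = some (h, s)) :
    r ∈ G.hospList h := (G.mem_iff r h).1 (hp.valid r h s hr).1

theorem above_subset_upTo (G : HRLQ R H) (pl : R → Option (H × ℕ)) (h : H) (s : ℕ) (r : R) :
    G.above pl h s r ⊆ upTo pl h s := by
  intro x hx
  obtain ⟨t, ht, h1⟩ := HRLQ.mem_above.1 hx
  exact mem_upTo.2 ⟨t, ht, by omega⟩

/-- Apply `keep` to the resident that `h` likes least among those at level exactly `s`: all the
others up to level `s` come before it. -/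
theorem card_upTo_le (hp : G.LevelStable pl) {r : R} {h : H} {s : ℕ} (hr : pl r = some (h, s)) :
    (upTo pl h s).card ≤ G.levelCap h s := by
  classical
  obtain ⟨w, hw, hmax⟩ := Finset.exists_max_image
    (Finset.univ.filter fun x => pl x = some (h, s)) (fun x => (G.hospList h).idxOf x)
    ⟨r, by simp [hr]⟩
  simp only [Finset.mem_filter, Finset.mem_univ, true_and] at hw hmax
  have hsub : upTo pl h s ⊆ insert w (G.above pl h s w) := by
    intro x hx
    obtain ⟨t, ht, hts⟩ := mem_upTo.1 hx
    rw [Finset.mem_insert]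
    by_cases hxw : x = w
    · exact Or.inl hxw
    · refine Or.inr (HRLQ.mem_above.2 ⟨t, ht, ?_⟩)
      rcases hts.lt_or_eq with h1 | rfl
      · exact Or.inl h1
      · refine Or.inr ⟨rfl, ?_⟩
        rcases Prefers.trichotomy (hp.mem_hospList ht) (hp.mem_hospList hw) hxw with h2 | h2
        · exact h2
        · exact absurd h2.2.2 (not_lt.2 (hmax x ht))
  have := (Finset.card_le_card hsub).trans (Finset.card_insert_le _ _)
  have := hp.keep w h s hw
  omega

/-- Everyone up to level `s` comes before `r`. The bound is the capacity of the higher level `t`,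
which may be the smaller one: a resident at level `t` certifies that all lower levels are open. -/
theorem card_upTo_lt (hp : G.LevelStable pl) {r : R} {h : H} {s t : ℕ} (hr : pl r = some (h, t))
    (hst : s < t) : (upTo pl h s).card < G.levelCap h t := by
  refine lt_of_le_of_lt (Finset.card_le_card ?_) (hp.keep r h t hr)
  intro x hx
  obtain ⟨t', ht, hts⟩ := mem_upTo.1 hx
  exact HRLQ.mem_above.2 ⟨t', ht, by omega⟩

theorem levelCap_le_upTo (hp : G.LevelStable pl) {r : R} {h : H} {s : ℕ} (hs : s < G.numLevels)
    (hd : G.Desires pl r h s) : G.levelCap h s ≤ (upTo pl h s).card :=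
  (hp.full r h s hs hd).trans (Finset.card_le_card (above_subset_upTo G pl h s r))

/-- Otherwise `r'` lies in `upTo pl h s` without being counted before `r`, and `full` makes that set
exceed the capacity. -/
theorem prefers_of_desires (hp : G.LevelStable pl) {r r' : R} {h : H} {s : ℕ}
    (hd : G.Desires pl r h s) (hr' : pl r' = some (h, s)) : Prefers (G.hospList h) r' r := by
  by_contra hn
  have h1 := hp.full r h s (hp.valid _ _ _ hr').2 hd
  have h2 := hp.card_upTo_le hr'
  have h3 : G.above pl h s r ⊂ upTo pl h s := by
    refine Finset.ssubset_iff_subset_ne.2 ⟨above_subset_upTo G pl h s r, fun he => ?_⟩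
    have : r' ∈ G.above pl h s r := by rw [he]; exact mem_upTo.2 ⟨s, hr', le_rfl⟩
    obtain ⟨t, ht, h4⟩ := HRLQ.mem_above.1 this
    rw [hr'] at ht
    simp only [Option.some.injEq, Prod.mk.injEq, true_and] at ht
    subst ht
    simp [hn] at h4
  have := Finset.card_lt_card h3
  omega

theorem upTo_eq (h : H) (s : ℕ) (hs : ∀ r t, pl r = some (h, t) → t ≤ s) :
    upTo pl h s = residentsOf (edgesOf pl) h := by
  ext r
  rw [mem_upTo, mem_residentsOf, mem_edgesOf]
  exact ⟨fun ⟨t, ht, _⟩ => ⟨t, ht⟩, fun ⟨t, ht⟩ => ⟨t, ht, hs r t ht⟩⟩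

theorem upTo_subset (h : H) (s : ℕ) : upTo pl h s ⊆ residentsOf (edgesOf pl) h := by
  intro r hr
  rw [mem_residentsOf, mem_edgesOf]
  obtain ⟨t, ht, _⟩ := mem_upTo.1 hr
  exact ⟨t, ht⟩

theorem exists_top (h : H) : residentsOf (edgesOf pl) h = ∅ ∨
    ∃ r s, pl r = some (h, s) ∧ upTo pl h s = residentsOf (edgesOf pl) h := by
  classical
  rcases (residentsOf (edgesOf pl) h).eq_empty_or_nonempty with h0 | h0
  · exact Or.inl h0
  · right
    obtain ⟨r, hr, hmax⟩ := Finset.exists_max_image _ (fun r => ((pl r).map Prod.snd).getD 0) h0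
    rw [mem_residentsOf, mem_edgesOf] at hr
    obtain ⟨s, hs⟩ := hr
    refine ⟨r, s, hs, upTo_eq h s fun r' t ht => ?_⟩
    have := hmax r' (mem_residentsOf.2 (mem_edgesOf.2 ⟨t, ht⟩))
    simpa [ht, hs] using this

theorem card_le_upper (hp : G.LevelStable pl) (hq : ∀ h, G.lower h ≤ G.upper h) (h : H) :
    (residentsOf (edgesOf pl) h).card ≤ G.upper h := by
  rcases exists_top (pl := pl) h with h0 | ⟨r, s, hr, he⟩
  · simp [h0]
  · rw [← he]
    refine (hp.card_upTo_le hr).trans ?_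
    have := hq h
    unfold HRLQ.levelCap
    split_ifs <;> omega

/-- The highest level occupied at `h` is then also at least `n`, where the capacity is the lower
quota, and all residents of `h` lie up to it. -/
theorem card_le_lower (hp : G.LevelStable pl) {r : R} {h : H} {s : ℕ}
    (hr : pl r = some (h, s)) (hs : Fintype.card R ≤ s) :
    (residentsOf (edgesOf pl) h).card ≤ G.lower h := by
  rcases exists_top (pl := pl) h with h0 | ⟨r', s', hr', he⟩
  · simp [h0]
  · have h1 : s ≤ s' := by
      have : r ∈ upTo pl h s' := by rw [he]; exact mem_residentsOf.2 (mem_edgesOf.2 ⟨s, hr⟩)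
      obtain ⟨t, ht, hts⟩ := mem_upTo.1 this
      rw [hr] at ht
      simp only [Option.some.injEq, Prod.mk.injEq, true_and] at ht
      omega
    rw [← he]
    refine (hp.card_upTo_le hr').trans ?_
    unfold HRLQ.levelCap
    rw [if_neg (by omega)]

theorem isMatching (hp : G.LevelStable pl) (hq : ∀ h, G.lower h ≤ G.upper h) :
    G.toHR.IsMatching (edgesOf pl) := by
  refine ⟨?_, edgesOf_unique pl, hp.card_le_upper hq⟩
  rintro ⟨r, h⟩ hr
  obtain ⟨s, hs⟩ := mem_edgesOf.1 hr
  exact (hp.valid r h s hs).1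

/-- A resident with an edge to a hospital that is not filled up to level `s` has level at least
`s`. -/
theorem le_level_of_open (hp : G.LevelStable pl) {r : R} {h : H} {s : ℕ} (hs : s < G.numLevels)
    (hr : h ∈ G.resList r) (ho : (upTo pl h s).card < G.levelCap h s) :
    ∃ h' t, pl r = some (h', t) ∧ s ≤ t ∧ (s = t → ¬ Prefers (G.resList r) h h') := by
  by_contra hn
  refine absurd (hp.levelCap_le_upTo hs (r := r) ⟨hr, fun h' t ht => ?_⟩) (not_le.2 ho)
  by_contra hc
  refine hn ⟨h', t, ht, by omega, fun h1 h2 => hc (Or.inr ⟨h1.symm, h2⟩)⟩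

end HRLQ.LevelStable

end Placements

/-! ### Correspondences, votes, and the bound of votes by levels. -/

section Votes

variable {R : Type u} {H : Type v} [Fintype R] [Fintype H] [DecidableEq R] [DecidableEq H]

namespace Correspondence

variable (τ : Correspondence R H) (h : H) (M₁ M₂ : Finset (R × H))

/-- The correspondence restricts to a bijection between the paired residents of the two sides, so
sums over pairs may be indexed by either side. -/
theorem sum_paired (g : Option R → Option R → ℤ) :
    ∑ r ∈ (residentsOf M₁ h \ residentsOf M₂ h).filter (fun r => τ.corr h M₁ M₂ r ≠ none),
      g (some r) (τ.corr h M₁ M₂ r) =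
    ∑ r ∈ (residentsOf M₂ h \ residentsOf M₁ h).filter (fun r => τ.corr h M₂ M₁ r ≠ none),
      g (τ.corr h M₂ M₁ r) (some r) := by
  have key : ∀ A B : Finset (R × H), ∀ r ∈ (residentsOf A h \ residentsOf B h).filter
      (fun r => τ.corr h A B r ≠ none), ∃ r', τ.corr h A B r = some r' ∧
        r' ∈ (residentsOf B h \ residentsOf A h).filter (fun r => τ.corr h B A r ≠ none) ∧
        τ.corr h B A r' = some r := by
    intro A B r hr
    rw [Finset.mem_filter] at hr
    obtain ⟨r', hr'⟩ := Option.ne_none_iff_exists'.1 hr.2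
    have := τ.pairing h A B r r' hr.1 hr'
    exact ⟨r', hr', by simp [this.1, this.2, -Finset.mem_sdiff], this.2⟩
  refine Finset.sum_bij' (fun r _ => (τ.corr h M₁ M₂ r).getD r)
    (fun r _ => (τ.corr h M₂ M₁ r).getD r) ?_ ?_ ?_ ?_ ?_
  · intro r hr
    obtain ⟨r', h1, h2, _⟩ := key M₁ M₂ r hr
    simpa [h1] using h2
  · intro r hr
    obtain ⟨r', h1, h2, _⟩ := key M₂ M₁ r hr
    simpa [h1] using h2
  · intro r hr
    obtain ⟨r', h1, _, h2⟩ := key M₁ M₂ r hr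
    simp [h1, h2]
  · intro r hr
    obtain ⟨r', h1, _, h2⟩ := key M₂ M₁ r hr
    simp [h1, h2]
  · intro r hr
    obtain ⟨r', h1, _, h2⟩ := key M₁ M₂ r hr
    simp [h1, h2]

theorem sum_sdiff_eq (g : R → ℤ) :
    ∑ r ∈ residentsOf M₁ h \ residentsOf M₂ h, g r =
    ∑ r ∈ (residentsOf M₁ h \ residentsOf M₂ h).filter (fun r => τ.corr h M₁ M₂ r = none), g r +
    ∑ r ∈ (residentsOf M₁ h \ residentsOf M₂ h).filter (fun r => τ.corr h M₁ M₂ r ≠ none), g r :=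
  (Finset.sum_filter_add_sum_filter_not _ _ _).symm

theorem card_unpaired :
    ((((residentsOf M₁ h \ residentsOf M₂ h).filter
      (fun r => τ.corr h M₁ M₂ r = none)).card : ℤ) -
    ((residentsOf M₂ h \ residentsOf M₁ h).filter (fun r => τ.corr h M₂ M₁ r = none)).card) =
    (residentsOf M₁ h).card - (residentsOf M₂ h).card := by
  have h1 := τ.sum_paired h M₁ M₂ (fun _ _ => 1)
  have h2 := τ.sum_sdiff_eq h M₁ M₂ (fun _ => 1)
  have h3 := τ.sum_sdiff_eq h M₂ M₁ (fun _ => 1)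
  have h4 := Finset.card_sdiff_add_card_inter (residentsOf M₁ h) (residentsOf M₂ h)
  have h5 := Finset.card_sdiff_add_card_inter (residentsOf M₂ h) (residentsOf M₁ h)
  rw [Finset.inter_comm] at h5
  simp only [Finset.sum_const, nsmul_eq_mul, mul_one] at h1 h2 h3
  omega

theorem unpaired_eq_empty :
    (residentsOf M₁ h \ residentsOf M₂ h).filter (fun r => τ.corr h M₁ M₂ r = none) = ∅ ∨
    (residentsOf M₂ h \ residentsOf M₁ h).filter (fun r => τ.corr h M₂ M₁ r = none) = ∅ := by
  by_contra! hc
  obtain ⟨⟨r, hr⟩, ⟨r', hr'⟩⟩ := hc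
  rw [Finset.mem_filter] at hr hr'
  exact τ.one_sided h M₁ M₂ r r' hr.1 hr'.1 ⟨hr.2, hr'.2⟩

theorem card_lt_of_unpaired {r : R} (hr : r ∈ residentsOf M₁ h \ residentsOf M₂ h)
    (hc : τ.corr h M₁ M₂ r = none) : (residentsOf M₂ h).card < (residentsOf M₁ h).card := by
  have hm := (Finset.mem_filter (p := fun r => τ.corr h M₁ M₂ r = none)).2 ⟨hr, hc⟩
  have h1 := τ.card_unpaired h M₁ M₂
  have h2 := Finset.card_pos.2 ⟨r, hm⟩
  rcases τ.unpaired_eq_empty h M₁ M₂ with h0 | h0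
  · simp [h0] at hm
  · rw [h0] at h1
    simp only [Finset.card_empty, Nat.cast_zero] at h1
    omega

end Correspondence

/-- Every unpaired resident contributes `1` or `-1` according to its side, so their total is the
difference of the sizes, whatever the correspondence. -/
theorem HR.hospVote_eq (G : HR R H) (τ : Correspondence R H) (M₁ M₂ : Finset (R × H)) (h : H) :
    G.hospVote τ M₁ M₂ h =
    ∑ r ∈ (residentsOf M₁ h \ residentsOf M₂ h).filter (fun r => τ.corr h M₁ M₂ r ≠ none),
      vote (G.hospList h) (some r) (τ.corr h M₁ M₂ r) +
    ((residentsOf M₁ h).card - (residentsOf M₂ h).card) := by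
  rw [HR.hospVote, τ.sum_sdiff_eq, ← τ.card_unpaired h M₁ M₂]
  rw [Finset.sum_congr rfl (g := fun _ => (1 : ℤ))
    (s₁ := Finset.filter (fun r => τ.corr h M₁ M₂ r = none) _)]
  · simp [vote]; ring
  · intro r hr
    rw [(Finset.mem_filter.1 hr).2, vote]

theorem HR.votes_swap (G : HR R H) (τ : Correspondence R H) (M₁ M₂ : Finset (R × H)) :
    G.votes τ M₁ M₂ = - G.votes τ M₂ M₁ := by
  rw [HR.votes, HR.votes, neg_add, ← Finset.sum_neg_distrib, ← Finset.sum_neg_distrib]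
  congr 1
  · exact Finset.sum_congr rfl fun r _ => vote_swap _ _ _
  · refine Finset.sum_congr rfl fun h _ => ?_
    rw [G.hospVote_eq, G.hospVote_eq, τ.sum_paired h M₁ M₂ (fun x y => vote (G.hospList h) x y),
      neg_add, neg_sub, ← Finset.sum_neg_distrib]
    congr 1
    exact Finset.sum_congr rfl fun r _ => vote_swap _ _ _

/-- The level of a resident, zero for an unmatched one. -/
def levelOf (pl : R → Option (H × ℕ)) (r : R) : ℕ := ((pl r).map Prod.snd).getD 0

theorem levelOf_eq {pl : R → Option (H × ℕ)} {r : R} {h : H} {s : ℕ} (hr : pl r = some (h, s)) :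
    levelOf pl r = s := by simp [levelOf, hr]

namespace HRLQ.LevelStable

variable {G : HRLQ R H} {pl : R → Option (H × ℕ)}

/-- The central inequality. Stability allows `j` to exceed the level `i` of `r` by at most one. If
`j = i + 1`, both votes are `-1`; if `j = i`, at least one of them is `-1`; if `j < i`, the trivial
bound `2` suffices. An unmatched `r` has level zero and forces `j = 0`. -/
theorem vote_add_vote_le (hp : G.LevelStable pl) (hq : ∀ h, G.lower h ≤ G.upper h) {r r' : R}
    {h : H} {j : ℕ} (hr : h ∈ G.resList r) (hm : (r, h) ∉ edgesOf pl)
    (hr' : pl r' = some (h, j)) :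
    vote (G.resList r) (some h) (partner (edgesOf pl) r) +
      vote (G.hospList h) (some r) (some r') ≤ 2 * ((levelOf pl r : ℤ) - j) := by
  have hj := (hp.valid _ _ _ hr').2
  rw [partner_edgesOf]
  have hV := vote_le_one (G.resList r) (some h) ((pl r).map Prod.fst)
  have hW := vote_le_one (G.hospList h) (some r) (some r')
  rcases hpr : pl r with _ | ⟨h₁, i⟩
  · have hd : ∀ s, G.Desires pl r h s := fun s => ⟨hr, by simp [hpr]⟩
    have hj0 : j = 0 := by
      by_contra hj0
      have h1 := hp.levelCap_le_upTo (by omega) (hd 0)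
      have h2 := hp.card_upTo_lt hr' (Nat.pos_of_ne_zero hj0)
      have h3 := G.levelCap_anti hq h (Nat.zero_le j)
      omega
    rw [vote_eq_neg_one (hp.prefers_of_desires (hd j) hr')]
    simp [levelOf, hpr, hj0, vote]
  · have hne : h₁ ≠ h := by
      rintro rfl; exact hm (mem_edgesOf.2 ⟨i, hpr⟩)
    have hr₁ := (hp.valid _ _ _ hpr).1
    rw [levelOf_eq hpr]
    rw [hpr] at hV
    simp only [Option.map_some] at hV ⊢
    have hd : ∀ s, i < s ∨ i = s ∧ Prefers (G.resList r) h h₁ → G.Desires pl r h s := by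
      intro s hs
      refine ⟨hr, fun h' t ht => ?_⟩
      rw [hpr] at ht
      simp only [Option.some.injEq, Prod.mk.injEq] at ht
      rw [← ht.1, ← ht.2]
      exact hs
    -- The resident `r'` at level `j` shows that level `s` is open, so nobody can desire `h` there
    -- in vain.
    have hlt : ∀ s < j, ¬ G.Desires pl r h s := by
      intro s hs hds
      have h1 := hp.levelCap_le_upTo (by omega) hds
      have h2 := hp.card_upTo_lt hr' hs
      have h3 := G.levelCap_anti hq h hs.le
      omega
    have hji : j ≤ i + 1 := by
      by_contra hc
      exact hlt (i + 1) (by omega) (hd _ (by omega))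
    rcases Prefers.trichotomy hr hr₁ hne.symm with hpf | hpf
    · have h1 : j ≤ i := by
        by_contra hc
        exact hlt i (by omega) (hd i (Or.inr ⟨rfl, hpf⟩))
      rcases h1.lt_or_eq with h2 | rfl
      · omega
      · rw [vote_eq_neg_one (hp.prefers_of_desires (hd j (Or.inr ⟨rfl, hpf⟩)) hr')]
        omega
    · rw [vote_eq_neg_one hpf]
      rcases hji.lt_or_eq with h1 | rfl
      · omega
      · rw [vote_eq_neg_one (hp.prefers_of_desires (hd (i + 1) (Or.inl (by omega))) hr')]
        push_cast
        omega

/-- The analogue of `vote_add_vote_le` for an empty position, which behaves like a resident of level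
`n - 1`: that is the last level with capacity `q⁺(h)`, and it is still open. -/
theorem vote_add_one_le (hp : G.LevelStable pl) {r : R} {h : H} (hr : h ∈ G.resList r)
    (hm : (r, h) ∉ edgesOf pl) (hc : (residentsOf (edgesOf pl) h).card < G.upper h) :
    vote (G.resList r) (some h) (partner (edgesOf pl) r) + 1 ≤
      2 * ((levelOf pl r : ℤ) - (Fintype.card R - 1)) := by
  have hn : 0 < Fintype.card R := Fintype.card_pos_iff.2 ⟨r⟩
  have hV := vote_le_one (G.resList r) (some h) (partner (edgesOf pl) r)
  rw [partner_edgesOf] at hV ⊢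
  have hcap : G.levelCap h (Fintype.card R - 1) = G.upper h := by
    unfold HRLQ.levelCap; rw [if_pos (by omega)]
  obtain ⟨h₁, t, hpr, h2, h3⟩ := hp.le_level_of_open (s := Fintype.card R - 1)
    (by unfold HRLQ.numLevels; omega) hr
    (by rw [hcap]; exact (Finset.card_le_card (upTo_subset h _)).trans_lt hc)
  rw [levelOf_eq hpr]
  rw [hpr] at hV
  simp only [hpr, Option.map_some] at hV ⊢
  rcases h2.lt_or_eq with h4 | h4
  · omega
  · have hne : h ≠ h₁ := by
      rintro rfl; exact hm (mem_edgesOf.2 ⟨t, hpr⟩)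
    rw [vote_eq_neg_one ((Prefers.trichotomy hr (hp.valid _ _ _ hpr).1 hne).resolve_left (h3 h4))]
    omega

/-- The two preceding bounds are summed over the residents that `h` gains in `N`. Unpaired residents
that `h` loses occur only if `|M(h)| > |N(h)| ≥ q⁻(h)`; then nobody at `h` has level `n` or more,
and each lost level is at most `n - 1`. So all unpaired positions together cost `n - 1` times the
difference of the sizes. -/
theorem hospVote_add_le (hp : G.LevelStable pl) (hq : ∀ h, G.lower h ≤ G.upper h)
    {N : Finset (R × H)} (hN : G.IsFeasible N) (τ : Correspondence R H) (h : H) :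
    G.toHR.hospVote τ N (edgesOf pl) h +
      ∑ r ∈ residentsOf N h \ residentsOf (edgesOf pl) h,
        vote (G.resList r) (some h) (partner (edgesOf pl) r) ≤
    2 * (∑ r ∈ residentsOf N h \ residentsOf (edgesOf pl) h, (levelOf pl r : ℤ) -
      ∑ r ∈ residentsOf (edgesOf pl) h \ residentsOf N h, (levelOf pl r : ℤ)) +
    2 * ((Fintype.card R : ℤ) - 1) *
      ((residentsOf (edgesOf pl) h).card - (residentsOf N h).card) := by
  set M := edgesOf pl with hM
  set f : Option R → ℤ := fun x => x.elim ((Fintype.card R : ℤ) - 1) (fun r => levelOf pl r)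
    with hf
  have h1 : ∀ r ∈ residentsOf N h \ residentsOf M h,
      vote (G.hospList h) (some r) (τ.corr h N M r) +
        vote (G.resList r) (some h) (partner M r) ≤
      2 * (levelOf pl r - f (τ.corr h N M r)) := by
    intro r hr
    have hr2 := Finset.mem_sdiff.1 hr
    rw [mem_residentsOf, mem_residentsOf] at hr2
    have hrl := hN.1.1 _ hr2.1
    rcases hc : τ.corr h N M r with _ | r'
    · have h2 := hp.vote_add_one_le hrl hr2.2
        ((τ.card_lt_of_unpaired h N M hr hc).trans_le (hN.1.2.2 h))
      rw [add_comm]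
      simpa [hf, vote] using h2
    · have h2 := (Finset.mem_sdiff.1 (τ.pairing h N M r r' hr hc).1).1
      rw [mem_residentsOf] at h2
      obtain ⟨j, hj⟩ := mem_edgesOf.1 h2
      have h3 := hp.vote_add_vote_le hq hrl hr2.2 hj
      rw [add_comm]
      simpa [hf, levelOf_eq hj] using h3
  have h2 := Finset.sum_le_sum h1
  rw [Finset.sum_add_distrib, ← Finset.mul_sum, Finset.sum_sub_distrib,
    τ.sum_sdiff_eq h N M (fun r => f (τ.corr h N M r)),
    τ.sum_paired h N M (fun _ y => f y)] at h2
  have h3 := τ.sum_sdiff_eq h M N (fun r => (levelOf pl r : ℤ))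
  have h4 : ∑ r ∈ (residentsOf N h \ residentsOf M h).filter (fun r => τ.corr h N M r = none),
      f (τ.corr h N M r) = ∑ r ∈ (residentsOf N h \ residentsOf M h).filter
        (fun r => τ.corr h N M r = none), ((Fintype.card R : ℤ) - 1) :=
    Finset.sum_congr rfl fun r hr => by rw [(Finset.mem_filter.1 hr).2, hf]; rfl
  have h5 : ∑ r ∈ (residentsOf M h \ residentsOf N h).filter (fun r => τ.corr h M N r = none),
      (levelOf pl r : ℤ) ≤ ∑ r ∈ (residentsOf M h \ residentsOf N h).filter
        (fun r => τ.corr h M N r = none), ((Fintype.card R : ℤ) - 1) := by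
    refine Finset.sum_le_sum fun r hr => ?_
    rw [Finset.mem_filter] at hr
    have h6 := τ.card_lt_of_unpaired h M N hr.1 hr.2
    have h7 := (Finset.mem_sdiff.1 hr.1).1
    rw [mem_residentsOf] at h7
    obtain ⟨s, hs⟩ := mem_edgesOf.1 h7
    rw [levelOf_eq hs]
    by_contra hc
    have h8 := hp.card_le_lower hs (by omega)
    have h9 := hN.2 h
    rw [← hM] at h8
    omega
  have h6 : ∀ r ∈ (residentsOf M h \ residentsOf N h).filter (fun r => τ.corr h M N r ≠ none),
      f (some r) = levelOf pl r := fun r _ => rfl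
  have h7 := τ.card_unpaired h M N
  rw [h4, Finset.sum_congr rfl h6] at h2
  rw [← h7, HR.hospVote]
  simp only [vote, Finset.sum_const, nsmul_eq_mul] at h2 h5 ⊢
  linarith

/-- The vote of a resident is charged to its edge in `N`. After summation over the hospitals the
levels of moving residents cancel, and the rest is a nonnegative multiple of `|M| - |N|`. -/
theorem votes_nonpos (hp : G.LevelStable pl) (hq : ∀ h, G.lower h ≤ G.upper h)
    {N : Finset (R × H)} (hN : G.IsFeasible N) (hcard : (edgesOf pl).card ≤ N.card)
    (τ : Correspondence R H) : G.toHR.votes τ N (edgesOf pl) ≤ 0 := by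
  classical
  -- Without residents the factor `n - 1` would be negative.
  rcases isEmpty_or_nonempty R with hR | hR
  · have : ∀ M : Finset (R × H), M = ∅ := fun M => Finset.eq_empty_of_isEmpty M
    rw [this N, this (edgesOf pl)]
    simp [HR.votes, HR.hospVote, residentsOf]
  set M := edgesOf pl with hM
  have hsplit : ∀ (A B : Finset (R × H)) (g : R → H → ℤ),
      ∑ h, ∑ r ∈ residentsOf A h \ residentsOf B h, g r h =
      ∑ r, ∑ h, if (r, h) ∈ A ∧ (r, h) ∉ B then g r h else 0 := by
    intro A B g
    rw [Finset.sum_comm]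
    refine Finset.sum_congr rfl fun h _ => ?_
    rw [← Finset.sum_filter]
    refine Finset.sum_congr ?_ fun _ _ => rfl
    ext r
    simp [mem_residentsOf]
  have hres : ∑ r, vote (G.resList r) (partner N r) (partner M r) ≤
      ∑ h, ∑ r ∈ residentsOf N h \ residentsOf M h, vote (G.resList r) (some h) (partner M r) := by
    rw [hsplit N M (fun r h => vote (G.resList r) (some h) (partner M r))]
    refine Finset.sum_le_sum fun r _ => ?_
    rcases hpn : partner N r with _ | h
    · rw [Finset.sum_eq_zero]
      · rcases partner M r <;> simp [vote]
      · intro h _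
        rw [if_neg]
        rintro ⟨h1, -⟩
        rw [partner_eq_some hN.1.2.1 h1] at hpn
        simp at hpn
    · have h1 := mem_of_partner_eq_some hpn
      rw [Finset.sum_eq_single h]
      · by_cases h2 : (r, h) ∈ M
        · rw [partner_eq_some (edgesOf_unique pl) h2, vote_self, if_neg (by simp [h2])]
        · rw [if_pos ⟨h1, h2⟩]
      · intro h' _ hne
        rw [if_neg]
        rintro ⟨h2, -⟩
        exact hne (hN.1.2.1 _ _ _ h2 h1)
      · simp
  -- A resident with a new edge in `N` has either lost an edge of `M`, which contributes the same
  -- level on the right, or was unmatched and has level zero.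
  have hlev : ∑ h, ∑ r ∈ residentsOf N h \ residentsOf M h, (levelOf pl r : ℤ) ≤
      ∑ h, ∑ r ∈ residentsOf M h \ residentsOf N h, (levelOf pl r : ℤ) := by
    rw [hsplit N M (fun r _ => (levelOf pl r : ℤ)), hsplit M N (fun r _ => (levelOf pl r : ℤ))]
    refine Finset.sum_le_sum fun r _ => ?_
    have hnn : ∀ h ∈ (Finset.univ : Finset H),
        0 ≤ if (r, h) ∈ M ∧ (r, h) ∉ N then (levelOf pl r : ℤ) else 0 := by
      intro h _; split_ifs <;> simp
    by_cases hx : ∃ h, (r, h) ∈ N ∧ (r, h) ∉ M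
    · obtain ⟨h, h1, h2⟩ := hx
      rw [Finset.sum_eq_single h, if_pos ⟨h1, h2⟩]
      · rcases hpr : pl r with _ | ⟨h', s⟩
        · have : levelOf pl r = 0 := by simp [levelOf, hpr]
          simp [this]
        · have h3 : (r, h') ∈ M := mem_edgesOf.2 ⟨s, hpr⟩
          have h4 : (r, h') ∉ N := fun h5 => h2 (by rwa [hN.1.2.1 _ _ _ h1 h5])
          refine le_trans ?_ (Finset.single_le_sum hnn (Finset.mem_univ h'))
          rw [if_pos ⟨h3, h4⟩]
      · intro h' _ hne
        rw [if_neg]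
        rintro ⟨h3, -⟩
        exact hne (hN.1.2.1 _ _ _ h3 h1)
      · simp
    · push Not at hx
      rw [Finset.sum_eq_zero]
      · exact Finset.sum_nonneg hnn
      · intro h _
        rw [if_neg]
        rintro ⟨h3, h4⟩
        exact h4 (hx h h3)
  have hsum := Finset.sum_le_sum fun h (_ : h ∈ (Finset.univ : Finset H)) =>
    hp.hospVote_add_le hq hN τ h
  rw [Finset.sum_add_distrib, Finset.sum_add_distrib, ← Finset.mul_sum, ← Finset.mul_sum,
    Finset.sum_sub_distrib, Finset.sum_sub_distrib, ← Nat.cast_sum, ← Nat.cast_sum,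
    sum_card_residentsOf, sum_card_residentsOf] at hsum
  have hn : 0 < Fintype.card R := Fintype.card_pos
  have hprod : ((Fintype.card R : ℤ) - 1) * ((M.card : ℤ) - N.card) ≤ 0 :=
    mul_nonpos_of_nonneg_of_nonpos (by omega) (by omega)
  rw [HR.votes]
  nlinarith

/-! ### Feasibility and maximum cardinality by counting movers level by level. -/

/-- If the hospitals `O` whose copies up to level `s` are not full have more residents in `N` than
in the placement, then fewer residents move at levels above `s` than at levels from `s` on. -/
theorem movers_step (hp : G.LevelStable pl) (hq : ∀ h, G.lower h ≤ G.upper h)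
    {N : Finset (R × H)} (hN : G.IsFeasible N) {X : ℕ → Finset R}
    (hX : ∀ s r, r ∈ X s ↔ ∃ h t, pl r = some (h, t) ∧ s ≤ t ∧ (r, h) ∉ N) {s : ℕ}
    (hs : s < G.numLevels) {O : Finset H}
    (hO : ∀ h, h ∈ O ↔ (upTo pl h s).card < G.levelCap h s)
    (hlt : ∑ h ∈ O, (residentsOf (edgesOf pl) h).card < ∑ h ∈ O, (residentsOf N h).card) :
    (X (s + 1)).card < (X s).card := by
  set M := edgesOf pl
  -- A mover above level `s` leaves a hospital that is open at level `s`, by `card_upTo_lt`.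
  have h1 : (X (s + 1)).card ≤ ∑ h ∈ O, (residentsOf M h \ residentsOf N h).card := by
    refine (Finset.card_le_card ?_).trans Finset.card_biUnion_le
    intro r hr
    obtain ⟨h, t, hpr, hst, hrN⟩ := (hX _ _).1 hr
    rw [Finset.mem_biUnion]
    refine ⟨h, (hO h).2 ?_, ?_⟩
    · exact (hp.card_upTo_lt hpr (by omega)).trans_le (G.levelCap_anti hq h (by omega))
    · rw [Finset.mem_sdiff, mem_residentsOf, mem_residentsOf]
      exact ⟨mem_edgesOf.2 ⟨t, hpr⟩, hrN⟩
  -- A resident that `N` brings to an open hospital is at level at least `s` already, for otherwise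
  -- it would desire that hospital at level `s`.
  have h2 : ∑ h ∈ O, (residentsOf N h \ residentsOf M h).card ≤ (X s).card := by
    rw [← Finset.card_biUnion]
    · refine Finset.card_le_card fun r hr => ?_
      obtain ⟨h, hh, hr⟩ := Finset.mem_biUnion.1 hr
      rw [Finset.mem_sdiff, mem_residentsOf, mem_residentsOf] at hr
      obtain ⟨h', t, hpr, hst, _⟩ := hp.le_level_of_open hs (hN.1.1 _ hr.1) ((hO h).1 hh)
      refine (hX _ _).2 ⟨h', t, hpr, hst, fun hn => hr.2 ?_⟩
      rw [hN.1.2.1 _ _ _ hr.1 hn]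
      exact mem_edgesOf.2 ⟨t, hpr⟩
    · intro h _ h' _ hne
      rw [Function.onFun, Finset.disjoint_left]
      intro r hr hr'
      rw [Finset.mem_sdiff, mem_residentsOf] at hr hr'
      exact hne (hN.1.2.1 _ _ _ hr.1 hr'.1)
  have h3 : ∑ h ∈ O, (residentsOf M h \ residentsOf N h).card +
        ∑ h ∈ O, (residentsOf N h).card =
      ∑ h ∈ O, (residentsOf N h \ residentsOf M h).card + ∑ h ∈ O, (residentsOf M h).card := by
    rw [← Finset.sum_add_distrib, ← Finset.sum_add_distrib]
    refine Finset.sum_congr rfl fun h _ => ?_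
    have h4 := Finset.card_sdiff_add_card_inter (residentsOf M h) (residentsOf N h)
    have h5 := Finset.card_sdiff_add_card_inter (residentsOf N h) (residentsOf M h)
    rw [Finset.inter_comm] at h5
    omega
  omega

theorem exists_movers (pl : R → Option (H × ℕ)) (N : Finset (R × H)) : ∃ X : ℕ → Finset R,
    ∀ s r, r ∈ X s ↔ ∃ h t, pl r = some (h, t) ∧ s ≤ t ∧ (r, h) ∉ N := by
  classical
  exact ⟨fun s => Finset.univ.filter fun r => ∃ h t, pl r = some (h, t) ∧ s ≤ t ∧ (r, h) ∉ N,
    by simp⟩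

theorem card_add_le_of_strictAnti {X : ℕ → Finset R} {a b : ℕ} (hab : a ≤ b)
    (h : ∀ s, a ≤ s → s < b → (X (s + 1)).card < (X s).card) :
    (X b).card + (b - a) ≤ (X a).card := by
  induction b, hab using Nat.le_induction with
  | base => simp
  | succ b hab ih =>
    have h1 := ih fun s h1 h2 => h s h1 (by omega)
    have h2 := h b hab (by omega)
    omega

/-- A deficient hospital stays open at all levels, so the movers decrease at each of the `∑ q⁻`
levels from `n` on, and at least `∑ q⁻` residents have level `n` or more. But each hospital has at
most `q⁻(h)` of these, and the deficient one has fewer. -/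
theorem isFeasible (hp : G.LevelStable pl) {N : Finset (R × H)} (hN : G.IsFeasible N) :
    G.IsFeasible (edgesOf pl) := by
  classical
  have hq := hN.lower_le_upper
  refine ⟨hp.isMatching hq, fun h₀ => ?_⟩
  by_contra! hlt
  obtain ⟨X, hX⟩ := exists_movers pl N
  have hcap : ∀ s h, Fintype.card R ≤ s → G.levelCap h s = G.lower h := by
    intro s h hs; unfold HRLQ.levelCap; rw [if_neg (by omega)]
  have hstep : ∀ s, Fintype.card R ≤ s → s < G.numLevels → (X (s + 1)).card < (X s).card := by
    intro s h1 h2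
    refine hp.movers_step hq hN hX h2
      (O := Finset.univ.filter fun h => (upTo pl h s).card < G.levelCap h s) (by simp) ?_
    refine Finset.sum_lt_sum (fun h hh => ?_) ⟨h₀, ?_, hlt.trans_le (hN.2 h₀)⟩
    -- An open hospital has at most `q⁻(h)` residents: either one of them has level at least `n`, or
    -- all lie up to level `s`.
    · refine le_trans ?_ (hN.2 h)
      rw [Finset.mem_filter, hcap s h h1] at hh
      by_cases hx : ∃ r t, pl r = some (h, t) ∧ Fintype.card R ≤ t
      · obtain ⟨r, t, hr, ht⟩ := hx
        exact hp.card_le_lower hr ht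
      · push Not at hx
        rw [← upTo_eq h s fun r t ht => by have := hx r t ht; omega]
        exact hh.2.le
    · rw [Finset.mem_filter, hcap s h₀ h1]
      exact ⟨Finset.mem_univ _, (Finset.card_le_card (upTo_subset h₀ s)).trans_lt hlt⟩
  have hn : Fintype.card R ≤ G.numLevels := by unfold HRLQ.numLevels; omega
  have h1 := card_add_le_of_strictAnti hn hstep
  have h2 : (X (Fintype.card R)).card ≤
      ∑ h, ((residentsOf (edgesOf pl) h).filter (fun r => Fintype.card R ≤ levelOf pl r)).card := by
    refine (Finset.card_le_card fun r hr => ?_).trans Finset.card_biUnion_le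
    obtain ⟨h, t, hpr, hst, _⟩ := (hX _ _).1 hr
    refine Finset.mem_biUnion.2 ⟨h, Finset.mem_univ _, Finset.mem_filter.2 ⟨?_, ?_⟩⟩
    · exact mem_residentsOf.2 (mem_edgesOf.2 ⟨t, hpr⟩)
    · rwa [levelOf_eq hpr]
  have h3 : ∑ h, ((residentsOf (edgesOf pl) h).filter
      (fun r => Fintype.card R ≤ levelOf pl r)).card < ∑ h, G.lower h := by
    refine Finset.sum_lt_sum (fun h _ => ?_)
      ⟨h₀, Finset.mem_univ _, (Finset.card_filter_le _ _).trans_lt hlt⟩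
    rcases Finset.eq_empty_or_nonempty ((residentsOf (edgesOf pl) h).filter
      (fun r => Fintype.card R ≤ levelOf pl r)) with h0 | ⟨r, hr⟩
    · simp [h0]
    · rw [Finset.mem_filter, mem_residentsOf, mem_edgesOf] at hr
      obtain ⟨⟨s, hs⟩, hr⟩ := hr
      rw [levelOf_eq hs] at hr
      exact (Finset.card_filter_le _ _).trans (hp.card_le_lower hs hr)
  unfold HRLQ.numLevels at h1
  omega

/-- Below level `n`, a hospital that is not open has `q⁺(h)` residents, at least as many as in `N`.
A surplus of `N` thus falls on the open hospitals, the movers decrease `n` times, and every resident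
must be a mover, hence matched. -/
theorem isMaxFeasible (hp : G.LevelStable pl) {N₀ : Finset (R × H)} (hN₀ : G.IsFeasible N₀) :
    G.IsMaxFeasible (edgesOf pl) := by
  classical
  refine ⟨hp.isFeasible hN₀, fun N hN => ?_⟩
  have hq := hN.lower_le_upper
  by_contra! hlt
  obtain ⟨X, hX⟩ := exists_movers pl N
  have hn : Fintype.card R ≤ G.numLevels := by unfold HRLQ.numLevels; omega
  have hstep : ∀ s, 0 ≤ s → s < Fintype.card R → (X (s + 1)).card < (X s).card := by
    intro s _ h2
    refine hp.movers_step hq hN hX (by omega)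
      (O := Finset.univ.filter fun h => (upTo pl h s).card < G.levelCap h s) (by simp) ?_
    rw [← sum_card_residentsOf, ← sum_card_residentsOf N,
      ← Finset.sum_filter_add_sum_filter_not Finset.univ
        (fun h => (upTo pl h s).card < G.levelCap h s),
      ← Finset.sum_filter_add_sum_filter_not Finset.univ
        (fun h => (upTo pl h s).card < G.levelCap h s) (fun h => (residentsOf N h).card)] at hlt
    have h3 : ∑ h with ¬ (upTo pl h s).card < G.levelCap h s, (residentsOf N h).card ≤
        ∑ h with ¬ (upTo pl h s).card < G.levelCap h s, (residentsOf (edgesOf pl) h).card := by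
      refine Finset.sum_le_sum fun h hh => ?_
      rw [Finset.mem_filter, not_lt, HRLQ.levelCap, if_pos h2] at hh
      exact (hN.1.2.2 h).trans (hh.2.trans (Finset.card_le_card (upTo_subset h s)))
    omega
  have h1 := card_add_le_of_strictAnti (Nat.zero_le _) hstep
  have h2 : X 0 = Finset.univ := by
    rw [← Finset.card_eq_iff_eq_univ]
    exact le_antisymm (Finset.card_le_univ _) (by omega)
  have h3 : Fintype.card R ≤ (edgesOf pl).card := by
    refine le_trans (Finset.card_le_card (t := (edgesOf pl).image Prod.fst) fun r _ => ?_)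
      Finset.card_image_le
    have hr : r ∈ X 0 := by rw [h2]; exact Finset.mem_univ _
    obtain ⟨h, t, hpr, _⟩ := (hX _ _).1 hr
    exact Finset.mem_image.2 ⟨(r, h), mem_edgesOf.2 ⟨t, hpr⟩, rfl⟩
  have := hN.1.card_le
  omega

end HRLQ.LevelStable

end Votes

/-! ### Exchange along alternating cycles and paths. -/

section Exchanges

variable {R : Type u} {H : Type v} [DecidableEq R] [DecidableEq H]

namespace Linked

variable {σ : Correspondence R H} {M N : Finset (R × H)} {e f g k : R × H}

theorem symm (hl : Linked σ M N e f) : Linked σ M N f e := by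
  obtain ⟨he, hf, hne, h⟩ := hl
  refine ⟨hf, he, hne.symm, ?_⟩
  rcases h with h | ⟨h, h'⟩
  · exact Or.inl h.symm
  · rw [h] at h'
    exact Or.inr ⟨h.symm, h'.elim (fun x => Or.inr ⟨x.2.1, x.1, x.2.2⟩)
      (fun x => Or.inl ⟨x.2.1, x.1, x.2.2⟩)⟩

theorem mem_iff (hM : ∀ r h h', (r, h) ∈ M → (r, h') ∈ M → h = h')
    (hN : ∀ r h h', (r, h) ∈ N → (r, h') ∈ N → h = h') (hl : Linked σ M N e f) :
    e ∈ M ↔ f ∉ M := by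
  obtain ⟨he, hf, hne, h⟩ := hl
  obtain ⟨r, a⟩ := e
  obtain ⟨r', b⟩ := f
  rw [Finset.mem_symmDiff] at he hf
  rcases h with h | ⟨-, h⟩
  · obtain rfl : r = r' := h
    have h1 : ∀ h2 : a = b, False := fun h2 => hne (by rw [h2])
    constructor
    · exact fun h2 h3 => h1 (hM _ _ _ h2 h3)
    · intro h2
      by_contra h3
      exact h1 (hN _ _ _ (by tauto) (by tauto : (r, b) ∈ N))
  · tauto

theorem eq_of_fst_eq (hM : ∀ r h h', (r, h) ∈ M → (r, h') ∈ M → h = h')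
    (hN : ∀ r h h', (r, h) ∈ N → (r, h') ∈ N → h = h') (hf : Linked σ M N e f)
    (hg : Linked σ M N e g) (hef : e.1 = f.1) (heg : e.1 = g.1) : f = g := by
  have h1 := hf.mem_iff hM hN
  have h2 := hg.mem_iff hM hN
  have h3 := hf.2.1
  have h4 := hg.2.1
  obtain ⟨r, a⟩ := f
  obtain ⟨r', b⟩ := g
  obtain rfl : r = r' := hef.symm.trans heg
  rw [Finset.mem_symmDiff] at h3 h4
  have : a = b := by
    by_cases he : e ∈ M
    · exact hN r a b (by tauto) (by tauto)
    · exact hM r a b (by tauto) (by tauto)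
  rw [this]

theorem eq_of_fst_ne (hf : Linked σ M N e f)
    (hg : Linked σ M N e g) (hef : e.1 ≠ f.1) (heg : e.1 ≠ g.1) : f = g := by
  have hf2 := hf.2.2.2.resolve_left hef
  have hg2 := hg.2.2.2.resolve_left heg
  have he := hf.1
  have hfm := hf.2.1
  have hgm := hg.2.1
  rw [Finset.mem_symmDiff] at he hfm hgm
  refine Prod.ext ?_ (hf2.1.symm.trans hg2.1)
  -- The correspondence is used in one direction only in `Linked`; inverting it shows that two
  -- residents with the same correspondent coincide.
  have hback : ∀ x : R × H, e.2 = x.2 → x ∈ M → x ∉ N → σ.corr e.2 M N x.1 = some e.1 →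
      σ.corr e.2 N M e.1 = some x.1 := by
    rintro ⟨r, h⟩ hx h1 h2 h3
    simp only at hx h3
    refine (σ.pairing e.2 M N r e.1 ?_ h3).2
    rw [hx]
    simp [residentsOf, h1, h2]
  rcases hf2.2 with ⟨h1, h2, h3⟩ | ⟨h1, h2, h3⟩
  · have h4 : σ.corr e.2 M N e.1 = some g.1 := by
      rcases hg2.2 with h | h
      · exact h.2.2
      · tauto
    rw [h3] at h4
    simpa using h4
  · have h4 : g ∈ M ∧ σ.corr e.2 M N g.1 = some e.1 := by
      rcases hg2.2 with h | h
      · tauto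
      · exact ⟨h.2.1, h.2.2⟩
    have h5 := hback f hf2.1 h2 (by tauto) h3
    rw [hback g hg2.1 h4.1 (by tauto) h4.2] at h5
    simpa using h5.symm

/-- An edge has at most one link at its resident and at most one at its hospital, so the link graph
has degree at most two. In particular a closed cycle is a whole component. -/
theorem eq_or_eq (hM : ∀ r h h', (r, h) ∈ M → (r, h') ∈ M → h = h')
    (hN : ∀ r h h', (r, h) ∈ N → (r, h') ∈ N → h = h') (hf : Linked σ M N e f)
    (hg : Linked σ M N e g) (hk : Linked σ M N e k) (hne : f ≠ g) : k = f ∨ k = g := by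
  by_cases h1 : e.1 = f.1 <;> by_cases h2 : e.1 = g.1 <;> by_cases h3 : e.1 = k.1
  · exact Or.inl (hk.eq_of_fst_eq hM hN hf h3 h1)
  · exact absurd (hf.eq_of_fst_eq hM hN hg h1 h2) hne
  · exact Or.inl (hk.eq_of_fst_eq hM hN hf h3 h1)
  · exact Or.inr (hk.eq_of_fst_ne hg h3 h2)
  · exact Or.inr (hk.eq_of_fst_eq hM hN hg h3 h2)
  · exact Or.inl (hk.eq_of_fst_ne hf h3 h1)
  · exact absurd (hf.eq_of_fst_ne hg h1 h2) hne
  · exact Or.inl (hk.eq_of_fst_ne hf h3 h1)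

end Linked

theorem IsAltCycle.exists_two_linked {σ : Correspondence R H} {M N : Finset (R × H)}
    {ρ : List (R × H)} (hρ : IsAltCycle σ M N ρ) : ∀ e ∈ ρ, ∃ f g, f ∈ ρ ∧ g ∈ ρ ∧ f ≠ g ∧
      Linked σ M N e f ∧ Linked σ M N e g := by
  obtain ⟨hnd, hch, hlen, hcl⟩ := hρ
  have hcl' : Linked σ M N ρ[ρ.length - 1] ρ[0] := by
    refine hcl _ ?_ _ ?_
    · rw [List.getLast?_eq_getElem?]; simp
    · rw [List.head?_eq_getElem?]; simp
  have hstep : ∀ i (hi : i + 1 < ρ.length), Linked σ M N ρ[i] ρ[i + 1] :=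
    fun i hi => List.isChain_iff_getElem.1 hch i hi
  have hne : ∀ i j (hi : i < ρ.length) (hj : j < ρ.length), i ≠ j → ρ[i] ≠ ρ[j] := by
    intro i j hi hj hij he
    exact hij ((hnd.getElem_inj_iff).1 he)
  intro e he
  obtain ⟨i, hi, rfl⟩ := List.getElem_of_mem he
  rcases Nat.eq_zero_or_pos i with rfl | h0
  · exact ⟨ρ[1], ρ[ρ.length - 1], List.getElem_mem _, List.getElem_mem _,
      hne _ _ _ _ (by omega), hstep 0 (by omega), hcl'.symm⟩
  · obtain ⟨j, rfl⟩ : ∃ j, i = j + 1 := ⟨i - 1, by omega⟩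
    by_cases h1 : j + 1 + 1 < ρ.length
    · exact ⟨ρ[j + 1 + 1], ρ[j], List.getElem_mem _, List.getElem_mem _,
        hne _ _ _ _ (by omega), hstep (j + 1) h1, (hstep j hi).symm⟩
    · obtain rfl : j = ρ.length - 2 := by omega
      refine ⟨ρ[0], ρ[ρ.length - 2], List.getElem_mem _, List.getElem_mem _,
        hne _ _ _ _ (by omega), ?_, (hstep _ hi).symm⟩
      have h2 : ρ.length - 2 + 1 = ρ.length - 1 := by omega
      simpa only [h2] using hcl'

/-- The two kinds of entries differ in number by at most one, as determined by the two ends;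
equality holds when the ends are of different kinds. -/
theorem List.IsChain.countP_alternating {α : Type*} {p : α → Bool} {l : List α}
    (hl : l.IsChain (fun a b => p a = true ↔ p b ≠ true)) : ∀ e ∈ l.head?, ∀ f ∈ l.getLast?,
      l.countP p + 1 = l.countP (fun a => !p a) + (p e).toNat + (p f).toNat := by
  induction l with
  | nil => simp
  | cons a l ih =>
    rcases l with _ | ⟨b, l⟩
    · cases h : p a <;> simp [h]
    · rw [List.isChain_cons_cons] at hl
      intro e he f hf
      obtain rfl : a = e := by simpa using he
      have := ih hl.2 b (by simp) f (by simpa [List.getLast?_cons_cons] using hf)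
      rw [List.countP_cons, List.countP_cons (l := b :: l) (a := a)]
      have h1 := hl.1
      cases ha : p a <;> cases hb : p b <;> simp [ha, hb] at h1 this ⊢ <;> omega

theorem card_symmDiff_of_alternating {σ : Correspondence R H} {M N : Finset (R × H)}
    (hM : ∀ r h h', (r, h) ∈ M → (r, h') ∈ M → h = h')
    (hN : ∀ r h h', (r, h) ∈ N → (r, h') ∈ N → h = h') {ρ : List (R × H)} (hnd : ρ.Nodup)
    (hch : ρ.IsChain (Linked σ M N)) (hends : OneEndMatched M ρ) :
    (M ∆ ρ.toFinset).card = M.card := by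
  obtain ⟨e, he, f, hf, hx⟩ := hends
  have h1 : ρ.IsChain (fun a b => decide (a ∈ M) = true ↔ decide (b ∈ M) ≠ true) :=
    hch.imp fun a b hab => by simpa using hab.mem_iff hM hN
  have h2 := h1.countP_alternating e he f hf
  have h3 : (decide (e ∈ M)).toNat + (decide (f ∈ M)).toNat = 1 := by
    rcases hx with ⟨h3, h4⟩ | ⟨h3, h4⟩ <;> simp [h3, h4]
  have h4 : ∀ p : R × H → Bool, ρ.countP p = (ρ.toFinset.filter (fun a => p a = true)).card := by
    intro p
    rw [List.countP_eq_length_filter, ← List.toFinset_card_of_nodup (hnd.filter p)]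
    congr 1
    ext a
    simp
  rw [h4, h4] at h2
  have h5 : ρ.toFinset.filter (fun a => decide (a ∈ M) = true) = ρ.toFinset ∩ M := by
    ext a; simp
  have h6 : ρ.toFinset.filter (fun a => (!decide (a ∈ M)) = true) = ρ.toFinset \ M := by
    ext a; simp
  rw [h5, h6] at h2
  have h7 := Finset.card_sdiff_add_card_inter M ρ.toFinset
  rw [Finset.inter_comm] at h7
  have h8 : (M ∆ ρ.toFinset).card = (M \ ρ.toFinset).card + (ρ.toFinset \ M).card := by
    rw [symmDiff_def, Finset.sup_eq_union, Finset.card_union_of_disjoint disjoint_sdiff_sdiff]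
  omega

/-- The union of components of the decomposition of `M ⊕ N` can be exchanged without violating
the quotas. -/
theorem HRLQ.IsFeasible.symmDiff [Fintype R] [Fintype H] {G : HRLQ R H} {M N : Finset (R × H)}
    (hM : G.IsFeasible M) (hN : G.IsFeasible N) (σ : Correspondence R H) {S : Finset (R × H)}
    (hS : S ⊆ M ∆ N) (hcl : ∀ e ∈ S, ∀ f, Linked σ M N e f → f ∈ S) :
    G.IsFeasible (M ∆ S) := by
  classical
  have hSN : ∀ e ∈ S, e ∉ M → e ∈ N := by
    intro e he h1
    have := hS he
    rw [Finset.mem_symmDiff] at this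
    tauto
  have hcard : ∀ h, min (residentsOf M h).card (residentsOf N h).card ≤
      (residentsOf (M ∆ S) h).card ∧ (residentsOf (M ∆ S) h).card ≤
      max (residentsOf M h).card (residentsOf N h).card := by
    intro h
    set A := residentsOf M h \ residentsOf N h with hA
    set B := residentsOf N h \ residentsOf M h with hB
    -- With the indicator of `S` as summand: since `S` is closed under links, the paired residents
    -- lost and gained at `h` through `S` are equally many.
    have h1 := σ.sum_paired h M N
      (fun x _ => if ∃ r, x = some r ∧ (r, h) ∈ S then 1 else 0)
    rw [← hA, ← hB] at h1
    have h2 : ∀ r ∈ B.filter (fun r => σ.corr h N M r ≠ none),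
        (if ∃ r', σ.corr h N M r = some r' ∧ (r', h) ∈ S then (1 : ℤ) else 0) =
          if (r, h) ∈ S then 1 else 0 := by
      intro r hr
      rw [Finset.mem_filter] at hr
      obtain ⟨r', hr'⟩ := Option.ne_none_iff_exists'.1 hr.2
      obtain ⟨h3, h4⟩ := σ.pairing h N M r r' hr.1 hr'
      have h5 := hr.1
      rw [hB, Finset.mem_sdiff, mem_residentsOf, mem_residentsOf] at h5
      rw [Finset.mem_sdiff, mem_residentsOf, mem_residentsOf] at h3
      have hl : Linked σ M N (r, h) (r', h) := by
        refine ⟨Finset.mem_symmDiff.2 (Or.inr h5), Finset.mem_symmDiff.2 (Or.inl h3), ?_,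
          Or.inr ⟨rfl, Or.inr ⟨h5.1, h3.1, h4⟩⟩⟩
        intro he
        rw [he] at h5
        exact h5.2 h3.1
      refine if_congr ⟨?_, fun h6 => ⟨r', hr', hcl _ h6 _ hl⟩⟩ rfl rfl
      rintro ⟨r'', h6, h7⟩
      rw [hr'] at h6
      obtain rfl : r' = r'' := by simpa using h6
      exact hcl _ h7 _ hl.symm
    rw [Finset.sum_congr rfl h2] at h1
    simp only [Option.some.injEq, exists_eq_left', Finset.sum_boole] at h1
    set SA := A.filter (fun r => (r, h) ∈ S) with hSA
    set SB := B.filter (fun r => (r, h) ∈ S) with hSB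
    have h3 : (residentsOf (M ∆ S) h).card + SA.card = (residentsOf M h).card + SB.card := by
      have h4 : residentsOf (M ∆ S) h = (residentsOf M h \ SA) ∪ SB := by
        ext r
        simp only [hSA, hSB, hA, hB, mem_residentsOf, Finset.mem_union, Finset.mem_sdiff,
          Finset.mem_filter, Finset.mem_symmDiff]
        by_cases h5 : (r, h) ∈ S
        · have := hS h5
          rw [Finset.mem_symmDiff] at this
          tauto
        · tauto
      have h5 : SA ⊆ residentsOf M h := (Finset.filter_subset _ _).trans Finset.sdiff_subset
      have h6 : Disjoint (residentsOf M h \ SA) SB := by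
        rw [Finset.disjoint_left]
        intro r hr hr'
        rw [hSB, Finset.mem_filter, hB, Finset.mem_sdiff] at hr'
        exact hr'.1.2 (Finset.mem_sdiff.1 hr).1
      rw [h4, Finset.card_union_of_disjoint h6]
      have := Finset.card_sdiff_add_card_eq_card h5
      omega
    have hcu := σ.card_unpaired h M N
    have hue := σ.unpaired_eq_empty h M N
    rw [← hA, ← hB] at hcu hue
    have h7 : ∀ (T : Finset R) (c : R → Option R),
        (T.filter (fun r => (r, h) ∈ S)).card =
        ((T.filter (fun r => c r ≠ none)).filter (fun r => (r, h) ∈ S)).card +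
        ((T.filter (fun r => c r = none)).filter (fun r => (r, h) ∈ S)).card := by
      intro T c
      rw [Finset.filter_comm, Finset.filter_comm (p := fun r => c r = none), add_comm,
        Finset.card_filter_add_card_filter_not]
    have h8 := h7 A (σ.corr h M N)
    have h9 := h7 B (σ.corr h N M)
    rw [← hSA] at h8
    rw [← hSB] at h9
    have h10 := Finset.card_filter_le (A.filter (fun r => σ.corr h M N r = none))
      (fun r => (r, h) ∈ S)
    have h11 := Finset.card_filter_le (B.filter (fun r => σ.corr h N M r = none))
      (fun r => (r, h) ∈ S)
    -- Only unpaired residents change the size at `h`, and they occur on one side only; hence the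
    -- new size lies between the two old ones.
    rcases hue with h0 | h0 <;>
    · have h12 := Finset.card_eq_zero.2 h0
      omega
  refine ⟨⟨?_, ?_, ?_⟩, ?_⟩
  · intro e he
    rw [Finset.mem_symmDiff] at he
    rcases he with he | he
    · exact hM.1.1 e he.1
    · exact hN.1.1 e (hSN e he.1 he.2)
  -- An edge of `N` entering at `r` is linked to the edge of `M` there, so the latter is removed
  -- together with it.
  · have hmix : ∀ r h h', (r, h) ∈ M → (r, h) ∉ S → (r, h') ∈ S → (r, h') ∉ M → h = h' := by
      intro r h h' h1 h2 h3 h4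
      by_contra hne
      have h5 := hSN _ h3 h4
      have h6 : (r, h) ∉ N := fun h7 => hne (hN.1.2.1 _ _ _ h7 h5)
      exact h2 (hcl _ h3 _ ⟨hS h3, Finset.mem_symmDiff.2 (Or.inl ⟨h1, h6⟩), by simp [Ne.symm hne],
        Or.inl rfl⟩)
    intro r h h' h1 h2
    rw [Finset.mem_symmDiff] at h1 h2
    rcases h1 with h1 | h1 <;> rcases h2 with h2 | h2
    · exact hM.1.2.1 _ _ _ h1.1 h2.1
    · exact hmix _ _ _ h1.1 h1.2 h2.1 h2.2
    · exact (hmix _ _ _ h2.1 h2.2 h1.1 h1.2).symm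
    · exact hN.1.2.1 _ _ _ (hSN _ h1.1 h1.2) (hSN _ h2.1 h2.2)
  · exact fun h => (hcard h).2.trans (max_le (hM.1.2.2 h) (hN.1.2.2 h))
  · exact fun h => (le_min (hM.2 h) (hN.2 h)).trans (hcard h).1

theorem HRLQ.LevelStable.exchange [Fintype R] [Fintype H] {G : HRLQ R H}
    {pl : R → Option (H × ℕ)} (hp : G.LevelStable pl) (σ τ : Correspondence R H)
    {N : Finset (R × H)} (hN : G.IsFeasible N) {ρ : List (R × H)}
    (hρ : IsAltCycle σ (edgesOf pl) N ρ ∨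
      (IsAltPath σ (edgesOf pl) N ρ ∧ OneEndMatched (edgesOf pl) ρ)) :
    G.IsFeasible (edgesOf pl ∆ ρ.toFinset) ∧
      G.toHR.votes τ (edgesOf pl ∆ ρ.toFinset) (edgesOf pl) ≤
        G.toHR.votes τ (edgesOf pl) (edgesOf pl ∆ ρ.toFinset) := by
  have hM := hp.isFeasible hN
  have key : ρ.Nodup ∧ (∀ e ∈ ρ, e ∈ edgesOf pl ∆ N) ∧ ρ.IsChain (Linked σ (edgesOf pl) N) ∧
      (∀ e ∈ ρ, ∀ f, Linked σ (edgesOf pl) N e f → f ∈ ρ) ∧ OneEndMatched (edgesOf pl) ρ := by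
    rcases hρ with hρ | ⟨hρ, hx⟩
    · have hnb := hρ.exists_two_linked
      refine ⟨hρ.1, ?_, hρ.2.1, ?_, ?_⟩
      · intro e he
        obtain ⟨f, g, _, _, _, h, _⟩ := hnb e he
        exact h.1
      · intro e he k hk
        obtain ⟨f, g, hf, hg, hne, hef, heg⟩ := hnb e he
        rcases hef.eq_or_eq hM.1.2.1 hN.1.2.1 heg hk hne with rfl | rfl
        · exact hf
        · exact hg
      -- The first and last edges of a cycle are linked, so exactly one of them is in `M`. Cycles
      -- and paths can be treated alike from here on.
      · obtain ⟨-, -, hlen, hcl⟩ := hρ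
        have hne : ρ ≠ [] := by rintro rfl; simp at hlen
        refine ⟨ρ.head hne, List.head_mem_head? hne, ρ.getLast hne,
          List.getLast_mem_getLast? hne, ?_⟩
        have := (hcl _ (List.getLast_mem_getLast? hne) _ (List.head_mem_head? hne)).mem_iff
          hM.1.2.1 hN.1.2.1
        unfold Xor
        tauto
    · exact ⟨hρ.2.1, hρ.2.2.1, hρ.2.2.2.1, hρ.2.2.2.2.2, hx⟩
  obtain ⟨hnd, hmem, hch, hcl, hx⟩ := key
  have hf : G.IsFeasible (edgesOf pl ∆ ρ.toFinset) :=
    hM.symmDiff hN σ (fun e he => hmem e (List.mem_toFinset.1 he))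
      (fun e he f hef => List.mem_toFinset.2 (hcl e (List.mem_toFinset.1 he) f hef))
  refine ⟨hf, ?_⟩
  have h1 := hp.votes_nonpos hN.lower_le_upper hf
    (card_symmDiff_of_alternating hM.1.2.1 hN.1.2.1 hnd hch hx).ge τ
  have h2 := G.toHR.votes_swap τ (edgesOf pl) (edgesOf pl ∆ ρ.toFinset)
  omega

theorem HRLQ.LevelStable.isPopularAmongMaxFeasible [Fintype R] [Fintype H] {G : HRLQ R H}
    {pl : R → Option (H × ℕ)} (hp : G.LevelStable pl) (τ : Correspondence R H)
    {N : Finset (R × H)} (hN : G.IsFeasible N) :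
    G.IsPopularAmongMaxFeasible τ (edgesOf pl) := by
  have hmax := hp.isMaxFeasible hN
  refine ⟨hmax, fun N' hN' hpop => ?_⟩
  have h1 := hp.votes_nonpos hN.lower_le_upper hN'.1 (hN'.2 _ hmax.1) τ
  have h2 := G.toHR.votes_swap τ N' (edgesOf pl)
  unfold HR.MorePopular at hpop
  omega

end Exchanges

/-! ### The preference lists of `G''` described by numerical ranks. -/

theorem prefers_iff_of_pairwise {α β : Type*} [DecidableEq α] [LinearOrder β] {l : List α}
    {key : α → β} (hl : l.Pairwise (fun x y => key x < key y)) {x y : α} :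
    Prefers l x y ↔ x ∈ l ∧ y ∈ l ∧ key x < key y := by
  have h1 : ∀ x y, Prefers l x y → key x < key y := by
    intro x y h
    have := List.pairwise_iff_getElem.1 hl _ _ (List.idxOf_lt_length_iff.2 h.1)
      (List.idxOf_lt_length_iff.2 h.2.1) h.2.2
    simpa using this
  refine ⟨fun h => ⟨h.1, h.2.1, h1 x y h⟩, fun ⟨hx, hy, hk⟩ => ?_⟩
  have hne : x ≠ y := by rintro rfl; exact lt_irrefl _ hk
  exact (Prefers.trichotomy hx hy hne).resolve_right fun h => lt_asymm hk (h1 _ _ h)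

theorem List.Nodup.pairwise_idxOf {α : Type*} [DecidableEq α] {l : List α} (hl : l.Nodup) :
    l.Pairwise (fun x y => l.idxOf x < l.idxOf y) := by
  rw [List.pairwise_iff_getElem]
  intro i j hi hj hij
  rwa [hl.idxOf_getElem, hl.idxOf_getElem]

section Reduction

variable {R : Type u} {H : Type v} [Fintype R] [Fintype H] [DecidableEq R] [DecidableEq H]

namespace HRLQ

/-- The rank of a resident on the preference list of the level-`s` copy of `h`. -/
def copyKey (G : HRLQ R H) (h : H) (s : ℕ) : G.Res → ℕ ×ₗ ℕ
  -- Dummies of the previous level rank first, then the residents, then the dummies of level `s`.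
  -- Values at dummies that are not on the list are irrelevant.
  | Sum.inl r => toLex (1, (G.hospList h).idxOf r)
  | Sum.inr ⟨_, t, i⟩ => toLex (if t.val = s then 2 else 0, i.val)

/-- The rank of a copy on the preference list of the resident `r`. -/
def resKey (G : HRLQ R H) (r : R) (c : G.Copy) : ℕ ×ₗ ℕ :=
  toLex (G.numLevels - c.2.val, (G.resList r).idxOf c.1)

variable (G : HRLQ R H)

theorem dummies_pairwise (h : H) (t : Fin (G.numLevels - 1)) (k s : ℕ) :
    (G.dummies h t k).Pairwise (fun x y => G.copyKey h s x < G.copyKey h s y) := by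
  unfold dummies
  rw [List.pairwise_map]
  refine ((List.pairwise_lt_finRange _).filter _).imp ?_
  intro i j hij
  exact Prod.Lex.toLex_lt_toLex.2 (Or.inr ⟨rfl, hij⟩)

theorem redHospList_pairwise (h : H) (s : Fin G.numLevels) :
    (G.redHospList (h, s)).Pairwise (fun x y => G.copyKey h s x < G.copyKey h s y) := by
  unfold redHospList
  rw [List.pairwise_append, List.pairwise_append]
  refine ⟨?_, ⟨?_, ?_, ?_⟩, ?_⟩
  · split_ifs
    · exact G.dummies_pairwise _ _ _ _
    · exact List.Pairwise.nil
  · rw [List.pairwise_map]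
    refine (G.hospList_nodup h).pairwise_idxOf.imp ?_
    intro a b hab
    exact Prod.Lex.toLex_lt_toLex.2 (Or.inr ⟨rfl, hab⟩)
  · split_ifs
    · exact G.dummies_pairwise _ _ _ _
    · exact List.Pairwise.nil
  · intro x hx y hy
    split_ifs at hy
    · obtain ⟨r, _, rfl⟩ := List.mem_map.1 hx
      obtain ⟨i, _, rfl⟩ := (G.mem_dummies _ _ _ _).1 hy
      refine Prod.Lex.toLex_lt_toLex.2 (Or.inl ?_)
      simp
    · simp at hy
  · intro x hx y hy
    split_ifs at hx with hs
    · obtain ⟨i, _, rfl⟩ := (G.mem_dummies _ _ _ _).1 hx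
      rcases List.mem_append.1 hy with hy | hy
      · obtain ⟨r, _, rfl⟩ := List.mem_map.1 hy
        refine Prod.Lex.toLex_lt_toLex.2 (Or.inl ?_)
        simp only at hs ⊢
        rw [if_neg (by omega)]
        omega
      · split_ifs at hy
        · obtain ⟨i, _, rfl⟩ := (G.mem_dummies _ _ _ _).1 hy
          refine Prod.Lex.toLex_lt_toLex.2 (Or.inl ?_)
          simp only at hs ⊢
          rw [if_neg (by omega)]
          simp
        · simp at hy
    · simp at hx

theorem prefers_redHospList {h : H} {s : Fin G.numLevels} {x y : G.Res} :
    Prefers (G.redHospList (h, s)) x y ↔ x ∈ G.redHospList (h, s) ∧ y ∈ G.redHospList (h, s) ∧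
      G.copyKey h s x < G.copyKey h s y :=
  prefers_iff_of_pairwise (G.redHospList_pairwise h s)

theorem redResList_pairwise (r : R) :
    (G.redResList (Sum.inl r)).Pairwise (fun c d => G.resKey r c < G.resKey r d) := by
  unfold redResList
  rw [List.pairwise_flatMap]
  refine ⟨fun s _ => ?_, ?_⟩
  · rw [List.pairwise_map]
    refine (G.resList_nodup r).pairwise_idxOf.imp ?_
    intro a b hab
    exact Prod.Lex.toLex_lt_toLex.2 (Or.inr ⟨rfl, hab⟩)
  · rw [List.pairwise_reverse]
    refine (List.pairwise_lt_finRange _).imp ?_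
    intro a b hab x hx y hy
    obtain ⟨_, _, rfl⟩ := List.mem_map.1 hx
    obtain ⟨_, _, rfl⟩ := List.mem_map.1 hy
    refine Prod.Lex.toLex_lt_toLex.2 (Or.inl ?_)
    have : a.val < b.val := hab
    simp only
    omega

theorem mem_redResList_inl {r : R} {h : H} {s : Fin G.numLevels} :
    (h, s) ∈ G.redResList (Sum.inl r) ↔ h ∈ G.resList r := by
  simp [redResList]

theorem prefers_redResList_inl {r : R} {h h' : H} {s t : Fin G.numLevels} :
    Prefers (G.redResList (Sum.inl r)) (h, s) (h', t) ↔ h ∈ G.resList r ∧ h' ∈ G.resList r ∧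
      (t.val < s.val ∨ t.val = s.val ∧ Prefers (G.resList r) h h') := by
  rw [prefers_iff_of_pairwise (G.redResList_pairwise r), G.mem_redResList_inl,
    G.mem_redResList_inl, resKey, resKey, Prod.Lex.toLex_lt_toLex]
  unfold Prefers
  have := s.2
  have := t.2
  simp only
  constructor
  · rintro ⟨h1, h2, h3⟩
    refine ⟨h1, h2, ?_⟩
    rcases h3 with h3 | h3
    · left; omega
    · right; exact ⟨by omega, h1, h2, h3.2⟩
  · rintro ⟨h1, h2, h3⟩
    refine ⟨h1, h2, ?_⟩
    rcases h3 with h3 | h3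
    · left; omega
    · right; exact ⟨by omega, h3.2.2.2⟩

/-- The dummy `d^s_{h,i}`. -/
def dummy (h : H) (s : ℕ) (hs : s + 1 < G.numLevels) (i : Fin (G.levelCap h s)) : G.Res :=
  Sum.inr ⟨h, ⟨s, by omega⟩, i⟩

theorem redResList_dummy (h : H) (s : ℕ) (hs : s + 1 < G.numLevels) (i : Fin (G.levelCap h s)) :
    G.redResList (G.dummy h s hs i) =
      if i.val < G.numShort h s then [(h, ⟨s, by omega⟩)]
      else [(h, ⟨s, by omega⟩), (h, ⟨s + 1, hs⟩)] :=
  rfl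

theorem mem_redHospList {h : H} {s : ℕ} (hs : s < G.numLevels) {x : G.Res} :
    x ∈ G.redHospList (h, ⟨s, hs⟩) ↔ (∃ r ∈ G.hospList h, x = Sum.inl r) ∨
      (∃ (h1 : s + 1 < G.numLevels) (i : _), x = G.dummy h s h1 i) ∨
      (∃ (t : ℕ) (h1 : t + 1 < G.numLevels) (i : _), t + 1 = s ∧ G.numShort h t ≤ i.val ∧
        x = G.dummy h t h1 i) := by
  rw [← G.red_mem_iff]
  rcases x with r | ⟨h', t, i⟩
  · rw [G.mem_redResList_inl, G.mem_iff]
    simp [dummy]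
  · have ht := t.2
    constructor
    · intro hm
      simp only [redResList] at hm
      split_ifs at hm with h1
      · simp only [List.mem_singleton, Prod.mk.injEq, Fin.mk.injEq] at hm
        obtain ⟨rfl, rfl⟩ := hm
        exact Or.inr (Or.inl ⟨by omega, i, rfl⟩)
      · simp only [List.mem_cons, Prod.mk.injEq, Fin.mk.injEq, List.not_mem_nil, or_false] at hm
        rcases hm with ⟨rfl, rfl⟩ | ⟨rfl, rfl⟩
        · exact Or.inr (Or.inl ⟨by omega, i, rfl⟩)
        · exact Or.inr (Or.inr ⟨t.val, by omega, i, rfl, by omega, rfl⟩)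
    · rintro (⟨r, _, hx⟩ | ⟨h1, j, hx⟩ | ⟨t', h1, j, rfl, h3, hx⟩)
      · cases hx
      · rw [hx, redResList_dummy]
        split_ifs <;> simp
      · rw [hx, redResList_dummy, if_neg (by omega)]
        simp

/-- The purpose of the short dummies: exactly as many level-`s` dummies list the next copy as it has
places, even where the capacity drops. -/
theorem levelCap_sub_numShort (hq : ∀ h, G.lower h ≤ G.upper h) (h : H) (s : ℕ) :
    G.levelCap h s = G.numShort h s + G.levelCap h (s + 1) := by
  have := hq h
  unfold levelCap numShort
  split_ifs <;> omega

theorem copyKey_dummy (h : H) (s t : ℕ) (ht : t + 1 < G.numLevels) (i : Fin (G.levelCap h t)) :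
    G.copyKey h s (G.dummy h t ht i) = toLex (if t = s then 2 else 0, i.val) := rfl

end HRLQ

end Reduction

theorem Fin.card_filter_le_val (n k : ℕ) :
    (Finset.univ.filter (fun i : Fin n => k ≤ i.val)).card = n - k := by
  have h1 := Finset.card_filter_add_card_filter_not (s := Finset.univ)
    (fun i : Fin n => i.val < k)
  simp only [not_lt, Finset.card_univ, Fintype.card_fin] at h1
  rw [Fin.card_filter_val_lt] at h1
  omega

/-! ### Stable matchings of `G''` give level stable placements. -/

section StableToPlacement

variable {R : Type u} {H : Type v} [Fintype R] [Fintype H] [DecidableEq R] [DecidableEq H]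

namespace HRLQ

variable (G : HRLQ R H)

open Classical in
/-- The level-`s` dummies of `h`. -/
noncomputable def levelDummies (h : H) (s : ℕ) : Finset G.Res :=
  Finset.univ.filter (fun x => ∃ (hs : s + 1 < G.numLevels) (i : _), x = G.dummy h s hs i)

open Classical in
/-- The dummies of the level below `s` that list the level-`s` copy of `h`. -/
noncomputable def prevDummies (h : H) (s : ℕ) : Finset G.Res :=
  Finset.univ.filter (fun x => ∃ (t : ℕ) (ht : t + 1 < G.numLevels) (i : _), t + 1 = s ∧
    G.numShort h t ≤ i.val ∧ x = G.dummy h t ht i)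

open Classical in
/-- The residents matched to the level-`s` copy of `h`. -/
noncomputable def atLevel (M : Finset (G.Res × G.Copy)) (h : H) (s : ℕ) : Finset G.Res :=
  Finset.univ.filter (fun x => ∃ hs : s < G.numLevels, (x, ((h, ⟨s, hs⟩) : G.Copy)) ∈ M)

/-- The places of the residents in a matching of the reduced instance. -/
noncomputable def placeOf (M : Finset (G.Res × G.Copy)) (r : R) : Option (H × ℕ) :=
  (partner M (Sum.inl r)).map (fun c => (c.1, c.2.val))

open Classical in
/-- The residents with the place `(h, s)`. -/
noncomputable def realsAt (pl : R → Option (H × ℕ)) (h : H) (s : ℕ) : Finset R :=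
  Finset.univ.filter (fun r => pl r = some (h, s))

open Classical in
/-- The residents placed at `h` at a level smaller than `s`. -/
noncomputable def realsBelow (pl : R → Option (H × ℕ)) (h : H) (s : ℕ) : Finset R :=
  Finset.univ.filter (fun r => ∃ t, pl r = some (h, t) ∧ t < s)

variable {G}

theorem mem_levelDummies {h : H} {s : ℕ} {x : G.Res} : x ∈ G.levelDummies h s ↔
    ∃ (hs : s + 1 < G.numLevels) (i : _), x = G.dummy h s hs i := by
  simp [levelDummies]

theorem mem_prevDummies {h : H} {s : ℕ} {x : G.Res} : x ∈ G.prevDummies h s ↔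
    ∃ (t : ℕ) (ht : t + 1 < G.numLevels) (i : _), t + 1 = s ∧
    G.numShort h t ≤ i.val ∧ x = G.dummy h t ht i := by
  simp [prevDummies]

theorem mem_atLevel {M : Finset (G.Res × G.Copy)} {h : H} {s : ℕ} {x : G.Res} :
    x ∈ G.atLevel M h s ↔ ∃ hs : s < G.numLevels, (x, ((h, ⟨s, hs⟩) : G.Copy)) ∈ M := by
  simp [atLevel]

theorem mem_realsAt {pl : R → Option (H × ℕ)} {h : H} {s : ℕ} {r : R} :
    r ∈ realsAt pl h s ↔ pl r = some (h, s) := by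
  simp [realsAt]

theorem mem_realsBelow {pl : R → Option (H × ℕ)} {h : H} {s : ℕ} {r : R} :
    r ∈ realsBelow pl h s ↔ ∃ t, pl r = some (h, t) ∧ t < s := by
  simp [realsBelow]

theorem dummy_injective (h : H) (s : ℕ) (hs : s + 1 < G.numLevels) :
    Function.Injective (G.dummy h s hs) := by
  intro i j hij
  simpa [dummy] using hij

theorem dummy_inj {h h' : H} {s t : ℕ} {hs : s + 1 < G.numLevels} {ht : t + 1 < G.numLevels}
    {i : Fin (G.levelCap h s)} {j : Fin (G.levelCap h' t)}
    (he : G.dummy h s hs i = G.dummy h' t ht j) : h = h' ∧ s = t ∧ i.val = j.val := by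
  simp only [dummy, Sum.inr.injEq, Sigma.mk.injEq] at he
  obtain ⟨rfl, he⟩ := he
  simp only [heq_eq_eq, Sigma.mk.injEq, Fin.mk.injEq] at he
  obtain ⟨rfl, he⟩ := he
  simp only [heq_eq_eq] at he
  exact ⟨rfl, rfl, congrArg Fin.val he⟩

theorem card_levelDummies (h : H) {s : ℕ} (hs : s + 1 < G.numLevels) :
    (G.levelDummies h s).card = G.levelCap h s := by
  classical
  have : G.levelDummies h s = Finset.univ.image (G.dummy h s hs) := by
    ext x
    rw [mem_levelDummies]
    simp [hs, eq_comm]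
  rw [this, Finset.card_image_of_injective _ (dummy_injective h s hs), Finset.card_univ,
    Fintype.card_fin]

theorem card_prevDummies (hq : ∀ h, G.lower h ≤ G.upper h) (h : H) {s : ℕ}
    (hs : s + 1 < G.numLevels) : (G.prevDummies h (s + 1)).card = G.levelCap h (s + 1) := by
  classical
  have : G.prevDummies h (s + 1) = (Finset.univ.filter
      (fun i : Fin (G.levelCap h s) => G.numShort h s ≤ i.val)).image (G.dummy h s hs) := by
    ext x
    rw [mem_prevDummies, Finset.mem_image]
    constructor
    · rintro ⟨t, ht, i, h1, h2, rfl⟩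
      obtain rfl : t = s := by omega
      exact ⟨i, by simpa using h2, rfl⟩
    · rintro ⟨i, h1, rfl⟩
      exact ⟨s, hs, i, rfl, by simpa using h1, rfl⟩
  rw [this, Finset.card_image_of_injective _ (dummy_injective h s hs)]
  have h1 := G.levelCap_sub_numShort hq h s
  rw [Fin.card_filter_le_val]
  omega

theorem prevDummies_zero (h : H) : G.prevDummies h 0 = ∅ := by
  ext x
  simp [mem_prevDummies]

theorem card_realsBelow_succ (pl : R → Option (H × ℕ)) (h : H) (s : ℕ) :
    (realsBelow pl h (s + 1)).card = (realsBelow pl h s).card + (realsAt pl h s).card := by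
  rw [← Finset.card_union_of_disjoint]
  · congr 1
    ext r
    rw [Finset.mem_union, mem_realsBelow, mem_realsBelow, mem_realsAt]
    constructor
    · rintro ⟨t, h1, h2⟩
      rcases (Nat.lt_succ_iff.1 h2).lt_or_eq with h3 | rfl
      · exact Or.inl ⟨t, h1, h3⟩
      · exact Or.inr h1
    · rintro (⟨t, h1, h2⟩ | h1)
      · exact ⟨t, h1, by omega⟩
      · exact ⟨s, h1, by omega⟩
  · rw [Finset.disjoint_left]
    intro r h1 h2
    obtain ⟨t, h3, h4⟩ := mem_realsBelow.1 h1
    rw [mem_realsAt, h3] at h2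
    simp at h2
    omega

theorem realsBelow_zero (pl : R → Option (H × ℕ)) (h : H) : realsBelow pl h 0 = ∅ := by
  ext x
  simp [mem_realsBelow]

theorem realsBelow_succ_eq (pl : R → Option (H × ℕ)) (h : H) (s : ℕ) :
    realsBelow pl h (s + 1) = upTo pl h s := by
  ext r
  rw [mem_realsBelow, mem_upTo]
  simp only [Nat.lt_succ_iff]

variable {M : Finset (G.Res × G.Copy)}

theorem placeOf_eq_some (hU : ∀ x c c', (x, c) ∈ M → (x, c') ∈ M → c = c') {r : R} {h : H} {s : ℕ} :
    G.placeOf M r = some (h, s) ↔ (Sum.inl r : G.Res) ∈ G.atLevel M h s := by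
  rw [mem_atLevel, placeOf, Option.map_eq_some_iff]
  constructor
  · rintro ⟨⟨h', t⟩, h1, h2⟩
    simp only [Prod.mk.injEq] at h2
    obtain ⟨rfl, rfl⟩ := h2
    exact ⟨t.2, mem_of_partner_eq_some h1⟩
  · rintro ⟨hs, h1⟩
    exact ⟨_, partner_eq_some hU h1, rfl⟩

theorem edgesOf_placeOf (hM : G.reduction.IsMatching M) : edgesOf (G.placeOf M) = G.mapBack M := by
  ext ⟨r, h⟩
  simp only [mem_edgesOf, mapBack, Finset.mem_filter, placeOf_eq_some hM.2.1, mem_atLevel,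
    Finset.mem_univ, true_and]
  exact ⟨fun ⟨s, hs, h1⟩ => ⟨⟨s, hs⟩, h1⟩, fun ⟨s, h1⟩ => ⟨s.val, s.2, h1⟩⟩

theorem mem_redHospList_of_mem_atLevel
    (hE : ∀ e ∈ M, e.2 ∈ G.redResList e.1) {h : H} {s : ℕ} {x : G.Res}
    (hs : s < G.numLevels) (hx : x ∈ G.atLevel M h s) : x ∈ G.redHospList (h, ⟨s, hs⟩) := by
  obtain ⟨_, h1⟩ := mem_atLevel.1 hx
  exact (G.red_mem_iff _ _).1 (hE _ h1)

theorem eq_of_mem_atLevel (hM : G.reduction.IsMatching M) {h h' : H} {s t : ℕ} {x : G.Res}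
    (hx : x ∈ G.atLevel M h s) (hx' : x ∈ G.atLevel M h' t) : h = h' ∧ s = t := by
  obtain ⟨_, h1⟩ := mem_atLevel.1 hx
  obtain ⟨_, h2⟩ := mem_atLevel.1 hx'
  have := hM.2.1 _ _ _ h1 h2
  simp only [Prod.mk.injEq, Fin.mk.injEq] at this
  exact this

theorem card_atLevel (hE : ∀ e ∈ M, e.2 ∈ G.redResList e.1)
    (hU : ∀ x c c', (x, c) ∈ M → (x, c') ∈ M → c = c') (h : H) {s : ℕ} (hs : s < G.numLevels) :
    (G.atLevel M h s).card = (realsAt (G.placeOf M) h s).card +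
      (G.levelDummies h s ∩ G.atLevel M h s).card +
      (G.prevDummies h s ∩ G.atLevel M h s).card := by
  classical
  have h1 : (realsAt (G.placeOf M) h s).card =
      ((realsAt (G.placeOf M) h s).image (Sum.inl : R → G.Res)).card :=
    (Finset.card_image_of_injective _ Sum.inl_injective).symm
  rw [h1, ← Finset.card_union_of_disjoint, ← Finset.card_union_of_disjoint]
  · congr 1
    ext x
    rw [Finset.mem_union, Finset.mem_union, Finset.mem_inter, Finset.mem_inter, Finset.mem_image]
    constructor
    · intro hx
      rcases (G.mem_redHospList hs).1 (mem_redHospList_of_mem_atLevel hE hs hx) with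
        ⟨r, _, rfl⟩ | h2 | h2
      · exact Or.inl (Or.inl ⟨r, mem_realsAt.2 ((placeOf_eq_some hU).2 hx), rfl⟩)
      · exact Or.inl (Or.inr ⟨mem_levelDummies.2 h2, hx⟩)
      · exact Or.inr ⟨mem_prevDummies.2 h2, hx⟩
    · rintro ((⟨r, h2, rfl⟩ | h2) | h2)
      · exact (placeOf_eq_some hU).1 (mem_realsAt.1 h2)
      · exact h2.2
      · exact h2.2
  · rw [Finset.disjoint_left]
    intro x hx hx'
    obtain ⟨t, ht, i, h2, -, rfl⟩ := mem_prevDummies.1 (Finset.mem_inter.1 hx').1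
    rcases Finset.mem_union.1 hx with hx | hx
    · obtain ⟨r, _, h3⟩ := Finset.mem_image.1 hx
      cases h3
    · obtain ⟨h3, j, h4⟩ := mem_levelDummies.1 (Finset.mem_inter.1 hx).1
      have := (dummy_inj h4).2.1
      omega
  · rw [Finset.disjoint_left]
    intro x hx hx'
    obtain ⟨h3, j, rfl⟩ := mem_levelDummies.1 (Finset.mem_inter.1 hx').1
    obtain ⟨r, _, h3⟩ := Finset.mem_image.1 hx
    cases h3

theorem card_atLevel_le (hM : G.reduction.IsMatching M) (h : H) {s : ℕ} (hs : s < G.numLevels) :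
    (G.atLevel M h s).card ≤ G.levelCap h s := by
  refine (Finset.card_le_card fun x hx => ?_).trans (hM.2.2 (h, ⟨s, hs⟩))
  obtain ⟨_, h1⟩ := mem_atLevel.1 hx
  exact mem_residentsOf.2 h1

/-- A copy that a resident prefers to its partner is full, of residents that it prefers. -/
theorem full_of_isStable (hst : G.reduction.IsStable M) {x : G.Res} {h : H} {s : ℕ}
    (hs : s < G.numLevels) (hx : ((h, ⟨s, hs⟩) : G.Copy) ∈ G.redResList x)
    (hd : ∀ c, (x, c) ∈ M → Prefers (G.redResList x) (h, ⟨s, hs⟩) c) :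
    G.levelCap h s ≤ (G.atLevel M h s).card ∧
      ∀ y ∈ G.atLevel M h s, G.copyKey h s y < G.copyKey h s x := by
  have hnb := hst.2 x (h, ⟨s, hs⟩)
  have hdis : (∀ c, (x, c) ∉ M) ∨ ∃ c, (x, c) ∈ M ∧ Prefers (G.redResList x) (h, ⟨s, hs⟩) c := by
    by_cases hc : ∃ c, (x, c) ∈ M
    · obtain ⟨c, hc⟩ := hc
      exact Or.inr ⟨c, hc, hd c hc⟩
    · exact Or.inl (not_exists.1 hc)
  have hat : residentsOf M ((h, ⟨s, hs⟩) : G.Copy) = G.atLevel M h s := by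
    ext y
    rw [mem_residentsOf, mem_atLevel]
    exact ⟨fun h1 => ⟨hs, h1⟩, fun ⟨_, h1⟩ => h1⟩
  have hn : ¬ ((residentsOf M ((h, ⟨s, hs⟩) : G.Copy)).card < G.levelCap h s ∨
      ∃ y ∈ residentsOf M ((h, ⟨s, hs⟩) : G.Copy), Prefers (G.redHospList (h, ⟨s, hs⟩)) x y) :=
    fun h1 => hnb ⟨hx, hdis, h1⟩
  rw [hat] at hn
  push Not at hn
  refine ⟨hn.1, fun y hy => ?_⟩
  have hne : y ≠ x := by
    rintro rfl
    obtain ⟨_, h1⟩ := mem_atLevel.1 hy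
    exact (hd _ h1).ne rfl
  have := (Prefers.trichotomy (mem_redHospList_of_mem_atLevel hst.1.1 hs hy)
    ((G.red_mem_iff _ _).1 hx) hne).resolve_right (hn.2 y hy)
  exact (G.prefers_redHospList.1 this).2.2

theorem dummy_partner (hM : G.reduction.IsMatching M) {h : H} {s : ℕ} (hs : s + 1 < G.numLevels)
    (i : Fin (G.levelCap h s)) {c : G.Copy} (hc : (G.dummy h s hs i, c) ∈ M) :
    c = (h, ⟨s, by omega⟩) ∨ (c = (h, ⟨s + 1, hs⟩) ∧ G.numShort h s ≤ i.val) := by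
  have h1 : c ∈ G.redResList (G.dummy h s hs i) := hM.1 _ hc
  rw [redResList_dummy] at h1
  split_ifs at h1 with h2
  · simp at h1; exact Or.inl h1
  · simp at h1
    rcases h1 with h1 | h1
    · exact Or.inl h1
    · exact Or.inr ⟨h1, by omega⟩

/-- Below the top level, all copies are full. -/
theorem card_atLevel_eq (hst : G.reduction.IsStable M) (h : H) {s : ℕ}
    (hs : s + 1 < G.numLevels) : (G.atLevel M h s).card = G.levelCap h s := by
  refine le_antisymm (card_atLevel_le hst.1 h (by omega)) ?_
  by_contra! hlt
  -- The level-`s` dummies are as many as the places of `h^s` and all rank it first, so a free place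
  -- would attract every one of them.
  have hsub : G.levelDummies h s ⊆ G.atLevel M h s := by
    intro x hx
    obtain ⟨_, i, rfl⟩ := mem_levelDummies.1 hx
    by_contra hn
    refine absurd (full_of_isStable hst (by omega : s < G.numLevels) (x := G.dummy h s hs i)
      (by rw [redResList_dummy]; split_ifs <;> simp) fun c hc => ?_).1 (not_le.2 hlt)
    rcases dummy_partner hst.1 hs i hc with rfl | ⟨rfl, h1⟩
    · exact absurd (mem_atLevel.2 ⟨_, hc⟩) hn
    · rw [redResList_dummy, if_neg (by omega)]
      simp [Prefers]
  have := Finset.card_le_card hsub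
  rw [card_levelDummies h hs] at this
  omega

/-- An unmatched one would find `h^{s+1}` filled by residents of higher rank, which can only be
other dummies of level `s`; these are too few to fill it. -/
theorem long_dummy_matched (hst : G.reduction.IsStable M) (hq : ∀ h, G.lower h ≤ G.upper h)
    (h : H) {s : ℕ} (hs : s + 1 < G.numLevels) {x : G.Res} (hx : x ∈ G.prevDummies h (s + 1)) :
    x ∈ G.atLevel M h s ∨ x ∈ G.atLevel M h (s + 1) := by
  by_contra! hn
  obtain ⟨t, _, i, h1, h2, rfl⟩ := mem_prevDummies.1 hx
  obtain rfl : t = s := by omega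
  have hnm : ∀ c, (G.dummy h t hs i, c) ∉ M := by
    intro c hc
    rcases dummy_partner hst.1 hs i hc with rfl | ⟨rfl, h1⟩
    · exact hn.1 (mem_atLevel.2 ⟨_, hc⟩)
    · exact hn.2 (mem_atLevel.2 ⟨_, hc⟩)
  obtain ⟨h3, h4⟩ := full_of_isStable hst hs (h := h) (x := G.dummy h t hs i)
    (by rw [redResList_dummy, if_neg (by omega)]; simp) (fun c hc => absurd hc (hnm c))
  have h5 : G.atLevel M h (t + 1) ⊂ G.prevDummies h (t + 1) := by
    refine Finset.ssubset_iff_subset_ne.2 ⟨fun y hy => ?_, fun he => hn.2 (by rw [he]; exact hx)⟩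
    have h6 := h4 y hy
    rw [copyKey_dummy, if_neg (by omega)] at h6
    rcases (G.mem_redHospList hs).1 (mem_redHospList_of_mem_atLevel hst.1.1 hs hy) with
        ⟨r, _, rfl⟩ | ⟨h7, j, rfl⟩ | h7
    · rw [copyKey, Prod.Lex.toLex_lt_toLex] at h6
      simp at h6
    · rw [copyKey_dummy, if_pos rfl, Prod.Lex.toLex_lt_toLex] at h6
      simp at h6
    · exact mem_prevDummies.2 h7
  have h6 := Finset.card_lt_card h5
  rw [card_prevDummies hq h hs] at h6
  omega

/-- The level-`s` dummies are as many as the places of the full copy `h^s`, so those that move on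
are at most as many as the others holding its places: residents at level `s` and dummies from below.
Induction on the level finishes. -/
theorem card_prevDummies_le (hst : G.reduction.IsStable M) (h : H) (s : ℕ)
    (hs : s < G.numLevels) : (G.prevDummies h s ∩ G.atLevel M h s).card ≤
      (realsBelow (G.placeOf M) h s).card := by
  induction s with
  | zero => simp [prevDummies_zero]
  | succ s ih =>
    have h1 := ih (by omega)
    have h2 := card_atLevel hst.1.1 hst.1.2.1 h (by omega : s < G.numLevels)
    rw [card_atLevel_eq hst h hs] at h2
    have h3 : (G.prevDummies h (s + 1) ∩ G.atLevel M h (s + 1)).card +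
        (G.levelDummies h s ∩ G.atLevel M h s).card ≤ G.levelCap h s := by
      rw [← card_levelDummies h hs, ← Finset.card_union_of_disjoint]
      · refine Finset.card_le_card (Finset.union_subset (fun x hx => ?_) Finset.inter_subset_left)
        obtain ⟨t, ht, i, h4, _, rfl⟩ := mem_prevDummies.1 (Finset.mem_inter.1 hx).1
        obtain rfl : t = s := by omega
        exact mem_levelDummies.2 ⟨ht, i, rfl⟩
      · rw [Finset.disjoint_left]
        intro x hx hx'
        have := eq_of_mem_atLevel hst.1 (Finset.mem_inter.1 hx).2 (Finset.mem_inter.1 hx').2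
        omega
    rw [card_realsBelow_succ]
    omega

/-- Together with `card_prevDummies_le`, this determines how many places of `h^s` the dummies from
below occupy. Either every dummy that lists `h^{s+1}` goes there and fills it, or no level-`s` dummy
remains unmatched, and the count of `card_prevDummies_le` becomes exact. -/
theorem min_le_card_prevDummies (hst : G.reduction.IsStable M) (hq : ∀ h, G.lower h ≤ G.upper h)
    (h : H) (s : ℕ) (hs : s < G.numLevels) :
    min (G.levelCap h s) (realsBelow (G.placeOf M) h s).card ≤
      (G.prevDummies h s ∩ G.atLevel M h s).card := by
  induction s with
  | zero => simp [realsBelow_zero]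
  | succ s ih =>
    have h1 := ih (by omega)
    have h2 := card_atLevel hst.1.1 hst.1.2.1 h (by omega : s < G.numLevels)
    rw [card_atLevel_eq hst h hs] at h2
    have h0 := G.levelCap_anti hq h (Nat.le_add_right s 1)
    rw [card_realsBelow_succ]
    by_cases hl : ∃ x ∈ G.prevDummies h (s + 1), x ∈ G.atLevel M h s
    · obtain ⟨x, hx, hxs⟩ := hl
      obtain ⟨t, _, i, h3, h4, rfl⟩ := mem_prevDummies.1 hx
      obtain rfl : t = s := by omega
      have h5 : G.levelDummies h t ⊆ (G.levelDummies h t ∩ G.atLevel M h t) ∪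
          (G.prevDummies h (t + 1) ∩ G.atLevel M h (t + 1)) := by
        intro y hy
        rw [Finset.mem_union, Finset.mem_inter, Finset.mem_inter]
        obtain ⟨_, j, rfl⟩ := mem_levelDummies.1 hy
        by_cases hj : G.numShort h t ≤ j.val
        · have h6 := mem_prevDummies.2 ⟨t, hs, j, rfl, hj, rfl⟩
          rcases long_dummy_matched hst hq h hs h6 with h7 | h7
          · exact Or.inl ⟨hy, h7⟩
          · exact Or.inr ⟨h6, h7⟩
        · refine Or.inl ⟨hy, ?_⟩
          by_contra hn
          -- A short dummy has a smaller index than the long dummy in `h^s`, so the copy would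
          -- rather take it.
          have h6 := (full_of_isStable hst (by omega : t < G.numLevels) (x := G.dummy h t hs j)
            (by rw [redResList_dummy]; split_ifs <;> simp) fun c hc => ?_).2 _ hxs
          · rw [copyKey_dummy, copyKey_dummy, Prod.Lex.toLex_lt_toLex] at h6
            simp at h6
            omega
          · rcases dummy_partner hst.1 hs j hc with rfl | ⟨rfl, h1⟩
            · exact absurd (mem_atLevel.2 ⟨_, hc⟩) hn
            · exact absurd h1 hj
      have h6 := (Finset.card_le_card h5).trans (Finset.card_union_le _ _)
      rw [card_levelDummies h hs] at h6
      omega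
    · push Not at hl
      have h5 : G.prevDummies h (s + 1) ⊆ G.prevDummies h (s + 1) ∩ G.atLevel M h (s + 1) :=
        fun x hx => Finset.mem_inter.2 ⟨hx,
          (long_dummy_matched hst hq h hs hx).resolve_left (hl x hx)⟩
      have h6 := Finset.card_le_card h5
      rw [card_prevDummies hq h hs] at h6
      omega

/-- If `r` is placed in `h^s`, the dummies from below leave a place free for it, so they are as many
as the residents at lower levels, and `keep` is the capacity bound. If `r` desires `h^s`, that copy
is full without dummies of its own level; the dummies from below are at most as many as the
residents at lower levels, which gives `full`. -/
theorem levelStable_placeOf (hst : G.reduction.IsStable M) (hq : ∀ h, G.lower h ≤ G.upper h) :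
    G.LevelStable (G.placeOf M) := by
  refine ⟨?_, ?_, ?_⟩
  · intro r h s hr
    obtain ⟨hs, h1⟩ := mem_atLevel.1 ((placeOf_eq_some hst.1.2.1).1 hr)
    exact ⟨G.mem_redResList_inl.1 (hst.1.1 _ h1), hs⟩
  · intro r h s hr
    obtain ⟨hs, -⟩ := mem_atLevel.1 ((placeOf_eq_some hst.1.2.1).1 hr)
    have h1 := min_le_card_prevDummies hst hq h s hs
    have h2 := card_atLevel hst.1.1 hst.1.2.1 h hs
    have h3 := card_atLevel_le hst.1 h hs
    have h4 : 0 < (realsAt (G.placeOf M) h s).card := Finset.card_pos.2 ⟨r, mem_realsAt.2 hr⟩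
    have h5 : (G.above (G.placeOf M) h s r).card < (realsBelow (G.placeOf M) h (s + 1)).card := by
      rw [realsBelow_succ_eq]
      refine Finset.card_lt_card (Finset.ssubset_iff_subset_ne.2
        ⟨LevelStable.above_subset_upTo G _ h s r, fun he => ?_⟩)
      have : r ∈ G.above (G.placeOf M) h s r := by rw [he]; exact mem_upTo.2 ⟨s, hr, le_rfl⟩
      obtain ⟨t, h6, h7⟩ := mem_above.1 this
      rw [hr] at h6
      simp at h6
      rcases h7 with h7 | h7
      · omega
      · exact h7.2.ne rfl
    rw [card_realsBelow_succ] at h5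
    omega
  · intro r h s hs hd
    obtain ⟨h1, h2⟩ := full_of_isStable hst hs (x := Sum.inl r) (G.mem_redResList_inl.2 hd.1) (by
      rintro ⟨h', t⟩ hc
      have h3 := hd.2 h' t ((placeOf_eq_some hst.1.2.1).2 (mem_atLevel.2 ⟨t.2, hc⟩))
      exact G.prefers_redResList_inl.2 ⟨hd.1, G.mem_redResList_inl.1 (hst.1.1 _ hc), h3⟩)
    have h3 := card_atLevel hst.1.1 hst.1.2.1 h hs
    have h4 : G.levelDummies h s ∩ G.atLevel M h s = ∅ := by
      rw [Finset.eq_empty_iff_forall_notMem]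
      intro x hx
      rw [Finset.mem_inter] at hx
      obtain ⟨h5, i, rfl⟩ := mem_levelDummies.1 hx.1
      have h6 := h2 _ hx.2
      rw [copyKey_dummy, copyKey, if_pos rfl, Prod.Lex.toLex_lt_toLex] at h6
      simp at h6
    rw [h4, Finset.card_empty] at h3
    have h5 := card_prevDummies_le hst h s hs
    have h6 : (realsBelow (G.placeOf M) h (s + 1)).card ≤
        (G.above (G.placeOf M) h s r).card := by
      refine Finset.card_le_card fun x hx => ?_
      obtain ⟨t, h7, h8⟩ := mem_realsBelow.1 hx
      refine mem_above.2 ⟨t, h7, ?_⟩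
      rcases (Nat.lt_succ_iff.1 h8).lt_or_eq with h9 | rfl
      · exact Or.inl h9
      · have h9 := h2 _ ((placeOf_eq_some hst.1.2.1).1 h7)
        rw [copyKey, copyKey, Prod.Lex.toLex_lt_toLex] at h9
        simp at h9
        refine Or.inr ⟨rfl, ?_, (G.mem_iff r h).1 hd.1, h9⟩
        obtain ⟨hs', h10⟩ := mem_atLevel.1 ((placeOf_eq_some hst.1.2.1).1 h7)
        exact (G.mem_iff x h).1 (G.mem_redResList_inl.1 (hst.1.1 _ h10))
    rw [card_realsBelow_succ] at h6
    omega

end HRLQ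

end StableToPlacement

/-! ### Level stable placements give stable matchings of `G''`. -/

section PlacementToStable

variable {R : Type u} {H : Type v} [Fintype R] [Fintype H] [DecidableEq R] [DecidableEq H]

namespace HRLQ

open Classical in
/-- The matching of the reduced instance with given places of the residents. The level-`s` dummies
of `h` with small indices are matched to the level-`s` copy, those with larger indices to the next
one if they list it. -/
noncomputable def stableOf (G : HRLQ R H) (pl : R → Option (H × ℕ)) : Finset (G.Res × G.Copy) :=
  Finset.univ.filter (fun e =>
    (∃ r, e.1 = Sum.inl r ∧ pl r = some (e.2.1, e.2.2.val)) ∨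
    (∃ (h : H) (t : ℕ) (ht : t + 1 < G.numLevels) (i : _), e.1 = G.dummy h t ht i ∧
      (e.2 = (h, ⟨t, by omega⟩) ∧ i.val < G.levelCap h t - (upTo pl h t).card ∨
       e.2 = (h, ⟨t + 1, ht⟩) ∧ G.levelCap h t - (upTo pl h t).card ≤ i.val ∧
         G.numShort h t ≤ i.val)))

variable {G : HRLQ R H} {pl : R → Option (H × ℕ)}

theorem inl_mem_stableOf {r : R} {c : G.Copy} :
    (Sum.inl r, c) ∈ G.stableOf pl ↔ pl r = some (c.1, c.2.val) := by
  simp only [stableOf, Finset.mem_filter, Finset.mem_univ, true_and]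
  simp [dummy]

theorem dummy_mem_stableOf {h : H} {t : ℕ} {ht : t + 1 < G.numLevels} {i : Fin (G.levelCap h t)}
    {c : G.Copy} : (G.dummy h t ht i, c) ∈ G.stableOf pl ↔
      (c = (h, ⟨t, by omega⟩) ∧ i.val < G.levelCap h t - (upTo pl h t).card ∨
       c = (h, ⟨t + 1, ht⟩) ∧ G.levelCap h t - (upTo pl h t).card ≤ i.val ∧
         G.numShort h t ≤ i.val) := by
  simp only [stableOf, Finset.mem_filter, Finset.mem_univ, true_and]
  constructor
  · rintro (⟨r, h1, _⟩ | ⟨h', t', ht', j, h1, h2⟩)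
    · cases h1
    · obtain ⟨rfl, rfl, h3⟩ := dummy_inj h1
      rwa [h3]
  · exact fun h1 => Or.inr ⟨h, t, ht, i, rfl, h1⟩

theorem res_cases (x : G.Res) : (∃ r, x = Sum.inl r) ∨
    ∃ (h : H) (t : ℕ) (ht : t + 1 < G.numLevels) (i : _), x = G.dummy h t ht i := by
  rcases x with r | ⟨h, t, i⟩
  · exact Or.inl ⟨r, rfl⟩
  · have := t.2
    exact Or.inr ⟨h, t.val, by omega, i, rfl⟩

theorem stableOf_edges (hp : G.LevelStable pl) :
    ∀ e ∈ G.stableOf pl, e.2 ∈ G.redResList e.1 := by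
  rintro ⟨x, c⟩ he
  rcases res_cases x with ⟨r, rfl⟩ | ⟨h, t, ht, i, rfl⟩
  · rw [inl_mem_stableOf] at he
    exact G.mem_redResList_inl.2 (hp.valid _ _ _ he).1
  · rw [dummy_mem_stableOf] at he
    simp only
    rw [redResList_dummy]
    rcases he with ⟨rfl, _⟩ | ⟨rfl, _, h1⟩
    · split_ifs <;> simp
    · rw [if_neg (by omega)]; simp

theorem stableOf_unique (x : G.Res) (c c' : G.Copy) (hc : (x, c) ∈ G.stableOf pl)
    (hc' : (x, c') ∈ G.stableOf pl) : c = c' := by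
  rcases res_cases x with ⟨r, rfl⟩ | ⟨h, t, ht, i, rfl⟩
  · rw [inl_mem_stableOf] at hc hc'
    rw [hc] at hc'
    simp only [Option.some.injEq, Prod.mk.injEq] at hc'
    exact Prod.ext hc'.1 (Fin.ext hc'.2)
  · rw [dummy_mem_stableOf] at hc hc'
    rcases hc with ⟨rfl, h1⟩ | ⟨rfl, h1⟩ <;> rcases hc' with ⟨rfl, h2⟩ | ⟨rfl, h2⟩
    · rfl
    · omega
    · omega
    · rfl

theorem placeOf_stableOf (hp : G.LevelStable pl) : G.placeOf (G.stableOf pl) = pl := by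
  funext r
  have h1 : ∀ h s, G.placeOf (G.stableOf pl) r = some (h, s) ↔ pl r = some (h, s) := by
    intro h s
    rw [placeOf_eq_some stableOf_unique, mem_atLevel]
    exact ⟨fun ⟨_, h1⟩ => inl_mem_stableOf.1 h1,
      fun h1 => ⟨(hp.valid _ _ _ h1).2, inl_mem_stableOf.2 h1⟩⟩
  rcases h2 : pl r with _ | ⟨h, s⟩
  · rcases h3 : G.placeOf (G.stableOf pl) r with _ | ⟨h, s⟩
    · rfl
    · rw [h1] at h3
      rw [h3] at h2
      exact absurd h2 (by simp)
  · exact (h1 h s).2 h2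

theorem card_own_stableOf (h : H) {s : ℕ} (hs : s + 1 < G.numLevels) :
    (G.levelDummies h s ∩ G.atLevel (G.stableOf pl) h s).card =
      G.levelCap h s - (upTo pl h s).card := by
  have h1 : G.levelDummies h s ∩ G.atLevel (G.stableOf pl) h s = (Finset.univ.filter
      (fun i : Fin (G.levelCap h s) => i.val < G.levelCap h s - (upTo pl h s).card)).image
      (G.dummy h s hs) := by
    ext x
    rw [Finset.mem_inter, mem_levelDummies, mem_atLevel, Finset.mem_image]
    constructor
    · rintro ⟨⟨_, i, rfl⟩, _, h2⟩
      rw [dummy_mem_stableOf] at h2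
      refine ⟨i, ?_, rfl⟩
      rcases h2 with h2 | h2
      · simpa using h2.2
      · simp at h2
    · rintro ⟨i, h2, rfl⟩
      exact ⟨⟨hs, i, rfl⟩, by omega, dummy_mem_stableOf.2 (Or.inl ⟨rfl, by simpa using h2⟩)⟩
  rw [h1, Finset.card_image_of_injective _ (dummy_injective h s hs), Fin.card_filter_val_lt]
  omega

theorem card_prev_stableOf (hq : ∀ h, G.lower h ≤ G.upper h) (h : H) {s : ℕ}
    (hs : s < G.numLevels) :
    (G.prevDummies h s ∩ G.atLevel (G.stableOf pl) h s).card =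
      min (G.levelCap h s) (realsBelow pl h s).card := by
  rcases s with _ | s
  · simp [prevDummies_zero, realsBelow_zero]
  · have h1 : G.prevDummies h (s + 1) ∩ G.atLevel (G.stableOf pl) h (s + 1) = (Finset.univ.filter
        (fun i : Fin (G.levelCap h s) => max (G.levelCap h s - (upTo pl h s).card)
          (G.numShort h s) ≤ i.val)).image (G.dummy h s hs) := by
      ext x
      rw [Finset.mem_inter, mem_prevDummies, mem_atLevel, Finset.mem_image]
      constructor
      · rintro ⟨⟨t, ht, i, h2, h3, rfl⟩, _, h4⟩
        obtain rfl : t = s := by omega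
        rw [dummy_mem_stableOf] at h4
        refine ⟨i, ?_, rfl⟩
        rcases h4 with h4 | h4
        · simp at h4
        · simpa using h4.2
      · rintro ⟨i, h2, rfl⟩
        simp only [Finset.mem_filter, Finset.mem_univ, true_and] at h2
        exact ⟨⟨s, hs, i, rfl, by omega, rfl⟩, hs,
          dummy_mem_stableOf.2 (Or.inr ⟨rfl, by omega, by omega⟩)⟩
    rw [h1, Finset.card_image_of_injective _ (dummy_injective h s hs), Fin.card_filter_le_val,
      realsBelow_succ_eq]
    -- Of the level-`s` dummies, those that move on are as many as the minimum of the residents up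
    -- to level `s` and the dummies that list the next copy.
    have := G.levelCap_sub_numShort hq h s
    omega

theorem card_atLevel_stableOf (hp : G.LevelStable pl) (hq : ∀ h, G.lower h ≤ G.upper h) (h : H)
    {s : ℕ} (hs : s < G.numLevels) :
    (G.atLevel (G.stableOf pl) h s).card ≤ G.levelCap h s ∧
    ((s + 1 < G.numLevels ∨ G.levelCap h s ≤ (upTo pl h s).card) →
      (G.atLevel (G.stableOf pl) h s).card = G.levelCap h s) := by
  have h1 := card_atLevel (stableOf_edges hp) stableOf_unique h hs
  rw [placeOf_stableOf hp, card_prev_stableOf hq h hs] at h1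
  have h2 := card_realsBelow_succ pl h s
  rw [realsBelow_succ_eq] at h2
  -- The residents up to level `s` may exceed the capacity, but then none of them is at level `s`,
  -- and dummies from below fill the copy exactly.
  have h3 : (realsAt pl h s).card = 0 ∨ (upTo pl h s).card ≤ G.levelCap h s := by
    rcases Finset.eq_empty_or_nonempty (realsAt pl h s) with h3 | ⟨r, h3⟩
    · exact Or.inl (by simp [h3])
    · exact Or.inr (hp.card_upTo_le (mem_realsAt.1 h3))
  by_cases hs' : s + 1 < G.numLevels
  · rw [card_own_stableOf h hs'] at h1
    omega
  · have h4 : (G.levelDummies h s ∩ G.atLevel (G.stableOf pl) h s).card = 0 := by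
      rw [Finset.card_eq_zero, Finset.eq_empty_iff_forall_notMem]
      intro x hx
      obtain ⟨h4, _⟩ := mem_levelDummies.1 (Finset.mem_inter.1 hx).1
      exact hs' h4
    omega

theorem residentsOf_eq_atLevel (M : Finset (G.Res × G.Copy)) (h : H) {s : ℕ}
    (hs : s < G.numLevels) : residentsOf M ((h, ⟨s, hs⟩) : G.Copy) = G.atLevel M h s := by
  ext y
  rw [mem_residentsOf, mem_atLevel]
  exact ⟨fun h1 => ⟨hs, h1⟩, fun ⟨_, h1⟩ => h1⟩

/-- A copy desired by a resident keeps no dummy of its own level, and the residents there are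
preferred by `prefers_of_desires`. A dummy matched to the next copy finds its own copy full of
higher ranks, since dummies stay there by smallest index. An unmatched dummy is short, and the same
reason applies to it. -/
theorem stableOf_isStable (hp : G.LevelStable pl) (hq : ∀ h, G.lower h ≤ G.upper h) :
    G.reduction.IsStable (G.stableOf pl) := by
  have hM : G.reduction.IsMatching (G.stableOf pl) := by
    refine ⟨stableOf_edges hp, stableOf_unique, ?_⟩
    rintro ⟨h, s, hs⟩
    rw [residentsOf_eq_atLevel]
    exact (card_atLevel_stableOf hp hq h hs).1
  refine ⟨hM, ?_⟩
  rintro x ⟨h, s, hs⟩ ⟨hx, hd, hc⟩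
  change ((h, ⟨s, hs⟩) : G.Copy) ∈ G.redResList x at hx
  replace hd : ∀ c, (x, c) ∈ G.stableOf pl →
      Prefers (G.redResList x) ((h, ⟨s, hs⟩) : G.Copy) c := by
    intro c h1
    rcases hd with hd | ⟨c', hd, h2⟩
    · exact absurd h1 (hd c)
    · rw [stableOf_unique x c c' h1 hd]
      exact h2
  rw [residentsOf_eq_atLevel] at hc
  change (G.atLevel (G.stableOf pl) h s).card < G.levelCap h s ∨ _ at hc
  have hkey : ∀ y, Prefers (G.reduction.hospList (h, ⟨s, hs⟩)) x y →
      G.copyKey h s x < G.copyKey h s y := fun y hy => (G.prefers_redHospList.1 hy).2.2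
  rcases res_cases x with ⟨r, rfl⟩ | ⟨h', t, ht, i, rfl⟩
  · have hdes : G.Desires pl r h s := by
      refine ⟨G.mem_redResList_inl.1 hx, fun h' t hr => ?_⟩
      have h1 := hd (h', ⟨t, (hp.valid _ _ _ hr).2⟩) (inl_mem_stableOf.2 hr)
      exact (G.prefers_redResList_inl.1 h1).2.2
    have hcap := hp.levelCap_le_upTo hs hdes
    have hfull := (card_atLevel_stableOf hp hq h hs).2 (Or.inr hcap)
    rcases hc with hc | ⟨y, hy, hc⟩
    · omega
    · have hk := hkey y hc
      have hy' := mem_redHospList_of_mem_atLevel (stableOf_edges hp) hs hy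
      rcases (G.mem_redHospList hs).1 hy' with ⟨r', _, rfl⟩ | ⟨h1, j, rfl⟩ |
        ⟨t, h1, j, rfl, _, rfl⟩
      · obtain ⟨_, h1⟩ := mem_atLevel.1 hy
        have h2 := (hp.prefers_of_desires hdes (inl_mem_stableOf.1 h1)).2.2
        rw [copyKey, copyKey, Prod.Lex.toLex_lt_toLex] at hk
        simp at hk
        omega
      · obtain ⟨_, h2⟩ := mem_atLevel.1 hy
        rw [dummy_mem_stableOf] at h2
        simp at h2
        omega
      · rw [copyKey, copyKey_dummy, if_neg (by omega), Prod.Lex.toLex_lt_toLex] at hk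
        simp at hk
  · have hx2 := hx
    rw [redResList_dummy] at hx2
    have hx3 : h = h' ∧ (s = t ∨ s = t + 1 ∧ G.numShort h' t ≤ i.val) := by
      split_ifs at hx2 with h1
      · simp at hx2; exact ⟨hx2.1, Or.inl hx2.2⟩
      · simp at hx2
        rcases hx2 with hx2 | hx2
        · exact ⟨hx2.1, Or.inl hx2.2⟩
        · exact ⟨hx2.1, Or.inr ⟨hx2.2, by omega⟩⟩
    obtain ⟨rfl, rfl | ⟨rfl, hi⟩⟩ := hx3
    · by_cases hi : i.val < G.levelCap h s - (upTo pl h s).card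
      · exact (hd _ (dummy_mem_stableOf.2 (Or.inl ⟨rfl, hi⟩))).ne rfl
      · have hfull := (card_atLevel_stableOf hp hq h hs).2 (Or.inl ht)
        rcases hc with hc | ⟨y, hy, hc⟩
        · omega
        · have hk := hkey y hc
          have hy' := mem_redHospList_of_mem_atLevel (stableOf_edges hp) hs hy
          rw [copyKey_dummy, if_pos rfl] at hk
          rcases (G.mem_redHospList hs).1 hy' with ⟨r', _, rfl⟩ | ⟨h1, j, rfl⟩ |
            ⟨t, h1, j, rfl, _, rfl⟩
          · rw [copyKey, Prod.Lex.toLex_lt_toLex] at hk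
            simp at hk
          · obtain ⟨_, h2⟩ := mem_atLevel.1 hy
            rw [dummy_mem_stableOf] at h2
            rw [copyKey_dummy, if_pos rfl, Prod.Lex.toLex_lt_toLex] at hk
            simp at h2 hk
            omega
          · rw [copyKey_dummy, if_neg (by omega), Prod.Lex.toLex_lt_toLex] at hk
            simp at hk
    · by_cases hi' : i.val < G.levelCap h t - (upTo pl h t).card
      · have h1 := hd _ (dummy_mem_stableOf.2 (Or.inl ⟨rfl, hi'⟩))
        rw [redResList_dummy, if_neg (by omega)] at h1
        simp [Prefers] at h1
      · exact (hd _ (dummy_mem_stableOf.2 (Or.inr ⟨rfl, by omega, hi⟩))).ne rfl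

theorem mapBack_stableOf (hp : G.LevelStable pl) (hq : ∀ h, G.lower h ≤ G.upper h) :
    G.mapBack (G.stableOf pl) = edgesOf pl := by
  rw [← edgesOf_placeOf (stableOf_isStable hp hq).1, placeOf_stableOf hp]

end HRLQ

end PlacementToStable

/-! ### Deferred acceptance on levelled copies: invariant, termination and correctness. -/

section Algorithm

variable {R : Type u} {H : Type v} [Fintype R] [Fintype H] [DecidableEq R] [DecidableEq H]

/-- A configuration of the deferred acceptance algorithm on levelled copies: the number of levels
that a resident has used up, its position on its list, and the hospital that holds it. -/
structure Config (R : Type u) (H : Type v) where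
  used : R → ℕ
  pos : R → ℕ
  cur : R → Option H

namespace HRLQ

variable (G : HRLQ R H)

/-- The level at which a resident proposes after it has used up `w` levels. -/
def levelAfter (w : ℕ) : ℕ := G.numLevels - 1 - w

/-- The places of the residents in a configuration. -/
def places (c : Config R H) (r : R) : Option (H × ℕ) :=
  (c.cur r).map (fun h => (h, G.levelAfter (c.used r)))

/-- One step of the resident `r`: it leaves its hospital if that has enough residents before `r`,
it proposes to the next hospital on its list, or it starts over one level lower. -/
noncomputable def advance (c : Config R H) (r : R) : Option (Config R H) :=
  match c.cur r with
  | some h =>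
      if G.levelCap h (G.levelAfter (c.used r)) ≤
          (G.above (G.places c) h (G.levelAfter (c.used r)) r).card then
        some { c with cur := Function.update c.cur r none
                      pos := Function.update c.pos r (c.pos r + 1) }
      else none
  | none =>
      if c.used r < G.numLevels then
        match (G.resList r)[c.pos r]? with
        | some h => some { c with cur := Function.update c.cur r (some h) }
        | none => some { c with used := Function.update c.used r (c.used r + 1)
                                pos := Function.update c.pos r 0 }
      else none

/-- The invariant of the algorithm. -/
structure Inv (c : Config R H) : Prop where
  held : ∀ r h, c.cur r = some h → c.used r < G.numLevels ∧ (G.resList r)[c.pos r]? = some h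
  pos_le : ∀ r, c.pos r ≤ (G.resList r).length
  passed : ∀ r i h w, (G.resList r)[i]? = some h → w < G.numLevels →
    (w < c.used r ∨ w = c.used r ∧ i < c.pos r) →
    G.levelCap h (G.levelAfter w) ≤ (G.above (G.places c) h (G.levelAfter w) r).card

variable {G}

theorem inv_initial : G.Inv ⟨fun _ => 0, fun _ => 0, fun _ => none⟩ :=
  ⟨by simp, by simp, by simp⟩

theorem above_mono {pl pl' : R → Option (H × ℕ)} (hpl : ∀ r p, pl r = some p → pl' r = some p)
    (h : H) (s : ℕ) (r : R) : G.above pl h s r ⊆ G.above pl' h s r := by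
  intro x hx
  obtain ⟨t, h1, h2⟩ := mem_above.1 hx
  exact mem_above.2 ⟨t, hpl _ _ h1, h2⟩

/-- Removing a resident that has enough others before it keeps enough residents before all
others. -/
theorem le_card_above_of_remove (hq : ∀ h, G.lower h ≤ G.upper h) {pl pl' : R → Option (H × ℕ)}
    {r₀ : R} {h₀ : H} {t : ℕ} (h0 : pl r₀ = some (h₀, t))
    (hpl : ∀ r, r ≠ r₀ → pl' r = pl r) (hcap : G.levelCap h₀ t ≤ (G.above pl h₀ t r₀).card)
    {r : R} {h : H} {s : ℕ} (hle : G.levelCap h s ≤ (G.above pl h s r).card) :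
    G.levelCap h s ≤ (G.above pl' h s r).card := by
  -- If `r₀` was counted, then all those before `r₀` come before `r` too, and they already reach the
  -- capacity of level `t`, which is at least that of level `s`.
  by_cases hm : r₀ ∈ G.above pl h s r
  · obtain ⟨t', h1, h2⟩ := mem_above.1 hm
    rw [h0] at h1
    simp only [Option.some.injEq, Prod.mk.injEq] at h1
    obtain ⟨rfl, rfl⟩ := h1
    refine (G.levelCap_anti hq h₀ (by omega : t ≤ s)).trans (hcap.trans
      (Finset.card_le_card fun x hx => ?_))
    obtain ⟨t', h3, h4⟩ := mem_above.1 hx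
    refine mem_above.2 ⟨t', ?_, ?_⟩
    · rw [hpl x, h3]
      rintro rfl
      rw [h0] at h3
      simp only [Option.some.injEq, Prod.mk.injEq, true_and] at h3
      rcases h4 with h4 | h4
      · omega
      · exact h4.2.ne rfl
    · rcases h2 with h2 | ⟨rfl, h2⟩
      · exact Or.inl (by omega)
      · rcases h4 with h4 | ⟨rfl, h4⟩
        · exact Or.inl h4
        · exact Or.inr ⟨rfl, h4.1, h2.2.1, h4.2.2.trans h2.2.2⟩
  · refine hle.trans (Finset.card_le_card fun x hx => ?_)
    have hne : x ≠ r₀ := by rintro rfl; exact hm hx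
    obtain ⟨t', h3, h4⟩ := mem_above.1 hx
    exact mem_above.2 ⟨t', by rw [hpl x hne, h3], h4⟩

/-- The potential of a resident. -/
def potential (G : HRLQ R H) (c : Config R H) (r : R) : ℕ :=
  (G.numLevels - c.used r) * (2 * Fintype.card H + 2) + 2 * (Fintype.card H - c.pos r) +
    (c.cur r).elim 1 (fun _ => 0)

theorem length_resList_le (r : R) : (G.resList r).length ≤ Fintype.card H :=
  (G.resList_nodup r).length_le_card

theorem sum_lt_of_eq_off {f g : R → ℕ} {r₀ : R} (hlt : f r₀ < g r₀)
    (heq : ∀ r, r ≠ r₀ → f r = g r) : ∑ r, f r < ∑ r, g r :=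
  Finset.sum_lt_sum (fun r _ => by
    by_cases hr : r = r₀
    · rw [hr]; exact hlt.le
    · exact (heq r hr).le) ⟨r₀, Finset.mem_univ _, hlt⟩

/-- Only leaving a hospital can shrink the sets counted in `passed`; `le_card_above_of_remove`
covers this case. The potential charges two per list position, one for being free, and `2|H| + 2`
per level, more than resetting the position can regain. -/
theorem Inv.advance (hq : ∀ h, G.lower h ≤ G.upper h) {c c' : Config R H} (hc : G.Inv c) {r : R}
    (ha : G.advance c r = some c') :
    G.Inv c' ∧ ∑ r, G.potential c' r < ∑ r, G.potential c r := by
  unfold HRLQ.advance at ha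
  have hlen := G.length_resList_le r
  rcases hcur : c.cur r with _ | h₀
  · simp only [hcur] at ha
    split_ifs at ha with hl
    rcases hget : (G.resList r)[c.pos r]? with _ | h₁
    · simp only [hget, Option.some.injEq] at ha
      subst ha
      have hpl : ∀ x, G.places ⟨Function.update c.used r (c.used r + 1),
          Function.update c.pos r 0, c.cur⟩ x = G.places c x := by
        intro x
        by_cases hx : x = r
        · subst hx; simp [places, hcur]
        · simp [places, hx]
      refine ⟨⟨?_, ?_, ?_⟩, sum_lt_of_eq_off (r₀ := r) ?_ ?_⟩
      · intro x h hx
        have hne : x ≠ r := by rintro rfl; rw [hcur] at hx; cases hx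
        simpa [hne] using hc.held x h hx
      · intro x
        by_cases hx : x = r
        · subst hx; simp
        · simpa [hx] using hc.pos_le x
      · intro x i h w hi hw hlt
        rw [funext hpl]
        refine hc.passed x i h w hi hw ?_
        by_cases hx : x = r
        · subst hx
          simp only [Function.update_self] at hlt
          have h1 := hc.pos_le x
          have h2 := List.getElem?_eq_none_iff.1 hget
          have h3 := (List.getElem?_eq_some_iff.1 hi).1
          omega
        · simpa [hx] using hlt
      · simp only [potential, Function.update_self, hcur, Option.elim_none]
        obtain ⟨k, hk⟩ : ∃ k, G.numLevels - c.used r = k + 1 :=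
          ⟨G.numLevels - c.used r - 1, by omega⟩
        rw [show G.numLevels - (c.used r + 1) = k by omega, hk, Nat.add_mul]
        omega
      · intro x hx
        simp [potential, hx]
    · simp only [hget, Option.some.injEq] at ha
      subst ha
      have hlt1 := (List.getElem?_eq_some_iff.1 hget).1
      refine ⟨⟨?_, hc.pos_le, ?_⟩, sum_lt_of_eq_off (r₀ := r) ?_ ?_⟩
      · intro x h hx
        by_cases hxr : x = r
        · subst hxr
          simp only [Function.update_self, Option.some.injEq] at hx
          subst hx
          exact ⟨hl, hget⟩
        · simp only [Function.update_of_ne hxr] at hx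
          exact hc.held x h hx
      · intro x i h w hi hw hlt
        refine (hc.passed x i h w hi hw hlt).trans (Finset.card_le_card (above_mono ?_ h _ x))
        intro y p hy
        have hne : y ≠ r := by rintro rfl; simp [places, hcur] at hy
        simpa [places, hne] using hy
      · simp [potential, hcur]
      · intro x hx
        simp [potential, hx]
  · simp only [hcur] at ha
    split_ifs at ha with hcap
    simp only [Option.some.injEq] at ha
    subst ha
    obtain ⟨hl, hget⟩ := hc.held r h₀ hcur
    have hlt1 := (List.getElem?_eq_some_iff.1 hget).1
    have h0 : G.places c r = some (h₀, G.levelAfter (c.used r)) := by simp [places, hcur]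
    have hoff : ∀ x, x ≠ r → G.places ⟨c.used, Function.update c.pos r (c.pos r + 1),
        Function.update c.cur r none⟩ x = G.places c x := by
      intro x hx; simp [places, hx]
    refine ⟨⟨?_, ?_, ?_⟩, sum_lt_of_eq_off (r₀ := r) ?_ ?_⟩
    · intro x h hx
      by_cases hxr : x = r
      · subst hxr; simp at hx
      · simp only [Function.update_of_ne hxr] at hx
        simpa [hxr] using hc.held x h hx
    · intro x
      by_cases hxr : x = r
      · subst hxr; simp only [Function.update_self]; omega
      · simpa [hxr] using hc.pos_le x
    · intro x i h w hi hw hlt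
      refine le_card_above_of_remove hq h0 hoff hcap ?_
      by_cases hxr : x = r
      · subst hxr
        simp only [Function.update_self] at hlt
        by_cases h1 : w = c.used x ∧ i = c.pos x
        · rw [h1.2, hget] at hi
          obtain rfl : h₀ = h := by simpa using hi
          rw [h1.1]
          exact hcap
        · exact hc.passed x i h w hi hw (by omega)
      · exact hc.passed x i h w hi hw (by simpa [hxr] using hlt)
    · simp only [potential, Function.update_self, hcur, Option.elim_none, Option.elim_some]
      omega
    · intro x hx
      simp [potential, hx]

/-- A stuck free resident has used up all levels, and every copy that a held resident desires lies
at a level or position already passed. In both cases `passed` yields `full`; a held resident that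
cannot leave yields `keep`. -/
theorem Inv.levelStable {c : Config R H} (hc : G.Inv c)
    (hs : ∀ r, G.advance c r = none) : G.LevelStable (G.places c) := by
  have hplace : ∀ {r h s}, G.places c r = some (h, s) →
      c.cur r = some h ∧ s = G.levelAfter (c.used r) := by
    intro r h s hr
    rw [places, Option.map_eq_some_iff] at hr
    obtain ⟨h', h1, h2⟩ := hr
    simp only [Prod.mk.injEq] at h2
    exact ⟨h2.1 ▸ h1, h2.2.symm⟩
  refine ⟨?_, ?_, ?_⟩
  · intro r h s hr
    obtain ⟨h1, rfl⟩ := hplace hr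
    obtain ⟨h2, h3⟩ := hc.held r h h1
    refine ⟨List.mem_of_getElem? h3, ?_⟩
    unfold levelAfter
    omega
  · intro r h s hr
    obtain ⟨h1, rfl⟩ := hplace hr
    have h2 := hs r
    unfold HRLQ.advance at h2
    simp only [h1] at h2
    split_ifs at h2 with h3
    omega
  · intro r h s hs' hd
    have hi : (G.resList r)[(G.resList r).idxOf h]? = some h := by
      rw [List.getElem?_eq_getElem (List.idxOf_lt_length_iff.2 hd.1)]
      simp
    have hw : G.levelAfter (G.levelAfter s) = s := by unfold levelAfter; omega
    have hw' : G.levelAfter s < G.numLevels := by unfold levelAfter; omega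
    rw [← hw]
    refine hc.passed r _ h _ hi hw' ?_
    rcases hcur : c.cur r with _ | h'
    · left
      have h2 := hs r
      unfold HRLQ.advance at h2
      simp only [hcur] at h2
      split_ifs at h2 with h3
      · split at h2 <;> simp at h2
      · omega
    · obtain ⟨h1, h2⟩ := hc.held r h' hcur
      have h3 := hd.2 h' (G.levelAfter (c.used r)) (by simp [places, hcur])
      rcases h3 with h3 | ⟨h3, h4⟩
      · left
        unfold levelAfter at h3 ⊢
        omega
      · right
        refine ⟨by unfold levelAfter at h3 ⊢; omega, ?_⟩
        have h5 := h4.2.2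
        obtain ⟨h6, h7⟩ := List.getElem?_eq_some_iff.1 h2
        rwa [← h7, (G.resList_nodup r).idxOf_getElem] at h5

theorem partner_places (c : Config R H) (r : R) :
    partner (edgesOf (G.places c)) r = c.cur r := by
  rw [partner_edgesOf, places, Option.map_map]
  simp [Function.comp_def]

end HRLQ

end Algorithm

/-! ### Addresses and contents of the cells of the input encoding. -/

section Encoding

/-- The concatenation of lists of numbers, each preceded by its length. -/
def blocks (ls : List (List ℕ)) : List ℕ := ls.flatMap (fun l => l.length :: l)

theorem blocks_append (ls ls' : List (List ℕ)) : blocks (ls ++ ls') = blocks ls ++ blocks ls' := by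
  simp [blocks]

theorem blocks_split (ls : List (List ℕ)) (i : ℕ) (hi : i < ls.length) :
    blocks ls = blocks (ls.take i) ++ (ls[i].length :: ls[i]) ++ blocks (ls.drop (i + 1)) := by
  have h : ls = ls.take i ++ ls[i] :: ls.drop (i + 1) := by simp
  calc blocks ls = blocks (ls.take i ++ ls[i] :: ls.drop (i + 1)) := congrArg blocks h
    _ = _ := by
      rw [blocks_append, List.append_assoc]
      rfl

namespace HRLQ

variable {n m : ℕ} (G : HRLQ (Fin n) (Fin m))

/-- The preference lists of the residents and of the hospitals, as lists of numbers. -/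
def prefLists : List (List ℕ) :=
  (List.finRange n).map (fun r => (G.resList r).map Fin.val) ++
  (List.finRange m).map (fun h => (G.hospList h).map Fin.val)

/-- The part of the encoding before the preference lists. -/
def header : List ℕ := [n, m] ++ List.ofFn G.upper ++ List.ofFn G.lower

/-- The address of the `i`-th preference list in the encoding. -/
def addr (i : ℕ) : ℕ := (G.header ++ blocks (G.prefLists.take i)).length

theorem encode_eq : G.encode = G.header ++ blocks G.prefLists := by
  simp [encode, header, prefLists, blocks, List.flatMap_append, List.flatMap_map]

theorem length_header : G.header.length = 2 + m + m := by
  simp [header]; omega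

theorem length_prefLists : G.prefLists.length = n + m := by
  simp [prefLists]

theorem addr_zero : G.addr 0 = 2 + m + m := by
  simp [addr, blocks, length_header]

theorem addr_top : G.addr (n + m) = G.encode.length := by
  rw [addr, encode_eq, List.take_of_length_le G.length_prefLists.le]

theorem encode_split {i : ℕ} (hi : i < G.prefLists.length) : G.encode =
    (G.header ++ blocks (G.prefLists.take i)) ++ ((G.prefLists[i].length :: G.prefLists[i]) ++
      blocks (G.prefLists.drop (i + 1))) := by
  rw [encode_eq, blocks_split _ i hi]
  simp

theorem addr_succ {i : ℕ} (hi : i < G.prefLists.length) :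
    G.addr (i + 1) = G.addr i + G.prefLists[i].length + 1 := by
  rw [addr, addr, List.take_add_one, List.getElem?_eq_getElem hi, blocks_append]
  simp [blocks]
  omega

theorem addr_add_le {i : ℕ} (hi : i < G.prefLists.length) :
    G.addr i + G.prefLists[i].length + 1 ≤ G.encode.length := by
  rw [G.encode_split hi, addr]
  simp
  omega

theorem add_le_addr (i : ℕ) (hi : i ≤ G.prefLists.length) : 2 + m + m + i ≤ G.addr i := by
  induction i with
  | zero => simp [addr_zero]
  | succ i ih =>
    have := G.addr_succ (i := i) (by omega)
    have := ih (by omega)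
    omega

theorem add_le_length_encode : 2 + m + m + (n + m) ≤ G.encode.length := by
  rw [← addr_top]
  exact G.add_le_addr _ G.length_prefLists.ge

theorem encode_addr {i : ℕ} (hi : i < G.prefLists.length) :
    G.encode.getD (G.addr i) 0 = G.prefLists[i].length := by
  rw [G.encode_split hi, addr, List.getD_append_right _ _ _ _ le_rfl]
  simp

theorem encode_addr_add {i j : ℕ} (hi : i < G.prefLists.length) (hj : j < G.prefLists[i].length) :
    G.encode.getD (G.addr i + 1 + j) 0 = G.prefLists[i][j] := by
  rw [G.encode_split hi, addr, List.getD_append_right _ _ _ _ (by omega),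
    List.getD_append _ _ _ _ (by simp; omega)]
  rw [Nat.add_assoc, Nat.add_sub_cancel_left, Nat.add_comm 1 j, List.getD_cons_succ,
    List.getD_eq_getElem _ _ hj]

theorem encode_zero : G.encode.getD 0 0 = n := by
  simp [encode]

theorem encode_one : G.encode.getD 1 0 = m := by
  simp [encode]

theorem encode_upper (h : Fin m) : G.encode.getD (2 + h) 0 = G.upper h := by
  rw [encode_eq, List.getD_append _ _ _ _ (by rw [length_header]; omega), header,
    List.getD_append _ _ _ _ (by simp; omega),
    List.getD_append_right _ _ _ _ (by simp)]
  simp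

theorem encode_lower (h : Fin m) : G.encode.getD (2 + m + h) 0 = G.lower h := by
  rw [encode_eq, List.getD_append _ _ _ _ (by rw [length_header]; omega), header,
    List.getD_append_right _ _ _ _ (by simp; omega)]
  simp [show 2 + m + h.val - (m + 1 + 1) = h.val by omega]

theorem prefLists_res (r : Fin n) (hr : r.val < G.prefLists.length) :
    G.prefLists[r.val] = (G.resList r).map Fin.val := by
  simp [prefLists]

theorem prefLists_hosp (h : Fin m) (hh : n + h.val < G.prefLists.length) :
    G.prefLists[n + h.val] = (G.hospList h).map Fin.val := by
  simp [prefLists]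

end HRLQ

end Encoding

/-! ### A weakest-precondition calculus with time for the machine. -/

section Wp

/-- The program halts, and `Q` holds of the final state and the time, counted from `t₀`. -/
def RamProgram.Wp (p : RamProgram) (Q : RamState → ℕ → Prop) (s : RamState) (t₀ : ℕ) : Prop :=
  ∃ t s', p.Runs s t s' ∧ Q s' (t₀ + t)

namespace RamProgram

variable {Q Q' : RamState → ℕ → Prop} {s : RamState} {t : ℕ}

theorem wp_const {x c : ℕ} : (const x c).Wp Q s t ↔ Q (s.setReg x c) (t + 1) :=
  ⟨fun ⟨_, _, hr, hq⟩ => by cases hr; exact hq, fun h => ⟨_, _, .const x c s, h⟩⟩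

theorem wp_plus {x y z : ℕ} :
    (plus x y z).Wp Q s t ↔ Q (s.setReg x (s.reg y + s.reg z)) (t + 1) :=
  ⟨fun ⟨_, _, hr, hq⟩ => by cases hr; exact hq, fun h => ⟨_, _, .plus x y z s, h⟩⟩

theorem wp_minus {x y z : ℕ} :
    (minus x y z).Wp Q s t ↔ Q (s.setReg x (s.reg y - s.reg z)) (t + 1) :=
  ⟨fun ⟨_, _, hr, hq⟩ => by cases hr; exact hq, fun h => ⟨_, _, .minus x y z s, h⟩⟩

theorem wp_load {x y : ℕ} : (load x y).Wp Q s t ↔ Q (s.setReg x (s.mem (s.reg y))) (t + 1) :=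
  ⟨fun ⟨_, _, hr, hq⟩ => by cases hr; exact hq, fun h => ⟨_, _, .load x y s, h⟩⟩

theorem wp_store {x y : ℕ} : (store x y).Wp Q s t ↔ Q (s.setMem (s.reg x) (s.reg y)) (t + 1) :=
  ⟨fun ⟨_, _, hr, hq⟩ => by cases hr; exact hq, fun h => ⟨_, _, .store x y s, h⟩⟩

theorem wp_seq {p q : RamProgram} :
    (seq p q).Wp Q s t ↔ p.Wp (fun s' t' => q.Wp Q s' t') s t := by
  constructor
  · rintro ⟨_, _, hr, hq⟩
    cases hr with
    | seq _ _ _ s' _ t₁ t₂ h1 h2 => exact ⟨t₁, s', h1, t₂, _, h2, by rwa [Nat.add_assoc]⟩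
  · rintro ⟨t₁, s', h1, t₂, s'', h2, hq⟩
    exact ⟨_, _, .seq _ _ _ _ _ _ _ h1 h2, by rwa [← Nat.add_assoc]⟩

theorem wp_branch {x : ℕ} {p q : RamProgram} :
    (branch x p q).Wp Q s t ↔ if s.reg x = 0 then q.Wp Q s (t + 1) else p.Wp Q s (t + 1) := by
  split_ifs with h0
  · constructor
    · rintro ⟨_, _, hr, hq⟩
      cases hr with
      | branch_pos _ _ _ _ _ _ h1 h2 => exact absurd h0 h1
      | branch_zero _ _ _ _ _ t₁ h1 h2 =>
        exact ⟨t₁, _, h2, by rwa [Nat.add_assoc, Nat.add_comm 1]⟩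
    · rintro ⟨t₁, s', h1, hq⟩
      exact ⟨_, _, .branch_zero _ _ _ _ _ _ h0 h1, by rwa [Nat.add_comm t₁, ← Nat.add_assoc]⟩
  · constructor
    · rintro ⟨_, _, hr, hq⟩
      cases hr with
      | branch_pos _ _ _ _ _ t₁ h1 h2 =>
        exact ⟨t₁, _, h2, by rwa [Nat.add_assoc, Nat.add_comm 1]⟩
      | branch_zero _ _ _ _ _ _ h1 h2 => exact absurd h1 h0
    · rintro ⟨t₁, s', h1, hq⟩
      exact ⟨_, _, .branch_pos _ _ _ _ _ _ h0 h1, by rwa [Nat.add_comm t₁, ← Nat.add_assoc]⟩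

theorem Wp.mono {p : RamProgram} (h : p.Wp Q s t) (hQ : ∀ s' t', Q s' t' → Q' s' t') :
    p.Wp Q' s t :=
  let ⟨t₁, s', h1, h2⟩ := h; ⟨t₁, s', h1, hQ _ _ h2⟩

/-- A loop with an invariant `I` that bounds the number of its iterations, each of at most `T`
steps. -/
theorem wp_loop_bounded {x k : ℕ} {p : RamProgram} (I : ℕ → RamState → Prop) (T : ℕ)
    (hI : I k s) (hstep : ∀ k s t, I k s → s.reg x ≠ 0 →
      p.Wp (fun s' t' => (∃ k' < k, I k' s') ∧ t' ≤ t + T) s t)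
    (hpost : ∀ k' s' t', I k' s' → s'.reg x = 0 → t' ≤ t + (k * (T + 1) + 1) → Q s' t') :
    (loop x p).Wp Q s t := by
  suffices h : ∃ t₁ s' k', (loop x p).Runs s t₁ s' ∧ I k' s' ∧ s'.reg x = 0 ∧
      t₁ ≤ k * (T + 1) + 1 by
    obtain ⟨t₁, s', k', h1, h2, h3, h4⟩ := h
    exact ⟨t₁, s', h1, hpost k' s' _ h2 h3 (by omega)⟩
  clear hpost
  induction k using Nat.strong_induction_on generalizing s with
  | _ k ih =>
    by_cases h0 : s.reg x = 0
    · exact ⟨1, s, k, .loop_zero _ _ _ h0, hI, h0, by omega⟩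
    · obtain ⟨t₁, s', h1, ⟨k', h2, h3⟩, h4⟩ := hstep k s 0 hI h0
      obtain ⟨t₂, s'', k'', h5, h6, h7, h8⟩ := ih k' h2 h3
      refine ⟨_, s'', k'', .loop_pos _ _ _ _ _ _ _ h0 h1 h5, h6, h7, ?_⟩
      have h9 := Nat.mul_le_mul_right (T + 1) (Nat.succ_le_of_lt h2)
      rw [Nat.succ_mul] at h9
      omega

/-- A loop with invariant `I` and variant `μ`, whose body takes at most `T` steps. -/
theorem wp_loop {x : ℕ} {p : RamProgram} (I : RamState → Prop) (μ : RamState → ℕ) (T : ℕ)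
    (hI : I s) (hstep : ∀ s t, I s → s.reg x ≠ 0 →
      p.Wp (fun s' t' => I s' ∧ μ s' < μ s ∧ t' ≤ t + T) s t)
    (hpost : ∀ s' t', I s' → s'.reg x = 0 → t' ≤ t + (μ s * (T + 1) + 1) → Q s' t') :
    (loop x p).Wp Q s t := by
  refine wp_loop_bounded (fun k s => I s ∧ μ s = k) T ⟨hI, rfl⟩ ?_
    fun _ s' t' h1 h2 h3 => hpost s' t' h1.1 h2 h3
  rintro k s₁ t₁ ⟨h1, rfl⟩ h2
  exact (hstep s₁ t₁ h1 h2).mono fun s' t' h3 => ⟨⟨_, h3.2.1, h3.1, rfl⟩, h3.2.2⟩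

end RamProgram

theorem RamState.setReg_reg (s : RamState) (x v y : ℕ) :
    (s.setReg x v).reg y = if y = x then v else s.reg y := by
  simp [RamState.setReg, Function.update_apply]

theorem RamState.setReg_mem (s : RamState) (x v : ℕ) : (s.setReg x v).mem = s.mem := rfl

theorem RamState.setMem_reg (s : RamState) (a v : ℕ) : (s.setMem a v).reg = s.reg := rfl

theorem RamState.setMem_mem (s : RamState) (a v b : ℕ) :
    (s.setMem a v).mem b = if b = a then v else s.mem b := by
  simp [RamState.setMem, Function.update_apply]

end Wp

/-! ### Subprograms that locate a preference list and count the residents held before a given one.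
-/

section Programs

open RamProgram

/-- Sequential composition. -/
infixr:60 " ;; " => RamProgram.seq

/-- `reg 11` becomes the address of the preference list with the number in `reg 10`. -/
def walkProgram : RamProgram :=
  plus 11 4 0 ;; plus 12 10 0 ;;
  loop 12 (load 13 11 ;; plus 11 11 13 ;; plus 11 11 1 ;; minus 12 12 1)

/-- The treatment of the list entry at the address `reg 27` by `scanProgram`. -/
def scanStep : RamProgram :=
  load 28 27 ;; minus 29 28 20 ;; minus 30 20 28 ;; plus 29 29 30 ;;
  -- Register 29 holds the absolute difference of the entry and `r`; register 25 records that `r`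
  -- has been met. Writing register 33 is an idle instruction.
  branch 29 (const 33 0) (const 25 1) ;;
  plus 30 9 28 ;; load 30 30 ;; minus 31 30 23 ;; minus 32 23 30 ;; plus 31 31 32 ;;
  branch 31 (const 33 0)
    (plus 30 5 28 ;; load 30 30 ;; minus 31 30 22 ;;
     branch 31 (plus 24 24 1)
       (minus 32 22 30 ;; plus 32 32 25 ;; branch 32 (const 33 0) (plus 24 24 1))) ;;
  plus 27 27 1 ;; minus 26 26 1

/-- `reg 24` becomes the number of residents that the hospital `reg 23 - 1`, whose list starts at
the address `reg 11`, holds before the resident `reg 20`, which has used up `reg 22` levels. -/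
def scanProgram : RamProgram :=
  const 24 0 ;; const 25 0 ;; load 26 11 ;; plus 27 11 1 ;; loop 26 scanStep

/-- The values read from memory are abstracted to `a`, `b`, `w`, which makes every branch a linear
arithmetic question. The flag `seen` is the one after the current entry, so `r` does not count
itself. -/
theorem wp_scanStep {s : RamState} {t a b w seen : ℕ} {Q : RamState → ℕ → Prop}
    (h1 : s.reg 1 = 1) (ha : s.mem (s.reg 27) = a) (hb : s.mem (s.reg 9 + a) = b)
    (hw : s.mem (s.reg 5 + a) = w) (hseen : seen = if a = s.reg 20 then 1 else s.reg 25)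
    (hQ : ∀ s' t', s'.mem = s.mem → s'.reg 25 = seen → s'.reg 26 = s.reg 26 - 1 →
      s'.reg 27 = s.reg 27 + 1 →
      s'.reg 24 = s.reg 24 +
        (if b = s.reg 23 ∧ (s.reg 22 < w ∨ w = s.reg 22 ∧ seen = 0) then 1 else 0) →
      (∀ x, x < 24 ∨ 33 < x → s'.reg x = s.reg x) → t' ≤ t + 25 → Q s' t') :
    scanStep.Wp Q s t := by
  unfold scanStep
  have hframe : ∀ x, x < 24 ∨ 33 < x → x ≠ 24 ∧ x ≠ 25 ∧ x ≠ 26 ∧ x ≠ 27 ∧ x ≠ 28 ∧ x ≠ 29 ∧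
      x ≠ 30 ∧ x ≠ 31 ∧ x ≠ 32 ∧ x ≠ 33 := by omega
  simp only [wp_seq, wp_plus, wp_load, wp_minus, wp_branch, wp_const, RamState.setReg_reg,
    RamState.setReg_mem, Nat.reduceEqDiff, reduceIte, ha, hb, hw, h1]
  split_ifs
  all_goals
    refine hQ _ _ rfl ?_ ?_ ?_ ?_ (fun x hx => ?_) (by omega)
    · simp only [RamState.setReg_reg, Nat.reduceEqDiff, reduceIte]
      split_ifs at hseen <;> omega
    · simp only [RamState.setReg_reg, Nat.reduceEqDiff, reduceIte]
    · simp only [RamState.setReg_reg, Nat.reduceEqDiff, reduceIte]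
    · simp only [RamState.setReg_reg, Nat.reduceEqDiff, reduceIte]
      split_ifs at hseen ⊢ <;> omega
    · obtain ⟨x1, x2, x3, x4, x5, x6, x7, x8, x9, x10⟩ := hframe x hx
      simp only [RamState.setReg_reg, x1, x2, x3, x4, x5, x6, x7, x8, x9, x10, if_false]

namespace HRLQ

variable {n m : ℕ} (G : HRLQ (Fin n) (Fin m))

/-- The registers with fixed contents. -/
structure Globals (s : RamState) : Prop where
  zero : s.reg 0 = 0
  one : s.reg 1 = 1
  residents : s.reg 2 = n
  hospitals : s.reg 3 = m
  lists : s.reg 4 = 2 + m + m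
  inputEnd : s.reg 5 = G.encode.length
  quotas : s.reg 6 = ∑ h, G.lower h
  levels : s.reg 7 = G.numLevels
  posBase : s.reg 8 = G.encode.length + n
  curBase : s.reg 9 = G.encode.length + n + n

/-- The memory contains the instance and the configuration `c`. -/
structure Represents (f : ℕ → ℕ) (c : Config (Fin n) (Fin m)) : Prop where
  input : ∀ a < G.encode.length, f a = G.encode.getD a 0
  used : ∀ r : Fin n, f (G.encode.length + r) = c.used r
  pos : ∀ r : Fin n, f (G.encode.length + n + r) = c.pos r
  cur : ∀ r : Fin n, f (G.encode.length + n + n + r) = (c.cur r).elim 0 (fun h => h.val + 1)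

variable {G}

theorem Globals.congr {s s' : RamState} (hs : G.Globals s) (h : ∀ x < 10, s'.reg x = s.reg x) :
    G.Globals s' where
  zero := (h 0 (by omega)).trans hs.zero
  one := (h 1 (by omega)).trans hs.one
  residents := (h 2 (by omega)).trans hs.residents
  hospitals := (h 3 (by omega)).trans hs.hospitals
  lists := (h 4 (by omega)).trans hs.lists
  inputEnd := (h 5 (by omega)).trans hs.inputEnd
  quotas := (h 6 (by omega)).trans hs.quotas
  levels := (h 7 (by omega)).trans hs.levels
  posBase := (h 8 (by omega)).trans hs.posBase
  curBase := (h 9 (by omega)).trans hs.curBase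

theorem wp_walkProgram {s : RamState} {t i : ℕ} {Q : RamState → ℕ → Prop}
    (hmem : ∀ a < G.encode.length, s.mem a = G.encode.getD a 0)
    (h0 : s.reg 0 = 0) (h1 : s.reg 1 = 1) (h4 : s.reg 4 = 2 + m + m) (hi : s.reg 10 = i)
    (hin : i ≤ n + m)
    (hQ : ∀ s' t', s'.mem = s.mem → s'.reg 11 = G.addr i →
      (∀ x, x ≠ 11 → x ≠ 12 → x ≠ 13 → s'.reg x = s.reg x) → t' ≤ t + (5 * i + 3) → Q s' t') :
    walkProgram.Wp Q s t := by
  unfold walkProgram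
  simp only [wp_seq, wp_plus]
  refine wp_loop (fun s' => s'.mem = s.mem ∧ s'.reg 12 ≤ i ∧ s'.reg 11 = G.addr (i - s'.reg 12) ∧
    ∀ x, x ≠ 11 → x ≠ 12 → x ≠ 13 → s'.reg x = s.reg x) (fun s' => s'.reg 12) 4 ?_ ?_ ?_
  · refine ⟨rfl, ?_, ?_, ?_⟩
    · simp [RamState.setReg_reg, h0, hi]
    · simp [RamState.setReg_reg, h0, h4, hi, addr_zero]
    · intro x h11 h12 h13
      simp [RamState.setReg_reg, h11, h12]
  · rintro s₁ t₁ ⟨hm, hle, haddr, hfr⟩ hne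
    simp only [wp_seq, wp_plus, wp_load, wp_minus, RamState.setReg_reg, RamState.setReg_mem]
    have hlt : i - s₁.reg 12 < G.prefLists.length := by rw [length_prefLists]; omega
    have hval : s₁.mem (s₁.reg 11) = G.prefLists[i - s₁.reg 12].length := by
      rw [hm, haddr, hmem _ (by have := G.addr_add_le hlt; omega), G.encode_addr hlt]
    have hone : s₁.reg 1 = 1 := (hfr 1 (by omega) (by omega) (by omega)).trans h1
    have hsucc := G.addr_succ hlt
    refine ⟨⟨hm, ?_, ?_, ?_⟩, ?_, by omega⟩
    · simp [hone]; omega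
    · simp only [hone, hval, Nat.reduceEqDiff, reduceIte]
      rw [haddr, show i - (s₁.reg 12 - 1) = i - s₁.reg 12 + 1 by omega, hsucc]
    · intro x h11 h12 h13
      simp [h11, h12, h13, hfr]
    · simp [hone]; omega
  · rintro s' t' ⟨hm, hle, haddr, hfr⟩ hz ht'
    refine hQ s' t' hm (by rw [haddr, hz, Nat.sub_zero]) hfr ?_
    simp [RamState.setReg_reg, h0, hi] at ht'
    omega

/-- The condition for a resident `x` to be held by `h` before `r`. -/
def heldBefore (G : HRLQ (Fin n) (Fin m)) (c : Config (Fin n) (Fin m)) (h : Fin m) (r x : Fin n) :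
    Bool :=
  decide (c.cur x = some h ∧ (c.used r < c.used x ∨
    c.used x = c.used r ∧ (G.hospList h).idxOf x < (G.hospList h).idxOf r))

/-- The machine compares used-up levels instead of levels, so the order is reversed: more levels
used means a lower level, hence being served earlier. -/
theorem card_above_eq {c : Config (Fin n) (Fin m)} (hc : G.Inv c) {r : Fin n} {h : Fin m}
    (hr : c.cur r = some h) :
    (G.above (G.places c) h (G.levelAfter (c.used r)) r).card =
      (G.hospList h).countP (G.heldBefore c h r) := by
  rw [List.countP_eq_length_filter, ← List.toFinset_card_of_nodup ((G.hospList_nodup h).filter _)]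
  congr 1
  have hmem : ∀ x, c.cur x = some h → x ∈ G.hospList h := fun x hx =>
    (G.mem_iff x h).1 (List.mem_of_getElem? (hc.held x h hx).2)
  have hlr := (hc.held r h hr).1
  ext x
  rw [mem_above, List.mem_toFinset, List.mem_filter, heldBefore, decide_eq_true_iff]
  have hpl : ∀ t, G.places c x = some (h, t) ↔
      c.cur x = some h ∧ G.levelAfter (c.used x) = t := by
    intro t
    rw [places, Option.map_eq_some_iff]
    simp
  simp only [hpl]
  constructor
  · rintro ⟨t, ⟨h1, rfl⟩, h2⟩
    have hlx := (hc.held x h h1).1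
    refine ⟨hmem x h1, h1, ?_⟩
    unfold levelAfter at h2
    rcases h2 with h2 | ⟨h2, h3⟩
    · left; omega
    · right; exact ⟨by omega, h3.2.2⟩
  · rintro ⟨h0, h1, h2⟩
    have hlx := (hc.held x h h1).1
    refine ⟨_, ⟨h1, rfl⟩, ?_⟩
    unfold levelAfter
    rcases h2 with h2 | ⟨h2, h3⟩
    · left; omega
    · right; exact ⟨by omega, hmem x h1, hmem r hr, h3⟩

theorem wp_scanProgram {s : RamState} {t : ℕ} {Q : RamState → ℕ → Prop}
    {c : Config (Fin n) (Fin m)} (hs : G.Globals s) (hmem : G.Represents s.mem c)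
    {r : Fin n} {h : Fin m} (h20 : s.reg 20 = r) (h22 : s.reg 22 = c.used r)
    (h23 : s.reg 23 = h + 1) (h11 : s.reg 11 = G.addr (n + h))
    (hQ : ∀ s' t', s'.mem = s.mem →
      s'.reg 24 = (G.hospList h).countP (G.heldBefore c h r) →
      (∀ x, x < 24 ∨ 33 < x → s'.reg x = s.reg x) → t' ≤ t + (26 * n + 5) → Q s' t') :
    scanProgram.Wp Q s t := by
  have hlt : n + h.val < G.prefLists.length := by rw [length_prefLists]; omega
  have hlen : G.prefLists[n + h.val].length = (G.hospList h).length := by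
    rw [G.prefLists_hosp h hlt, List.length_map]
  have hbound := G.addr_add_le hlt
  have hlenv : s.mem (s.reg 11) = (G.hospList h).length := by
    rw [h11, hmem.input _ (by omega), G.encode_addr hlt, hlen]
  have hlen_le : (G.hospList h).length ≤ n := by
    simpa using (G.hospList_nodup h).length_le_card
  rw [hlen] at hbound
  have hentry : ∀ k (hk : k < (G.hospList h).length),
      s.mem (s.reg 11 + 1 + k) = ((G.hospList h)[k]).val := by
    intro k hk
    rw [h11, hmem.input _ (by omega), G.encode_addr_add hlt (by omega)]
    simp [G.prefLists_hosp h hlt]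
  generalize hl : G.hospList h = l at *
  have hnd : l.Nodup := hl ▸ G.hospList_nodup h
  unfold scanProgram
  simp only [wp_seq, wp_plus, wp_const, wp_load]
  -- The list is scanned in order of preference, so among residents of the same level exactly those
  -- met before `r` are preferred to it.
  refine wp_loop (fun s' => s'.mem = s.mem ∧ s'.reg 26 ≤ l.length ∧
    s'.reg 27 = s.reg 11 + 1 + (l.length - s'.reg 26) ∧
    (s'.reg 25 = 0 ↔ l.length - s'.reg 26 ≤ l.idxOf r) ∧
    s'.reg 24 = (l.take (l.length - s'.reg 26)).countP (G.heldBefore c h r) ∧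
    ∀ x, x < 24 ∨ 33 < x → s'.reg x = s.reg x) (fun s' => s'.reg 26) 25 ?_ ?_ ?_
  · simp only [RamState.setReg_reg, RamState.setReg_mem, Nat.reduceEqDiff, reduceIte, hlenv, hs.one]
    refine ⟨trivial, le_rfl, by simp, by simp, by simp, ?_⟩
    intro x hx
    simp [show x ≠ 24 by omega, show x ≠ 25 by omega, show x ≠ 26 by omega,
      show x ≠ 27 by omega]
  · rintro s₁ t₁ ⟨hm, hle, h27, h25, h24, hfr⟩ hne
    obtain ⟨k, hk⟩ : ∃ k, l.length - s₁.reg 26 = k := ⟨_, rfl⟩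
    rw [hk] at h27 h25 h24
    have hkl : k < l.length := by omega
    have e1 : s₁.mem (s₁.reg 27) = (l[k]).val := by rw [hm, h27, hentry k hkl]
    have e2 : s₁.mem (s₁.reg 9 + (l[k]).val) =
        (c.cur l[k]).elim 0 (fun h => h.val + 1) := by
      rw [hm, hfr 9 (by omega), hs.curBase, hmem.cur]
    have e3 : s₁.mem (s₁.reg 5 + (l[k]).val) = c.used l[k] := by
      rw [hm, hfr 5 (by omega), hs.inputEnd, hmem.used]
    have e4 : s₁.reg 20 = r := (hfr 20 (by omega)).trans h20
    have e5 : s₁.reg 22 = c.used r := (hfr 22 (by omega)).trans h22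
    have e6 : s₁.reg 23 = h + 1 := (hfr 23 (by omega)).trans h23
    have e7 : s₁.reg 1 = 1 := (hfr 1 (by omega)).trans hs.one
    have hidx : l.idxOf l[k] = k := hnd.idxOf_getElem k hkl
    have hk' : l.length - (s₁.reg 26 - 1) = k + 1 := by omega
    have b1 : s₁.reg 26 - 1 ≤ l.length := by omega
    have b2 : s₁.reg 27 + 1 = s.reg 11 + 1 + (k + 1) := by omega
    have b3 : s₁.reg 26 - 1 < s₁.reg 26 := by omega
    have hcnt : (l.take (k + 1)).countP (G.heldBefore c h r) =
        (l.take k).countP (G.heldBefore c h r) +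
          if G.heldBefore c h r l[k] then 1 else 0 := by
      rw [List.take_add_one, List.getElem?_eq_getElem hkl, List.countP_append]
      simp
    have hidr : l[k] = r ↔ k = l.idxOf r := by
      constructor
      · rintro rfl; exact hidx.symm
      · intro h1
        have h2 : l.idxOf r < l.length := by omega
        have h3 := List.getElem_idxOf h2
        subst h1
        exact h3
    have hval : (l[k]).val = r.val ↔ k = l.idxOf r := by rw [← Fin.ext_iff, hidr]
    have hcurv : (c.cur l[k]).elim 0 (fun h => h.val + 1) = h.val + 1 ↔ c.cur l[k] = some h := by
      rcases c.cur l[k] with _ | h'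
      · simp
      · simp [Fin.ext_iff]
    have hheld : G.heldBefore c h r l[k] = true ↔ (c.cur l[k] = some h ∧
        (c.used r < c.used l[k] ∨ c.used l[k] = c.used r ∧ k < l.idxOf r)) := by
      rw [heldBefore, decide_eq_true_iff, hl, hidx]
    refine wp_scanStep e7 e1 e2 e3 rfl ?_
    intro s₂ t₂ m₂ f25 f26 f27 f24 ffr ht₂
    simp only [e4, hval] at f25
    simp only [e4, e5, e6, hval, hcurv] at f24
    have hs25 : s₂.reg 25 = 0 ↔ k + 1 ≤ l.idxOf r := by
      clear f24
      rw [f25]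
      split_ifs
      · simp; omega
      · rw [h25]; omega
    have hcond : (c.cur l[k] = some h ∧ (c.used r < c.used l[k] ∨ c.used l[k] = c.used r ∧
        (if k = l.idxOf r then 1 else s₁.reg 25) = 0)) ↔ G.heldBefore c h r l[k] = true := by
      rw [hheld, ← f25, hs25, Nat.succ_le_iff]
    refine ⟨⟨m₂.trans hm, f26.trans_le b1, ?_, ?_, ?_, fun x hx => ?_⟩, f26.trans_lt b3, ht₂⟩
    · rw [f26, f27, hk', b2]
    · rw [f26, hk', hs25]
    · rw [f26, hk', hcnt, f24, h24]
      simp only [hcond]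
    · rw [ffr x hx, hfr x hx]
  · rintro s' t' ⟨hm, hle, h27, h25, h24, hfr⟩ hz ht'
    refine hQ s' t' hm (by simpa [hz] using h24) hfr ?_
    simp [RamState.setReg_reg, RamState.setReg_mem, hlenv] at ht'
    omega

end HRLQ

end Programs

/-! ### One step of a resident on the machine. -/

section Programs

open RamProgram

/-- The resident `reg 20` leaves its hospital if that holds enough residents before it. -/
def heldProgram : RamProgram :=
  plus 10 2 23 ;; minus 10 10 1 ;; walkProgram ;; scanProgram ;;
  -- Register 44 is nonzero exactly if at least `∑ q⁻` levels are used up, that is, at a level below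
  -- `n`. Register 23 holds `h + 1`, so register 45 becomes `2 + h`, the address of the upper quota;
  -- adding `m` gives the lower quota.
  plus 44 22 1 ;; minus 44 44 6 ;; plus 45 1 23 ;;
  branch 44 (const 33 0) (plus 45 45 3) ;; load 45 45 ;;
  plus 46 24 1 ;; minus 46 46 45 ;;
  branch 46 (store 43 0 ;; plus 42 42 1 ;; store 41 42 ;; const 20 0) (plus 20 20 1)

/-- The free resident `reg 20` proposes to the next hospital or starts over one level lower. -/
def freeProgram : RamProgram :=
  minus 44 7 22 ;;
  branch 44
    (plus 10 20 0 ;; walkProgram ;; load 45 11 ;; minus 45 45 42 ;;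
     branch 45
       (plus 46 11 1 ;; plus 46 46 42 ;; load 46 46 ;; plus 46 46 1 ;; store 43 46 ;; const 20 0)
       (plus 22 22 1 ;; store 40 22 ;; store 41 0 ;; const 20 0))
    (plus 20 20 1)

/-- One step of the resident `reg 20`. Afterwards the search for a resident that can make a step
starts over or goes on with the next resident. -/
def roundProgram : RamProgram :=
  plus 40 5 20 ;; load 22 40 ;; plus 41 8 20 ;; load 42 41 ;; plus 43 9 20 ;; load 23 43 ;;
  branch 23 heldProgram freeProgram ;; minus 21 2 20

namespace HRLQ

variable {n m : ℕ} {G : HRLQ (Fin n) (Fin m)}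

theorem Represents.update_cur {f : ℕ → ℕ} {c : Config (Fin n) (Fin m)} (hf : G.Represents f c)
    (r : Fin n) (x : Option (Fin m)) : G.Represents
      (Function.update f (G.encode.length + n + n + r) (x.elim 0 (fun h => h.val + 1)))
      { c with cur := Function.update c.cur r x } where
  input a ha := by rw [Function.update_of_ne (by omega), hf.input a ha]
  used r' := by rw [Function.update_of_ne (by omega), hf.used r']
  pos r' := by rw [Function.update_of_ne (by omega), hf.pos r']
  cur r' := by
    by_cases h : r' = r
    · subst h; simp
    · have : r'.val ≠ r.val := fun h' => h (Fin.ext h')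
      simp only [Function.update_of_ne h]
      rw [Function.update_of_ne (by omega), hf.cur r']

theorem Represents.update_pos {f : ℕ → ℕ} {c : Config (Fin n) (Fin m)} (hf : G.Represents f c)
    (r : Fin n) (x : ℕ) : G.Represents (Function.update f (G.encode.length + n + r) x)
      { c with pos := Function.update c.pos r x } where
  input a ha := by rw [Function.update_of_ne (by omega), hf.input a ha]
  used r' := by rw [Function.update_of_ne (by omega), hf.used r']
  cur r' := by rw [Function.update_of_ne (by omega), hf.cur r']
  pos r' := by
    by_cases h : r' = r
    · subst h; simp
    · have : r'.val ≠ r.val := fun h' => h (Fin.ext h')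
      simp only [Function.update_of_ne h]
      rw [Function.update_of_ne (by omega), hf.pos r']

theorem Represents.update_used {f : ℕ → ℕ} {c : Config (Fin n) (Fin m)} (hf : G.Represents f c)
    (r : Fin n) (x : ℕ) : G.Represents (Function.update f (G.encode.length + r) x)
      { c with used := Function.update c.used r x } where
  input a ha := by rw [Function.update_of_ne (by omega), hf.input a ha]
  pos r' := by rw [Function.update_of_ne (by omega), hf.pos r']
  cur r' := by rw [Function.update_of_ne (by omega), hf.cur r']
  used r' := by
    by_cases h : r' = r
    · subst h; simp
    · have : r'.val ≠ r.val := fun h' => h (Fin.ext h')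
      simp only [Function.update_of_ne h]
      rw [Function.update_of_ne (by omega), hf.used r']

/-- The result of a step of `r` in the configuration `c`. -/
def StepResult (G : HRLQ (Fin n) (Fin m)) (c : Config (Fin n) (Fin m)) (r : Fin n)
    (s : RamState) : Prop :=
  (∃ c', G.advance c r = some c' ∧ G.Represents s.mem c' ∧ s.reg 20 = 0) ∨
  (G.advance c r = none ∧ G.Represents s.mem c ∧ s.reg 20 = r + 1)

theorem wp_heldProgram {s : RamState} {t : ℕ} {Q : RamState → ℕ → Prop}
    {c : Config (Fin n) (Fin m)} (hc : G.Inv c) (hs : G.Globals s) (hmem : G.Represents s.mem c)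
    {r : Fin n} {h : Fin m} (hr : c.cur r = some h) (h20 : s.reg 20 = r)
    (h22 : s.reg 22 = c.used r) (h23 : s.reg 23 = h + 1) (h41 : s.reg 41 = G.encode.length + n + r)
    (h42 : s.reg 42 = c.pos r) (h43 : s.reg 43 = G.encode.length + n + n + r)
    (hQ : ∀ s' t', (∀ x < 10, s'.reg x = s.reg x) → StepResult G c r s' →
      t' ≤ t + (31 * n + 5 * m + 30) → Q s' t') : heldProgram.Wp Q s t := by
  unfold heldProgram
  have hlev := (hc.held r h hr).1
  simp only [wp_seq, wp_plus, wp_minus]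
  refine wp_walkProgram (G := G) (i := n + h) hmem.input ?_ ?_ ?_ ?_ (by omega) ?_
  · simp [RamState.setReg_reg, hs.zero]
  · simp [RamState.setReg_reg, hs.one]
  · simp [RamState.setReg_reg, hs.lists]
  · simp [RamState.setReg_reg, hs.residents, hs.one, h23]
  intro s₁ t₁ m₁ a₁ f₁ ht₁
  replace f₁ : ∀ x, x ≠ 10 → x ≠ 11 → x ≠ 12 → x ≠ 13 → s₁.reg x = s.reg x := by
    intro x h1 h2 h3 h4
    rw [f₁ x h2 h3 h4]
    simp [RamState.setReg_reg, h1]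
  replace m₁ : s₁.mem = s.mem := m₁
  have hs₁ : G.Globals s₁ :=
    hs.congr fun x hx => f₁ x (by omega) (by omega) (by omega) (by omega)
  refine wp_scanProgram (G := G) (c := c) (r := r) (h := h) hs₁ (m₁ ▸ hmem)
    ((f₁ 20 (by omega) (by omega) (by omega) (by omega)).trans h20)
    ((f₁ 22 (by omega) (by omega) (by omega) (by omega)).trans h22)
    ((f₁ 23 (by omega) (by omega) (by omega) (by omega)).trans h23) a₁ ?_
  intro s₂ t₂ m₂ a₂ f₂ ht₂
  rw [← card_above_eq hc hr] at a₂
  have f₃ : ∀ x, x < 10 ∨ 13 < x ∧ x < 24 ∨ 33 < x → s₂.reg x = s.reg x := fun x hx => by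
    rw [f₂ x (by omega), f₁ x (by omega) (by omega) (by omega) (by omega)]
  have m₃ : s₂.mem = s.mem := m₂.trans m₁
  have g0 : s₂.reg 0 = 0 := (f₃ 0 (by omega)).trans hs.zero
  have g1 : s₂.reg 1 = 1 := (f₃ 1 (by omega)).trans hs.one
  have g3 : s₂.reg 3 = m := (f₃ 3 (by omega)).trans hs.hospitals
  have g6 : s₂.reg 6 = ∑ h, G.lower h := (f₃ 6 (by omega)).trans hs.quotas
  have g20 : s₂.reg 20 = r := (f₃ 20 (by omega)).trans h20
  have g22 : s₂.reg 22 = c.used r := (f₃ 22 (by omega)).trans h22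
  have g23 : s₂.reg 23 = h + 1 := (f₃ 23 (by omega)).trans h23
  have g41 : s₂.reg 41 = G.encode.length + n + r := (f₃ 41 (by omega)).trans h41
  have g42 : s₂.reg 42 = c.pos r := (f₃ 42 (by omega)).trans h42
  have g43 : s₂.reg 43 = G.encode.length + n + n + r := (f₃ 43 (by omega)).trans h43
  have hL := G.add_le_length_encode
  have hup : s₂.mem (2 + h) = G.upper h := by
    rw [m₃, hmem.input _ (by omega), G.encode_upper]
  have hlo : s₂.mem (2 + h + m) = G.lower h := by
    rw [m₃, hmem.input _ (by omega), show 2 + h.val + m = 2 + m + h by omega, G.encode_lower]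
  have haddr : 1 + (h.val + 1) = 2 + h := by omega
  have hcap : G.levelCap h (G.levelAfter (c.used r)) =
      if c.used r + 1 - ∑ h, G.lower h = 0 then G.lower h else G.upper h := by
    unfold levelCap levelAfter
    unfold numLevels at hlev ⊢
    rw [Fintype.card_fin] at hlev ⊢
    split_ifs <;> first | rfl | omega
  have hadv : G.advance c r = if G.levelCap h (G.levelAfter (c.used r)) ≤
      (G.above (G.places c) h (G.levelAfter (c.used r)) r).card then
        some { c with cur := Function.update c.cur r none
                      pos := Function.update c.pos r (c.pos r + 1) } else none := by
    unfold HRLQ.advance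
    simp only [hr]
  generalize hab : (G.above (G.places c) h (G.levelAfter (c.used r)) r).card = k at *
  have hmem' : G.Represents s₂.mem c := m₃ ▸ hmem
  have hfin : ∀ x < 10, x ≠ 20 ∧ x ≠ 33 ∧ x ≠ 42 ∧ x ≠ 44 ∧ x ≠ 45 ∧ x ≠ 46 := by omega
  simp only [wp_plus, wp_load, wp_branch, wp_const, wp_store, wp_seq, RamState.setReg_reg,
    RamState.setReg_mem, RamState.setMem_reg, Nat.reduceEqDiff, reduceIte,
    a₂, g0, g1, g3, g6, g20, g22, g23, g41, g42, g43, haddr, hup, hlo]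
  split_ifs with c1 c2 c2
  all_goals
    refine hQ _ _ (fun x hx => ?_) ?_ (by omega)
    · obtain ⟨x1, x2, x3, x4, x5, x6⟩ := hfin x hx
      simp only [RamState.setReg_reg, RamState.setMem_reg, x1, x2, x3, x4, x5, x6, if_false]
      exact f₃ x (by omega)
    · simp only [c1, if_true, if_false] at hcap
      first
      | (refine Or.inr ⟨?_, hmem', ?_⟩
         · rw [hadv, if_neg (by omega)]
         · simp only [RamState.setReg_reg, Nat.reduceEqDiff, reduceIte])
      | (refine Or.inl ⟨_, ?_, (hmem'.update_cur r none).update_pos r (c.pos r + 1), ?_⟩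
         · rw [hadv, if_pos (by omega)]
         · simp only [RamState.setReg_reg, reduceIte])

theorem wp_freeProgram {s : RamState} {t : ℕ} {Q : RamState → ℕ → Prop}
    {c : Config (Fin n) (Fin m)} (hs : G.Globals s) (hmem : G.Represents s.mem c)
    {r : Fin n} (hr : c.cur r = none) (h20 : s.reg 20 = r)
    (h22 : s.reg 22 = c.used r) (h40 : s.reg 40 = G.encode.length + r)
    (h41 : s.reg 41 = G.encode.length + n + r)
    (h42 : s.reg 42 = c.pos r) (h43 : s.reg 43 = G.encode.length + n + n + r)
    (hQ : ∀ s' t', (∀ x < 10, s'.reg x = s.reg x) → StepResult G c r s' →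
      t' ≤ t + (31 * n + 5 * m + 30) → Q s' t') : freeProgram.Wp Q s t := by
  unfold freeProgram
  have hadv : G.advance c r = if c.used r < G.numLevels then
      match (G.resList r)[c.pos r]? with
        | some h => some { c with cur := Function.update c.cur r (some h) }
        | none => some { c with used := Function.update c.used r (c.used r + 1)
                                pos := Function.update c.pos r 0 }
      else none := by
    unfold HRLQ.advance
    simp only [hr]
    rcases (G.resList r)[c.pos r]? <;> rfl
  simp only [wp_seq, wp_plus, wp_minus, wp_branch, RamState.setReg_reg, Nat.reduceEqDiff,
    reduceIte, hs.levels, h22, h20, hs.zero, hs.one]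
  split_ifs with c1
  · refine hQ _ _ (fun x hx => ?_) (Or.inr ⟨?_, hmem, ?_⟩) (by omega)
    · simp only [RamState.setReg_reg, show x ≠ 20 by omega, show x ≠ 44 by omega, if_false]
    · rw [hadv, if_neg (by omega)]
    · simp only [RamState.setReg_reg, Nat.reduceEqDiff, reduceIte]
  · refine wp_walkProgram (G := G) (i := r) hmem.input ?_ ?_ ?_ ?_ (by omega) ?_
    · simp [RamState.setReg_reg, hs.zero]
    · simp [RamState.setReg_reg, hs.one]
    · simp [RamState.setReg_reg, hs.lists]
    · simp [RamState.setReg_reg]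
    intro s₁ t₁ m₁ a₁ f₁ ht₁
    replace f₁ : ∀ x, x ≠ 10 → x ≠ 11 → x ≠ 12 → x ≠ 13 → x ≠ 44 → s₁.reg x = s.reg x := by
      intro x h1 h2 h3 h4 h5
      rw [f₁ x h2 h3 h4]
      simp [RamState.setReg_reg, h1, h5]
    replace m₁ : s₁.mem = s.mem := m₁
    have hlt : r.val < G.prefLists.length := by rw [length_prefLists]; omega
    have hlen : G.prefLists[r.val].length = (G.resList r).length := by
      rw [G.prefLists_res r hlt, List.length_map]
    have hbound := G.addr_add_le hlt
    have hlenv : s₁.mem (s₁.reg 11) = (G.resList r).length := by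
      rw [a₁, m₁, hmem.input _ (by omega), G.encode_addr hlt, hlen]
    have g0 : s₁.reg 0 = 0 := (f₁ 0 (by omega) (by omega) (by omega) (by omega)
      (by omega)).trans hs.zero
    have g1 : s₁.reg 1 = 1 := (f₁ 1 (by omega) (by omega) (by omega) (by omega)
      (by omega)).trans hs.one
    have g22 : s₁.reg 22 = c.used r := (f₁ 22 (by omega) (by omega) (by omega) (by omega)
      (by omega)).trans h22
    have g40 : s₁.reg 40 = G.encode.length + r := (f₁ 40 (by omega) (by omega) (by omega)
      (by omega) (by omega)).trans h40
    have g41 : s₁.reg 41 = G.encode.length + n + r := (f₁ 41 (by omega) (by omega) (by omega)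
      (by omega) (by omega)).trans h41
    have g42 : s₁.reg 42 = c.pos r := (f₁ 42 (by omega) (by omega) (by omega) (by omega)
      (by omega)).trans h42
    have g43 : s₁.reg 43 = G.encode.length + n + n + r := (f₁ 43 (by omega) (by omega)
      (by omega) (by omega) (by omega)).trans h43
    have hmem' : G.Represents s₁.mem c := m₁ ▸ hmem
    rw [if_pos (by omega)] at hadv
    have hfin : ∀ x < 10, x ≠ 20 ∧ x ≠ 22 ∧ x ≠ 45 ∧ x ≠ 46 := by omega
    simp only [wp_load, wp_store, wp_const, RamState.setReg_reg, RamState.setReg_mem,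
      RamState.setMem_reg, Nat.reduceEqDiff, reduceIte, hlenv, g0, g1, g22, g40, g41, g42, g43]
    split_ifs with c2
    · refine hQ _ _ (fun x hx => ?_) (Or.inl ⟨_, ?_,
        (hmem'.update_used r (c.used r + 1)).update_pos r 0, ?_⟩) (by omega)
      · obtain ⟨x1, x2, x3, -⟩ := hfin x hx
        simp only [RamState.setReg_reg, RamState.setMem_reg, x1, x2, x3, if_false]
        exact f₁ x (by omega) (by omega) (by omega) (by omega) (by omega)
      · rw [hadv, List.getElem?_eq_none (by omega)]
      · simp only [RamState.setReg_reg, reduceIte]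
    · have hpos : c.pos r < (G.resList r).length := by omega
      have hval : s₁.mem (s₁.reg 11 + 1 + c.pos r) = ((G.resList r)[c.pos r]).val := by
        rw [a₁, m₁, hmem.input _ (by omega), G.encode_addr_add hlt (by omega)]
        simp [G.prefLists_res r hlt]
      rw [hval]
      refine hQ _ _ (fun x hx => ?_) (Or.inl ⟨_, ?_,
        hmem'.update_cur r (some (G.resList r)[c.pos r]), ?_⟩) (by omega)
      · obtain ⟨x1, -, x3, x4⟩ := hfin x hx
        simp only [RamState.setReg_reg, RamState.setMem_reg, x1, x3, x4, if_false]
        exact f₁ x (by omega) (by omega) (by omega) (by omega) (by omega)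
      · rw [hadv, List.getElem?_eq_getElem hpos]
      · simp only [RamState.setReg_reg, reduceIte]

theorem wp_roundProgram {s : RamState} {t : ℕ} {Q : RamState → ℕ → Prop}
    {c : Config (Fin n) (Fin m)} (hc : G.Inv c) (hs : G.Globals s) (hmem : G.Represents s.mem c)
    {r : Fin n} (h20 : s.reg 20 = r)
    (hQ : ∀ s' t', G.Globals s' → StepResult G c r s' → s'.reg 21 = n - s'.reg 20 →
      t' ≤ t + (31 * n + 5 * m + 38) → Q s' t') : roundProgram.Wp Q s t := by
  unfold roundProgram
  have hpost : ∀ s' t', (∀ x < 10, s'.reg x = s.reg x) → StepResult G c r s' →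
      t' ≤ t + 7 + (31 * n + 5 * m + 30) → (minus 21 2 20).Wp Q s' t' := by
    intro s' t' hfr hres ht
    rw [wp_minus]
    refine hQ _ _ (hs.congr fun x hx => ?_) ?_ ?_ (by omega)
    · rw [RamState.setReg_reg, if_neg (by omega), hfr x hx]
    · simpa only [StepResult, RamState.setReg_reg, RamState.setReg_mem, Nat.reduceEqDiff,
        reduceIte] using hres
    · simp only [RamState.setReg_reg, Nat.reduceEqDiff, reduceIte]
      rw [hfr 2 (by omega), hs.residents]
  simp only [wp_seq, wp_plus, wp_load, wp_branch, RamState.setReg_reg, RamState.setReg_mem,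
    Nat.reduceEqDiff, reduceIte, hs.inputEnd, hs.posBase, hs.curBase, h20, hmem.used, hmem.pos,
    hmem.cur]
  rcases hr : c.cur r with _ | h
  · rw [if_pos (by simp)]
    refine wp_freeProgram (G := G) (c := c) (r := r) (hs.congr fun x hx => ?_) hmem hr ?_ ?_ ?_ ?_
      ?_ ?_ fun s' t' hfr hres ht => hpost s' t' (fun x hx => (hfr x hx).trans ?_) hres (by omega)
    all_goals
      simp only [RamState.setReg_reg, Nat.reduceEqDiff, reduceIte, h20]
    · simp only [show x ≠ 22 by omega, show x ≠ 23 by omega, show x ≠ 40 by omega,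
        show x ≠ 41 by omega, show x ≠ 42 by omega, show x ≠ 43 by omega, if_false]
    · simp only [show x ≠ 22 by omega, show x ≠ 23 by omega, show x ≠ 40 by omega,
        show x ≠ 41 by omega, show x ≠ 42 by omega, show x ≠ 43 by omega, if_false]
  · rw [if_neg (by simp)]
    refine wp_heldProgram (G := G) (c := c) (r := r) (h := h) hc (hs.congr fun x hx => ?_) hmem hr
      ?_ ?_ ?_ ?_ ?_ ?_
      fun s' t' hfr hres ht => hpost s' t' (fun x hx => (hfr x hx).trans ?_) hres (by omega)
    all_goals
      simp only [RamState.setReg_reg, Nat.reduceEqDiff, reduceIte, h20, Option.elim_some]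
    · simp only [show x ≠ 22 by omega, show x ≠ 23 by omega, show x ≠ 40 by omega,
        show x ≠ 41 by omega, show x ≠ 42 by omega, show x ≠ 43 by omega, if_false]
    · simp only [show x ≠ 22 by omega, show x ≠ 23 by omega, show x ≠ 40 by omega,
        show x ≠ 41 by omega, show x ≠ 42 by omega, show x ≠ 43 by omega, if_false]

end HRLQ

end Programs

/-! ### The complete program and its polynomial running time. -/

section Programs

open RamProgram

/-- Computation of the fixed register contents. -/
def initProgram : RamProgram :=
  const 1 1 ;; load 2 0 ;; load 3 1 ;; plus 4 1 1 ;; plus 4 4 3 ;; plus 4 4 3 ;;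
  -- Walking past all `n + m` lists ends at the length of the input, where the working arrays begin.
  plus 10 2 3 ;; walkProgram ;; plus 5 11 0 ;; plus 12 3 0 ;; plus 13 1 1 ;; plus 13 13 3 ;;
  loop 12 (load 14 13 ;; plus 6 6 14 ;; plus 13 13 1 ;; minus 12 12 1) ;;
  plus 7 2 6 ;; plus 8 5 2 ;; plus 9 8 2 ;; plus 21 2 0

/-- Copying of the final partners to the output cells. -/
def outputProgram : RamProgram :=
  const 20 0 ;; plus 21 2 0 ;; plus 22 9 0 ;;
  loop 21 (load 23 22 ;; store 20 23 ;; plus 20 20 1 ;; plus 22 22 1 ;; minus 21 21 1)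

/-- The deferred acceptance algorithm on levelled copies. -/
def matchingProgram : RamProgram := initProgram ;; loop 21 roundProgram ;; outputProgram

namespace HRLQ

variable {n m : ℕ} {G : HRLQ (Fin n) (Fin m)}

theorem wp_initProgram (G : HRLQ (Fin n) (Fin m)) {t : ℕ} {Q : RamState → ℕ → Prop}
    (hQ : ∀ s' t', G.Globals s' → s'.mem = (RamState.init G.encode).mem → s'.reg 20 = 0 →
      s'.reg 21 = n → t' ≤ t + (5 * n + 10 * m + 20) → Q s' t') :
    initProgram.Wp Q (RamState.init G.encode) t := by
  have hm : ∀ a, (RamState.init G.encode).mem a = G.encode.getD a 0 := fun _ => rfl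
  have hr : ∀ x, (RamState.init G.encode).reg x = 0 := fun _ => rfl
  generalize RamState.init G.encode = s at *
  have hL := G.add_le_length_encode
  unfold initProgram
  simp only [wp_seq, wp_const, wp_load, wp_plus, RamState.setReg_reg, RamState.setReg_mem,
    Nat.reduceEqDiff, reduceIte, hm, hr, G.encode_zero, G.encode_one]
  refine wp_walkProgram (G := G) (i := n + m) (fun a _ => hm a) ?_ ?_ ?_ ?_ le_rfl ?_
  · simp [RamState.setReg_reg, hr]
  · simp [RamState.setReg_reg]
  · simp [RamState.setReg_reg]
  · simp [RamState.setReg_reg]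
  intro s₁ t₁ m₁ a₁ f₁ ht₁
  rw [addr_top] at a₁
  replace m₁ : s₁.mem = s.mem := m₁
  simp only [RamState.setReg_reg, hr] at f₁
  have g0 : s₁.reg 0 = 0 := by rw [f₁ 0 (by omega) (by omega) (by omega)]; simp
  have g1 : s₁.reg 1 = 1 := by rw [f₁ 1 (by omega) (by omega) (by omega)]; simp
  have g2 : s₁.reg 2 = n := by rw [f₁ 2 (by omega) (by omega) (by omega)]; simp
  have g3 : s₁.reg 3 = m := by rw [f₁ 3 (by omega) (by omega) (by omega)]; simp
  have g4 : s₁.reg 4 = 2 + m + m := by rw [f₁ 4 (by omega) (by omega) (by omega)]; simp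
  have g6 : s₁.reg 6 = 0 := by rw [f₁ 6 (by omega) (by omega) (by omega)]; simp
  have g20 : s₁.reg 20 = 0 := by rw [f₁ 20 (by omega) (by omega) (by omega)]; simp
  simp only [g0, g1, g3, a₁]
  refine wp_loop (fun s' => s'.mem = s.mem ∧ s'.reg 12 ≤ m ∧
    s'.reg 13 = 2 + m + (m - s'.reg 12) ∧
    s'.reg 6 = ∑ i ∈ Finset.range (m - s'.reg 12), G.encode.getD (2 + m + i) 0 ∧
    s'.reg 0 = 0 ∧ s'.reg 1 = 1 ∧ s'.reg 2 = n ∧ s'.reg 3 = m ∧ s'.reg 4 = 2 + m + m ∧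
    s'.reg 5 = G.encode.length ∧ s'.reg 20 = 0) (fun s' => s'.reg 12) 4 ?_ ?_ ?_
  · simp [RamState.setReg_reg, RamState.setReg_mem, m₁, g0, g1, g2, g3, g4, g6, g20]
  · rintro s₂ t₂ ⟨m₂, hle, h13, h6, k0, k1, k2, k3, k4, k5, k20⟩ hne
    simp only [wp_seq, wp_load, wp_plus, wp_minus, RamState.setReg_reg, RamState.setReg_mem,
      Nat.reduceEqDiff, reduceIte, k0, k1, k2, k3, k4, k5, k20, h6, h13, m₂, hm, and_true,
      true_and, show m - (s₂.reg 12 - 1) = m - s₂.reg 12 + 1 by omega, Finset.sum_range_succ]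
    omega
  · rintro s' t' ⟨m₂, hle, h13, h6, k0, k1, k2, k3, k4, k5, k20⟩ hz ht'
    simp only [RamState.setReg_reg, Nat.reduceEqDiff, reduceIte] at ht'
    have hsum : s'.reg 6 = ∑ h, G.lower h := by
      rw [h6, hz, Nat.sub_zero, ← Fin.sum_univ_eq_sum_range
        (fun i => G.encode.getD (2 + m + i) 0)]
      exact Finset.sum_congr rfl fun h _ => G.encode_lower h
    refine hQ _ _ ?_ m₂ ?_ ?_ (by omega)
    · constructor <;>
        simp only [RamState.setReg_reg, Nat.reduceEqDiff, reduceIte, k0, k1, k2, k3, k4, k5, hsum,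
          numLevels, Fintype.card_fin]
    · simp only [RamState.setReg_reg, Nat.reduceEqDiff, reduceIte, k20]
    · simp only [RamState.setReg_reg, Nat.reduceEqDiff, reduceIte, k0, k2, Nat.add_zero]

theorem wp_outputProgram {s : RamState} {t : ℕ} {Q : RamState → ℕ → Prop}
    {c : Config (Fin n) (Fin m)} (hs : G.Globals s) (hmem : G.Represents s.mem c)
    (hQ : ∀ s' t', (∀ r : Fin n, s'.mem r = (c.cur r).elim 0 (fun h => h.val + 1)) →
      t' ≤ t + (6 * n + 4) → Q s' t') : outputProgram.Wp Q s t := by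
  have hL := G.add_le_length_encode
  unfold outputProgram
  simp only [wp_seq, wp_const, wp_plus, RamState.setReg_reg, Nat.reduceEqDiff, reduceIte, hs.zero,
    hs.residents, hs.curBase, Nat.add_zero]
  refine wp_loop (fun s' => s'.reg 1 = 1 ∧ s'.reg 21 ≤ n ∧ s'.reg 20 = n - s'.reg 21 ∧
    s'.reg 22 = G.encode.length + n + n + (n - s'.reg 21) ∧
    (∀ r : Fin n, r.val < n - s'.reg 21 → s'.mem r = (c.cur r).elim 0 (fun h => h.val + 1)) ∧
    ∀ a, n ≤ a → s'.mem a = s.mem a) (fun s' => s'.reg 21) 5 ?_ ?_ ?_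
  · simp [RamState.setReg_reg, RamState.setReg_mem, hs.one]
  · rintro s₂ t₂ ⟨h1, hle, h20, h22, hout, hrest⟩ hne
    obtain ⟨r, hr⟩ : ∃ r : Fin n, r.val = n - s₂.reg 21 := ⟨⟨n - s₂.reg 21, by omega⟩, rfl⟩
    -- The source cells lie beyond the first `n` cells, so output already written has not destroyed
    -- them.
    have hval : s₂.mem (G.encode.length + n + n + r) =
        (c.cur r).elim 0 (fun h => h.val + 1) := by
      rw [hrest _ (by omega), hmem.cur]
    rw [← hr] at h20 h22 hout
    have hr' : n - (s₂.reg 21 - 1) = r + 1 := by omega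
    simp only [wp_seq, wp_load, wp_plus, wp_minus, wp_store, RamState.setReg_reg,
      RamState.setReg_mem, RamState.setMem_reg, RamState.setMem_mem, Nat.reduceEqDiff, reduceIte,
      h1, h20, h22, hval, hr']
    refine ⟨⟨trivial, by omega, trivial, by omega, ?_, ?_⟩, by omega, by omega⟩
    · intro r' hlt
      by_cases he : r'.val = r.val
      · rw [if_pos he, Fin.ext he]
      · rw [if_neg he]
        exact hout r' (by omega)
    · intro a ha
      rw [if_neg (by omega)]
      exact hrest a ha
  · rintro s' t' ⟨h1, hle, h20, h22, hout, hrest⟩ hz ht'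
    simp only [RamState.setReg_reg, Nat.reduceEqDiff, reduceIte] at ht'
    exact hQ s' t' (fun r => hout r (by omega)) (by omega)

/-- Cells behind the input are zero, and zero encodes the configuration before the first proposal.
-/
theorem represents_init (G : HRLQ (Fin n) (Fin m)) :
    G.Represents (RamState.init G.encode).mem ⟨fun _ => 0, fun _ => 0, fun _ => none⟩ where
  input a _ := rfl
  used r := List.getD_eq_default _ _ (by omega)
  pos r := List.getD_eq_default _ _ (by omega)
  cur r := List.getD_eq_default _ _ (by omega)

theorem wp_matchingProgram (G : HRLQ (Fin n) (Fin m)) (hq : ∀ h, G.lower h ≤ G.upper h)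
    {Q : RamState → ℕ → Prop}
    (hQ : ∀ c s' t', G.LevelStable (G.places c) →
      (∀ r : Fin n, s'.mem r = (c.cur r).elim 0 (fun h => h.val + 1)) →
      t' ≤ (n * (G.numLevels * (2 * m + 2) + 2 * m + 1) * (n + 1) + n) * (31 * n + 5 * m + 39) +
        (11 * n + 10 * m + 25) → Q s' t') :
    matchingProgram.Wp Q (RamState.init G.encode) 0 := by
  unfold matchingProgram
  rw [wp_seq]
  refine wp_initProgram G fun s₁ t₁ hs₁ hm₁ h20 h21 ht₁ => ?_
  rw [wp_seq]
  -- After a move the search restarts at resident `0`, so a unit of potential is weighted by `n + 1`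
  -- and pays for one full search. The loop stops when every resident has been found stuck since the
  -- last move.
  refine wp_loop_bounded (fun k s => G.Globals s ∧ s.reg 20 ≤ n ∧ s.reg 21 = n - s.reg 20 ∧
    ∃ c, G.Inv c ∧ G.Represents s.mem c ∧ (∀ r : Fin n, r.val < s.reg 20 → G.advance c r = none) ∧
      (∑ r, G.potential c r) * (n + 1) + (n - s.reg 20) = k) (31 * n + 5 * m + 38)
    (k := n * (G.numLevels * (2 * m + 2) + 2 * m + 1) * (n + 1) + n) ?_ ?_ ?_
  · refine ⟨hs₁, by omega, by omega, _, inv_initial, hm₁ ▸ represents_init G, by simp [h20], ?_⟩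
    simp [potential, h20]
  · rintro k s t ⟨hs, hle, h21, c, hc, hmem, hstuck, rfl⟩ hne
    have hlt : s.reg 20 < n := by omega
    refine wp_roundProgram (r := ⟨s.reg 20, hlt⟩) hc hs hmem rfl fun s' t' hs' hres h21' ht' => ?_
    refine ⟨?_, ht'⟩
    rcases hres with ⟨c', ha, hmem', h0⟩ | ⟨ha, hmem', h0⟩
    · obtain ⟨hc', hpot⟩ := hc.advance hq ha
      refine ⟨_, ?_, hs', by omega, h21', c', hc', hmem', by simp [h0], rfl⟩
      have h1 := Nat.mul_le_mul_right (n + 1) (Nat.succ_le_of_lt hpot)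
      rw [Nat.succ_mul] at h1
      omega
    · simp only at h0
      refine ⟨_, ?_, hs', by omega, h21', c, hc, hmem', fun r hr => ?_, rfl⟩
      · omega
      · rcases Nat.lt_succ_iff_lt_or_eq.1 (h0 ▸ hr) with h1 | h1
        · exact hstuck r h1
        · rw [← ha]
          congr 1
          exact Fin.ext h1
  · rintro k s t ⟨hs, hle, h21, c, hc, hmem, hstuck, -⟩ hz ht
    refine wp_outputProgram hs hmem fun s' t' hout ht' =>
      hQ c s' t' (hc.levelStable fun r => hstuck r (by omega)) hout ?_
    rw [show 31 * n + 5 * m + 38 + 1 = 31 * n + 5 * m + 39 by omega] at ht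
    omega

end HRLQ

/-- A polynomial bound for the time of `matchingProgram`. -/
noncomputable def timeBound : Polynomial ℕ :=
  (.X * (2 * .X * (2 * .X + 2) + 2 * .X + 1) * (.X + 1) + .X) * (36 * .X + 39) + (21 * .X + 25)

theorem HRLQ.exists_stable_computation {n m : ℕ} (G : HRLQ (Fin n) (Fin m))
    (hN : ∃ N, G.IsFeasible N) :
    ∃ M'' : Finset (G.Res × G.Copy), G.reduction.IsStable M'' ∧
      ∃ (t : ℕ) (s : RamState), matchingProgram.Runs (RamState.init G.encode) t s ∧
        t ≤ timeBound.eval G.encode.length ∧ s.Outputs (G.mapBack M'') := by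
  obtain ⟨N, hN⟩ := hN
  have hq := hN.lower_le_upper
  obtain ⟨t, s, hrun, c, hp, hout, ht⟩ := G.wp_matchingProgram hq
    (Q := fun s t => ∃ c, G.LevelStable (G.places c) ∧
      (∀ r : Fin n, s.mem r = (c.cur r).elim 0 (fun h => h.val + 1)) ∧
      t ≤ (n * (G.numLevels * (2 * m + 2) + 2 * m + 1) * (n + 1) + n) * (31 * n + 5 * m + 39) +
        (11 * n + 10 * m + 25)) fun c s t h1 h2 h3 => ⟨c, h1, h2, h3⟩
  refine ⟨G.stableOf (G.places c), HRLQ.stableOf_isStable hp hq, t, s, hrun, ?_, fun r => ?_⟩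
  · rw [Nat.zero_add] at ht
    refine ht.trans ?_
    have hL := G.add_le_length_encode
    -- A feasible matching bounds `∑ q⁻` by `n`. Without this the number of levels could be
    -- exponential in the bit length of the quotas, and unbounded in `L`.
    have hl : G.numLevels ≤ 2 * G.encode.length := by
      have h1 := hN.sum_lower_le
      rw [Fintype.card_fin] at h1
      rw [HRLQ.numLevels, Fintype.card_fin]
      omega
    generalize G.encode.length = L at *
    have hn : n ≤ L := by omega
    have hm : m ≤ L := by omega
    simp only [timeBound, Polynomial.eval_add, Polynomial.eval_mul, Polynomial.eval_X,
      Polynomial.eval_ofNat, Polynomial.eval_one]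
    gcongr <;> omega
  · rw [HRLQ.mapBack_stableOf hp hq, HRLQ.partner_places, hout]

end Programs

theorem mainTheorem7 :
    (∀ (R : Type u) (H : Type v) [Fintype R] [Fintype H] [DecidableEq R] [DecidableEq H]
      (G : HRLQ R H) (M'' : Finset (G.Res × G.Copy)), G.reduction.IsStable M'' →
      (∃ N, G.IsFeasible N) →
      (∀ (σ τ : Correspondence R H) (N : Finset (R × H)), G.IsFeasible N →
        ∀ ρ : List (R × H),
          (IsAltCycle σ (G.mapBack M'') N ρ ∨
            (IsAltPath σ (G.mapBack M'') N ρ ∧ OneEndMatched (G.mapBack M'') ρ)) →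
          G.IsFeasible (G.mapBack M'' ∆ ρ.toFinset) ∧
          G.votes τ (G.mapBack M'' ∆ ρ.toFinset) (G.mapBack M'') ≤
            G.votes τ (G.mapBack M'') (G.mapBack M'' ∆ ρ.toFinset)) ∧
      (∀ τ : Correspondence R H, G.IsPopularAmongMaxFeasible τ (G.mapBack M''))) ∧
    (∃ (P : RamProgram) (p : Polynomial ℕ), ∀ (n m : ℕ) (G : HRLQ (Fin n) (Fin m)),
      (∃ N, G.IsFeasible N) →
      ∃ M'' : Finset (G.Res × G.Copy), G.reduction.IsStable M'' ∧
        ∃ (t : ℕ) (s : RamState), P.Runs (RamState.init G.encode) t s ∧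
          t ≤ p.eval G.encode.length ∧ s.Outputs (G.mapBack M'')) := by
  refine ⟨?_, matchingProgram, timeBound, fun n m G hN => G.exists_stable_computation hN⟩
  intro R H _ _ _ _ G M'' hst hN
  obtain ⟨N₀, hN₀⟩ := hN
  have hp := HRLQ.levelStable_placeOf hst hN₀.lower_le_upper
  rw [← HRLQ.edgesOf_placeOf hst.1]
  exact ⟨fun σ τ N hN ρ hρ => hp.exchange σ τ hN hρ,
    fun τ => hp.isPopularAmongMaxFeasible τ hN₀⟩
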